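/- Let $k$ be a field and $q\in k$, $q\neq 0$. Let $A=\mathcal O_q(\mathrm{SU}(2))$ be the unital $k$-algebra generated by $\alpha,\beta,\gamma,\delta$ with relations $$\beta\alpha=q\alpha\beta,\quad \gamma\alpha=q\alpha\gamma,\quad \delta\beta=q\beta\delta,\quad \delta\gamma=q\gamma\delta,\quad \gamma\beta=\beta\gamma,\quad \delta\alpha-\alpha\delta=(q-q^{-1})\beta\gamma,\quad \alpha\delta-q^{-1}\beta\gamma=1 .$$ Let $H=k[t,t^{-1}]$ and let $\Delta_A:A\to A\otimes H$ be the algebra map with $\alpha\mapsto\alpha\otimes t$, $\beta\mapsto\beta\otimes t^{-1}$, $\gamma\mapsto\gamma\otimes t$, $\delta\mapsto\delta\otimes t^{-1}$. An element $a\in A$ has degree $n\in\mathbb Z$, $|a|=n$, if $\Delta_A(a)=a\otimes t^{n}$ (so $0$ has every degree). The Podleś sphere is $B=\{a\in A:\Delta_A(a)=a\otimes 1\}$. A differential calculus on an algebra $C$ is a differential $\mathbb N_0$-graded algebra $(\Omega^\bullet,\wedge,\mathrm d)$ with $\Omega^0=C$ and $\Omega^n=\mathrm{span}_k\{c^0\mathrm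 dc^1\wedge\dots\wedge \mathrm dc^n : c^i\in C\}$ for all $n$. On $H$ let $\Omega^\bullet(H)=H\oplus H\,\mathrm dt$ with $H\,\mathrm dt$ free on $\mathrm dt$, $\mathrm dt\, t=q^{2}t\,\mathrm dt$, $\mathrm dt\wedge \mathrm dt=0$, and $\mathrm d$ the derivation $H\to H\,\mathrm dt$ that maps $t$ to $\mathrm dt$. On $A$ let $\Omega^\bullet(A)$ be the graded algebra that is the free left $A$-module on $1$; $e^+,e^-,e^0$; $e^+\wedge e^-,e^+\wedge e^0,e^-\wedge e^0$; $e^+\wedge e^-\wedge e^0$, with $$e^\pm f=q^{|f|}fe^\pm,\quad e^0f=q^{2|f|}fe^0\quad (f\in\{\alpha,\beta,\gamma,\delta\}),\qquad e^\pm\wedge e^\pm=e^0\wedge e^0=0,$$ $$e^+\wedge e^-=-q^{-2}e^-\wedge e^+,\qquad e^\pm\wedge e^0=-q^{\mp4}e^0\wedge e^\pm,$$ and with the degree one differential, satisfying the graded Leibniz rule, that is determined by $$\mathrm d\alpha=\alpha e^0+q\beta e^+,\quad \mathrm d\beta=\alpha e^--q^{-2}\beta e^0,\quad \mathrm d\gamma=\gamma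 e^0+q\delta e^+,\quad \mathrm d\delta=\gamma e^--q^{-2}\delta e^0,$$ $$\mathrm de^\pm=\mp q^{\pm2}(1+q^{-2})\,e^\pm\wedge e^0,\qquad \mathrm de^0=q^3e^+\wedge e^- .$$ Then $\Omega^\bullet(H)$ and $\Omega^\bullet(A)$ are differential calculi on $H$ and $A$; one has $e^+=q^{-1}\alpha\,\mathrm d\gamma-q^{-2}\gamma\,\mathrm d\alpha$, $e^-=\delta\,\mathrm d\beta-q\beta\,\mathrm d\delta$, $e^0=\delta\,\mathrm d\alpha-q\beta\,\mathrm d\gamma$; and $\Omega^\bullet(A)$ is complete: $\Delta_A$ extends (uniquely) to a morphism of differential graded algebras $\Delta_A^\wedge:\Omega^\bullet(A)\to\Omega^\bullet(A)\otimes\Omega^\bullet(H)$, where $\otimes$ is the graded tensor product. Let $$\Omega^\bullet(B)=\{\omega\in\Omega^\bullet(A):\Delta_A^\wedge(\omega)=\omega\otimes1\}$$ be the base forms, and let $\Omega^n(B)=\Omega^\bullet(B)\cap\Omega^n(A)$. Then: 1. $\Omega^1(B)=\{ae^++be^- : a,b\in A,\ |a|=-2,\ |b|=2\}$; 2. every such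 form $ae^++be^-$ lies in $B\,\mathrm dB=\mathrm{span}_k\{b_0\,\mathrm db_1 : b_0,b_1\in B\}$; 3. the volume form $e^+\wedge e^-$ lies in $\mathrm{span}_k\{b_0\,\mathrm db_1\wedge\mathrm db_2 : b_0,b_1,b_2\in B\}$; 4. $\Omega^\bullet(B)$ is closed under $\wedge$ and $\mathrm d$, and with the restricted operations it is a differential calculus on $B$. -/

import Mathlib

open scoped TensorProduct

noncomputable section

namespace QHopf

/-! ### Differential graded algebras and differential calculi -/

section Calculi

variable {k A Ω Ω' : Type*} [Field k] [Ring A] [Algebra k A] [Ring Ω] [Algebra k Ω]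
  [Ring Ω'] [Algebra k Ω']

/-- `Ω` with homogeneous components `𝒜 n` (`n ∈ ℕ`) and differential `d` is a differential graded
algebra. -/
structure IsDGA (𝒜 : ℕ → Submodule k Ω) (d : Ω →ₗ[k] Ω) : Prop where
  one_mem : (1 : Ω) ∈ 𝒜 0
  mul_mem : ∀ m n : ℕ, ∀ ω ∈ 𝒜 m, ∀ η ∈ 𝒜 n, ω * η ∈ 𝒜 (m + n)
  internal : DirectSum.IsInternal 𝒜
  d_mem : ∀ n : ℕ, ∀ ω ∈ 𝒜 n, d ω ∈ 𝒜 (n + 1)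
  d_d : ∀ ω, d (d ω) = 0
  leibniz : ∀ n : ℕ, ∀ ω ∈ 𝒜 n, ∀ η, d (ω * η) = d ω * η + (-1 : k) ^ n • (ω * d η)

/-- The span of all `a⁰ da¹ ∧ ⋯ ∧ daⁿ`, where `ι` embeds the algebra `A` into the forms `Ω`. -/
def generatedForms (d : Ω →ₗ[k] Ω) (ι : A →ₐ[k] Ω) (n : ℕ) : Submodule k Ω :=
  Submodule.span k
    {ω | ∃ (a₀ : A) (a : Fin n → A), ω = ι a₀ * (List.ofFn fun i => d (ι (a i))).prod}

/-- A differential calculus on `A`: a differential graded algebra whose degree zero part is (via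
`ι`) the algebra `A`, and which is generated in degree zero. -/
structure IsDifferentialCalculus (𝒜 : ℕ → Submodule k Ω) (d : Ω →ₗ[k] Ω) (ι : A →ₐ[k] Ω) : Prop
    extends IsDGA 𝒜 d where
  ι_injective : Function.Injective ι
  range_ι : LinearMap.range ι.toLinearMap = 𝒜 0
  generated : ∀ n : ℕ, 𝒜 n = generatedForms d ι n

/-- The linear map equal to `(-1) ^ n` on the `n`-th component. -/
def parity (𝒜 : ℕ → Submodule k Ω) [GradedAlgebra 𝒜] : Ω →ₗ[k] Ω :=
  (DirectSum.toModule k ℕ Ω fun n => (-1 : k) ^ n • (𝒜 n).subtype) ∘ₗ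
    (DirectSum.decomposeLinearEquiv 𝒜).toLinearMap

/-- The differential of the graded tensor product of two differential graded algebras,
`ω ⊗ η ↦ dω ⊗ η + (-1)^|ω| ω ⊗ dη`. -/
def tensorD (𝒜 : ℕ → Submodule k Ω) (ℬ : ℕ → Submodule k Ω') [GradedAlgebra 𝒜] [GradedAlgebra ℬ]
    (d : Ω →ₗ[k] Ω) (d' : Ω' →ₗ[k] Ω') : (𝒜 ᵍ⊗[k] ℬ) →ₗ[k] (𝒜 ᵍ⊗[k] ℬ) :=
  (GradedTensorProduct.of k 𝒜 ℬ).toLinearMap ∘ₗ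
    (TensorProduct.map d LinearMap.id + TensorProduct.map (parity 𝒜) d') ∘ₗ
    (GradedTensorProduct.of k 𝒜 ℬ).symm.toLinearMap

/-- The component of total degree `n` of the graded tensor product. -/
def tensorDegree (𝒜 : ℕ → Submodule k Ω) (ℬ : ℕ → Submodule k Ω') [GradedAlgebra 𝒜]
    [GradedAlgebra ℬ] (n : ℕ) : Submodule k (𝒜 ᵍ⊗[k] ℬ) :=
  Submodule.span k
    {x | ∃ i j : ℕ, i + j = n ∧ ∃ ω ∈ 𝒜 i, ∃ η ∈ ℬ j, x = GradedTensorProduct.tmul k ω η}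

/-- `Φ : Ω(A) → Ω(A) ⊗ Ω(H)` is a morphism of differential graded algebras which extends the
coaction `Δ : A → A ⊗ H`.  A calculus on `A` is complete if such a `Φ` exists. -/
structure IsCompleteExtension {H : Type*} [Ring H] [Algebra k H]
    (𝒜 : ℕ → Submodule k Ω) (ℬ : ℕ → Submodule k Ω') [GradedAlgebra 𝒜] [GradedAlgebra ℬ]
    (d : Ω →ₗ[k] Ω) (d' : Ω' →ₗ[k] Ω') (ι : A →ₐ[k] Ω) (ι' : H →ₐ[k] Ω')
    (Δ : A →ₐ[k] A ⊗[k] H) (Φ : Ω →ₐ[k] (𝒜 ᵍ⊗[k] ℬ)) : Prop where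
  extends_coaction : ∀ a : A, Φ (ι a) =
    GradedTensorProduct.of k 𝒜 ℬ (TensorProduct.map ι.toLinearMap ι'.toLinearMap (Δ a))
  graded : ∀ n : ℕ, ∀ ω ∈ 𝒜 n, Φ ω ∈ tensorDegree 𝒜 ℬ n
  comm_d : ∀ ω, Φ (d ω) = tensorD 𝒜 ℬ d d' (Φ ω)

/-- The base space forms: those `ω` with `Φ ω = ω ⊗ 1`. -/
def baseForms {𝒜 : ℕ → Submodule k Ω} {ℬ : ℕ → Submodule k Ω'} [GradedAlgebra 𝒜]
    [GradedAlgebra ℬ] (Φ : Ω →ₐ[k] (𝒜 ᵍ⊗[k] ℬ)) : Subalgebra k Ω :=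
  AlgHom.equalizer Φ (GradedTensorProduct.includeLeft 𝒜 ℬ)

/-- The base space forms of degree `n`. -/
def baseGrading {𝒜 : ℕ → Submodule k Ω} {ℬ : ℕ → Submodule k Ω'} [GradedAlgebra 𝒜]
    [GradedAlgebra ℬ] (Φ : Ω →ₐ[k] (𝒜 ᵍ⊗[k] ℬ)) (n : ℕ) : Submodule k (baseForms Φ) :=
  (𝒜 n).comap (baseForms Φ).val.toLinearMap

/-- The restriction of the differential to the base space forms. -/
def baseD {𝒜 : ℕ → Submodule k Ω} {ℬ : ℕ → Submodule k Ω'} [GradedAlgebra 𝒜]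
    [GradedAlgebra ℬ] (Φ : Ω →ₐ[k] (𝒜 ᵍ⊗[k] ℬ)) (d : Ω →ₗ[k] Ω)
    (hd : ∀ ω ∈ baseForms Φ, d ω ∈ baseForms Φ) : baseForms Φ →ₗ[k] baseForms Φ where
  toFun ω := ⟨d ω, hd ω ω.2⟩
  map_add' ω η := Subtype.ext (map_add d (ω : Ω) η)
  map_smul' r ω := Subtype.ext (map_smul d r (ω : Ω))

end Calculi

/-! ### Free modules of forms with quasi-commuting generators -/

/-- Data for a graded algebra generated over `R` by one-forms `e 0, …, e (n - 1)` subject to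
`e i * r = σ ^ (w i) r * e i`, `e i * e i = 0`, and `e i * e j = c i j • (e j * e i)` for `j < i`. -/
structure FormData (k R : Type*) [Field k] [Ring R] [Algebra k R] (n : ℕ) where
  σ : R →ₐ[k] R
  w : Fin n → ℕ
  c : Fin n → Fin n → k

section Forms

variable {k R : Type*} [Field k] [Ring R] [Algebra k R] {n : ℕ}

/-- The free left `R`-module on the monomials `e S`, the products of the `e i`, `i ∈ S`, in
increasing order; a form is given by its family of coefficients. -/
def Forms (_D : FormData k R n) : Type _ := Finset (Fin n) → R

namespace Forms

variable (D : FormData k R n)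

instance : AddCommGroup (Forms D) := inferInstanceAs (AddCommGroup (Finset (Fin n) → R))

instance : Module k (Forms D) := inferInstanceAs (Module k (Finset (Fin n) → R))

/-- The exponent of the twist picked up when moving a scalar to the left through `e S`. -/
def weight (S : Finset (Fin n)) : ℕ := ∑ i ∈ S, D.w i

/-- For disjoint `S` and `T`, the scalar with `e S * e T = coeff S T • e (S ∪ T)`. -/
def coeff (S T : Finset (Fin n)) : k := ∏ i ∈ S, ∏ j ∈ T, if j < i then D.c i j else 1

instance : Mul (Forms D) where
  mul ω η := fun U => ∑ S ∈ U.powerset,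
    coeff D S (U \ S) • (ω S * (D.σ ^ weight D S) (η (U \ S)))

instance : One (Forms D) where
  one := fun U => if U = ∅ then 1 else 0

variable {D}

@[ext]
theorem ext {ω η : Forms D} (h : ∀ S, ω S = η S) : ω = η := funext h

theorem mul_apply (ω η : Forms D) (U : Finset (Fin n)) : (ω * η) U = ∑ S ∈ U.powerset,
    coeff D S (U \ S) • (ω S * (D.σ ^ weight D S) (η (U \ S))) := rfl

theorem one_apply (U : Finset (Fin n)) : (1 : Forms D) U = if U = ∅ then 1 else 0 := rfl

@[simp] theorem add_apply (ω η : Forms D) (U : Finset (Fin n)) : (ω + η) U = ω U + η U := rfl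

@[simp] theorem smul_apply (r : k) (ω : Forms D) (U : Finset (Fin n)) : (r • ω) U = r • ω U := rfl

@[simp] theorem zero_apply (U : Finset (Fin n)) : (0 : Forms D) U = 0 := rfl

theorem weight_union {S T : Finset (Fin n)} (h : Disjoint S T) :
    weight D (S ∪ T) = weight D S + weight D T := Finset.sum_union h

theorem coeff_union_left {S T : Finset (Fin n)} (h : Disjoint S T) (U : Finset (Fin n)) :
    coeff D (S ∪ T) U = coeff D S U * coeff D T U := Finset.prod_union h

theorem coeff_union_right (S : Finset (Fin n)) {T U : Finset (Fin n)} (h : Disjoint T U) :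
    coeff D S (T ∪ U) = coeff D S T * coeff D S U := by
  simp only [coeff, Finset.prod_union h, Finset.prod_mul_distrib]

theorem mul_assoc' (ω η ζ : Forms D) : ω * η * ζ = ω * (η * ζ) := by
  ext U
  simp only [mul_apply, Finset.sum_mul, Finset.smul_sum, map_sum, Finset.mul_sum]
  rw [Finset.sum_sigma', Finset.sum_sigma']
  refine Finset.sum_bij' (fun x _ => ⟨x.2, x.1 \ x.2⟩) (fun y _ => ⟨y.1 ∪ y.2, y.1⟩) ?_ ?_ ?_ ?_ ?_
  · rintro ⟨S, T⟩ h
    simp only [Finset.mem_sigma, Finset.mem_powerset] at h ⊢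
    exact ⟨h.2.trans h.1, Finset.sdiff_subset_sdiff h.1 le_rfl⟩
  · rintro ⟨S, T⟩ h
    simp only [Finset.mem_sigma, Finset.mem_powerset] at h ⊢
    exact ⟨Finset.union_subset h.1 (h.2.trans Finset.sdiff_subset), Finset.subset_union_left⟩
  · rintro ⟨S, T⟩ h
    simp only [Finset.mem_sigma, Finset.mem_powerset] at h
    simp [Finset.union_sdiff_of_subset h.2]
  · rintro ⟨S, T⟩ h
    simp only [Finset.mem_sigma, Finset.mem_powerset] at h
    have : Disjoint T S := Finset.disjoint_of_subset_left h.2 Finset.sdiff_disjoint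
    simp [Finset.union_sdiff_left, this.sdiff_eq_left]
  · rintro ⟨S, T⟩ h
    simp only [Finset.mem_sigma, Finset.mem_powerset] at h
    obtain ⟨V, hV, rfl⟩ : ∃ V, Disjoint T V ∧ S = T ∪ V :=
      ⟨S \ T, Finset.disjoint_sdiff, (Finset.union_sdiff_of_subset h.2).symm⟩
    obtain ⟨W, hW, rfl⟩ : ∃ W, Disjoint (T ∪ V) W ∧ U = (T ∪ V) ∪ W :=
      ⟨U \ (T ∪ V), Finset.disjoint_sdiff, (Finset.union_sdiff_of_subset h.1).symm⟩
    have hTW : Disjoint T W := (Finset.disjoint_union_left.1 hW).1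
    have hVW : Disjoint V W := (Finset.disjoint_union_left.1 hW).2
    have e1 : ((T ∪ V) ∪ W) \ (T ∪ V) = W := by
      rw [Finset.union_sdiff_left, hW.symm.sdiff_eq_left]
    have e2 : (T ∪ V) \ T = V := by
      rw [Finset.union_sdiff_left, hV.symm.sdiff_eq_left]
    have e3 : ((T ∪ V) ∪ W) \ T = V ∪ W := by
      rw [Finset.union_assoc, Finset.union_sdiff_left,
        (Finset.disjoint_union_right.2 ⟨hV, hTW⟩).symm.sdiff_eq_left]
    have e4 : (V ∪ W) \ V = W := by
      rw [Finset.union_sdiff_left, hVW.symm.sdiff_eq_left]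
    simp only [e1, e2, e3, e4, weight_union hV, coeff_union_left hV, coeff_union_right _ hVW,
      pow_add, map_smul, map_mul, AlgHom.mul_apply, smul_mul_assoc, mul_smul_comm, smul_smul,
      mul_assoc]
    congr 1
    ring

theorem one_mul' (ω : Forms D) : 1 * ω = ω := by
  ext U
  rw [mul_apply, Finset.sum_eq_single ∅]
  · simp [one_apply, coeff, weight]
  · intro S _ hS
    simp [one_apply, hS]
  · simp

theorem mul_one' (ω : Forms D) : ω * 1 = ω := by
  ext U
  rw [mul_apply, Finset.sum_eq_single U]
  · simp [one_apply, coeff]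
  · intro S hS hSU
    have : U \ S ≠ ∅ := fun h => hSU
      (Finset.Subset.antisymm (Finset.mem_powerset.1 hS) (Finset.sdiff_eq_empty_iff_subset.1 h))
    simp [one_apply, this]
  · simp

instance : Ring (Forms D) where
  __ := (inferInstance : AddCommGroup (Forms D))
  left_distrib ω η ζ := by
    ext U; simp [mul_apply, mul_add, Finset.sum_add_distrib]
  right_distrib ω η ζ := by
    ext U; simp [mul_apply, add_mul, Finset.sum_add_distrib]
  zero_mul ω := by ext U; simp [mul_apply]
  mul_zero ω := by ext U; simp [mul_apply]
  mul_assoc := mul_assoc'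
  one_mul := one_mul'
  mul_one := mul_one'

instance : Algebra k (Forms D) :=
  Algebra.ofModule
    (fun r ω η => by
      ext U; simp [mul_apply, Finset.smul_sum, smul_comm r])
    (fun r ω η => by
      ext U; simp [mul_apply, Finset.smul_sum, smul_comm r])

variable (D)

/-- The form `r * e S`. -/
def mono (S : Finset (Fin n)) (r : R) : Forms D := fun U => if U = S then r else 0

/-- The inclusion of `R` as the forms of degree zero. -/
def incl : R →ₐ[k] Forms D :=
  AlgHom.ofLinearMap
    { toFun := mono D ∅
      map_add' := fun r s => by ext U; by_cases h : U = ∅ <;> simp [mono, h]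
      map_smul' := fun r s => by ext U; by_cases h : U = ∅ <;> simp [mono, h] }
    rfl
    (fun r s => by
      ext U
      change mono D ∅ (r * s) U = (mono D ∅ r * mono D ∅ s) U
      rw [mul_apply, Finset.sum_eq_single ∅]
      · by_cases h : U = ∅ <;> simp [mono, h, coeff, weight]
      · intro S _ hS
        simp [mono, hS]
      · simp)

/-- The coefficient of `e S` in a form. -/
def coeffAt (S : Finset (Fin n)) : Forms D →ₗ[k] R where
  toFun ω := ω S
  map_add' _ _ := rfl
  map_smul' _ _ := rfl

/-- The basis form `e S`. -/
def e (S : Finset (Fin n)) : Forms D := mono D S 1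

/-- The forms of degree `m`. -/
def degree (m : ℕ) : Submodule k (Forms D) where
  carrier := {ω | ∀ S : Finset (Fin n), S.card ≠ m → ω S = 0}
  add_mem' hω hη S hS := by simp [hω S hS, hη S hS]
  zero_mem' S _ := rfl
  smul_mem' r ω hω S hS := by simp [hω S hS]

theorem mem_degree {m : ℕ} {ω : Forms D} :
    ω ∈ degree D m ↔ ∀ S : Finset (Fin n), S.card ≠ m → ω S = 0 := Iff.rfl

instance : SetLike.GradedMonoid (degree D) where
  one_mem S hS := by
    have : S ≠ ∅ := fun h => hS (by simp [h])
    simp [one_apply, this]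
  mul_mem i j ω η hω hη U hU := by
    rw [mul_apply]
    refine Finset.sum_eq_zero fun S hS => ?_
    by_cases h1 : S.card = i
    · have h2 : (U \ S).card ≠ j := fun h2 => hU (by
        have := Finset.card_sdiff_add_card_eq_card (Finset.mem_powerset.1 hS)
        omega)
      simp [hη _ h2]
    · simp [hω _ h1]

/-- The component of degree `m` of a form. -/
def proj (m : ℕ) : Forms D →ₗ[k] degree D m where
  toFun ω := ⟨fun S => if S.card = m then ω S else 0, fun S hS => by simp [hS]⟩
  map_add' ω η := by
    apply Subtype.ext; ext S
    change (if S.card = m then ω S + η S else 0) =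
      (if S.card = m then ω S else 0) + (if S.card = m then η S else 0)
    split_ifs <;> simp
  map_smul' r ω := by
    apply Subtype.ext; ext S
    change (if S.card = m then r • ω S else 0) = r • (if S.card = m then ω S else 0)
    split_ifs <;> simp

theorem proj_apply (m : ℕ) (ω : Forms D) (S : Finset (Fin n)) :
    (proj D m ω : Forms D) S = if S.card = m then ω S else 0 := rfl

theorem sum_apply {κ : Type*} (s : Finset κ) (f : κ → Forms D) (S : Finset (Fin n)) :
    (∑ i ∈ s, f i) S = ∑ i ∈ s, f i S := Finset.sum_apply S s f

instance : DirectSum.Decomposition (degree D) :=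
  DirectSum.Decomposition.ofLinearMap (degree D)
    (∑ m ∈ Finset.range (n + 1), DirectSum.lof k ℕ (fun i => degree D i) m ∘ₗ proj D m)
    (by
      ext ω S
      have hS : S.card < n + 1 := Nat.lt_succ_of_le (by simpa using Finset.card_le_univ S)
      simp only [LinearMap.comp_apply, LinearMap.sum_apply, map_sum, DirectSum.coeLinearMap_lof,
        sum_apply, proj_apply, LinearMap.id_apply]
      simp [hS])
    (by
      ext m ω : 2
      simp only [LinearMap.comp_apply, LinearMap.sum_apply, DirectSum.coeLinearMap_lof,
        LinearMap.id_apply]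
      have key : ∀ i, i ≠ m → proj D i (ω : Forms D) = 0 := fun i hi => by
        apply Subtype.ext; ext S
        by_cases h : S.card = i
        · simp [proj_apply, ω.2 S (by omega)]
        · simp [proj_apply, h]
      have key2 : proj D m (ω : Forms D) = ω := by
        apply Subtype.ext; ext S
        by_cases h : S.card = m
        · simp [proj_apply, h]
        · simp [proj_apply, h, ω.2 S h]
      by_cases hm : m < n + 1
      · rw [Finset.sum_eq_single m]
        · rw [key2]
        · intro i _ hi
          rw [key i hi, map_zero]
        · intro h
          exact absurd (Finset.mem_range.2 hm) h
      · have hω : ω = 0 := by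
          apply Subtype.ext; ext S
          have : S.card ≤ n := by simpa using Finset.card_le_univ S
          exact ω.2 S (by omega)
        simp [hω])

instance : GradedAlgebra (degree D) where

end Forms

end Forms

/-! ### The quantum group `O_q(SU(2))` -/

section Algebra

/-- The four generators. -/
inductive Gen
  | α | β | γ | δ

variable {k : Type*} [Field k] (q : kˣ)

/-- The defining relations, for elements of an arbitrary algebra. -/
structure Relations {S : Type*} [Ring S] [Algebra k S] (a b c d : S) : Prop where
  ba : b * a = (q : k) • (a * b)
  ca : c * a = (q : k) • (a * c)
  db : d * b = (q : k) • (b * d)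
  dc : d * c = (q : k) • (c * d)
  cb : c * b = b * c
  da : d * a - a * d = ((q : k) - (q : k)⁻¹) • (b * c)
  ad : a * d - (q : k)⁻¹ • (b * c) = 1

open FreeAlgebra in
/-- The defining relations in the free algebra. -/
inductive Rel : FreeAlgebra k Gen → FreeAlgebra k Gen → Prop
  | ba : Rel (ι k .β * ι k .α) ((q : k) • (ι k .α * ι k .β))
  | ca : Rel (ι k .γ * ι k .α) ((q : k) • (ι k .α * ι k .γ))
  | db : Rel (ι k .δ * ι k .β) ((q : k) • (ι k .β * ι k .δ))
  | dc : Rel (ι k .δ * ι k .γ) ((q : k) • (ι k .γ * ι k .δ))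
  | cb : Rel (ι k .γ * ι k .β) (ι k .β * ι k .γ)
  | da : Rel (ι k .δ * ι k .α - ι k .α * ι k .δ)
      (((q : k) - (q : k)⁻¹) • (ι k .β * ι k .γ))
  | ad : Rel (ι k .α * ι k .δ - (q : k)⁻¹ • (ι k .β * ι k .γ)) 1

/-- The algebra `A = O_q(SU(2))`. -/
abbrev SUq : Type _ := RingQuot (Rel q)

/-- The image of a generator. -/
def gen (g : Gen) : SUq q := RingQuot.mkAlgHom k (Rel q) (FreeAlgebra.ι k g)

theorem relations_gen : Relations q (gen q .α) (gen q .β) (gen q .γ) (gen q .δ) := by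
  constructor
  · simpa [gen] using RingQuot.mkAlgHom_rel k (Rel.ba (q := q))
  · simpa [gen] using RingQuot.mkAlgHom_rel k (Rel.ca (q := q))
  · simpa [gen] using RingQuot.mkAlgHom_rel k (Rel.db (q := q))
  · simpa [gen] using RingQuot.mkAlgHom_rel k (Rel.dc (q := q))
  · simpa [gen] using RingQuot.mkAlgHom_rel k (Rel.cb (q := q))
  · simpa [gen] using RingQuot.mkAlgHom_rel k (Rel.da (q := q))
  · simpa [gen] using RingQuot.mkAlgHom_rel k (Rel.ad (q := q))

theorem gen_ad : gen q .α * gen q .δ = 1 + (q : k)⁻¹ • (gen q .β * gen q .γ) :=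
  sub_eq_iff_eq_add.1 (relations_gen q).ad

theorem gen_da : gen q .δ * gen q .α = 1 + (q : k) • (gen q .β * gen q .γ) := by
  rw [sub_eq_iff_eq_add.1 (relations_gen q).da, gen_ad]
  module

/-- The images of the four generators under a homomorphism. -/
def genMap {S : Type*} (a b c d : S) : Gen → S
  | .α => a
  | .β => b
  | .γ => c
  | .δ => d

variable {q} in
/-- The homomorphism out of `A` with prescribed values on the generators. -/
def homOfRelations {S : Type*} [Ring S] [Algebra k S] {a b c d : S} (h : Relations q a b c d) :
    SUq q →ₐ[k] S :=
  RingQuot.liftAlgHom k ⟨FreeAlgebra.lift k (genMap a b c d), by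
    intro x y hxy
    cases hxy
    · simpa [genMap] using h.ba
    · simpa [genMap] using h.ca
    · simpa [genMap] using h.db
    · simpa [genMap] using h.dc
    · simpa [genMap] using h.cb
    · simpa [genMap] using h.da
    · simpa [genMap] using h.ad⟩

theorem relations_scale {u : k} (hu : u ≠ 0) : Relations q (u • gen q .α) (u⁻¹ • gen q .β)
    (u • gen q .γ) (u⁻¹ • gen q .δ) := by
  have h := relations_gen q
  constructor
  · simp [h.ba, smul_smul, hu]
  · simp [h.ca, smul_smul, mul_left_comm, mul_comm]
  · simp [h.db, smul_smul, mul_left_comm, mul_comm]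
  · simp [h.dc, smul_smul, hu]
  · simp [h.cb, smul_smul, hu]
  · simpa [smul_smul, hu] using h.da
  · simpa [smul_smul, hu] using h.ad

/-- The automorphism `f ↦ q^|f| f`, where `|α| = |γ| = 1` and `|β| = |δ| = -1`. -/
def twist : SUq q →ₐ[k] SUq q := homOfRelations (relations_scale q q.ne_zero)

variable {q} in
theorem relations_triangular {S : Type*} [Ring S] [Algebra k S] {a b c d a' b' c' d' : S}
    (h : Relations q a b c d) (h' : Relations q a' b' c' d') {x y z w : S}
    (ba : b * x + y * a' = (q : k) • (a * y + x * b'))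
    (ca : c * x + z * a' = (q : k) • (a * z + x * c'))
    (db : d * y + w * b' = (q : k) • (b * w + y * d'))
    (dc : d * z + w * c' = (q : k) • (c * w + z * d'))
    (cb : c * y + z * b' = b * z + y * c')
    (da : d * x + w * a' - (a * w + x * d') = ((q : k) - (q : k)⁻¹) • (b * z + y * c'))
    (ad : a * w + x * d' - (q : k)⁻¹ • (b * z + y * c') = 0) :
    Relations q !![a, x; 0, a'] !![b, y; 0, b'] !![c, z; 0, c'] !![d, w; 0, d'] := by
  have hm : ∀ p r s p' r' s' : S, !![p, r; 0, s] * !![p', r'; 0, s'] =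
      !![p * p', p * r' + r * s'; 0, s * s'] := by
    intro p r s p' r' s'
    rw [Matrix.mul_fin_two]
    simp
  have hs : ∀ (t : k) (p r s : S), t • !![p, r; 0, s] = !![t • p, t • r; 0, t • s] := by
    intro t p r s
    simp
  have hsub : ∀ p r s p' r' s' : S, !![p, r; 0, s] - !![p', r'; 0, s'] =
      !![p - p', r - r'; 0, s - s'] := by
    intro p r s p' r' s'
    ext i j
    fin_cases i <;> fin_cases j <;> simp
  constructor
  · rw [hm, hm, hs, h.ba, h'.ba, ba]
  · rw [hm, hm, hs, h.ca, h'.ca, ca]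
  · rw [hm, hm, hs, h.db, h'.db, db]
  · rw [hm, hm, hs, h.dc, h'.dc, dc]
  · rw [hm, hm, h.cb, h'.cb, cb]
  · rw [hm, hm, hm, hs, hsub, h.da, h'.da, da]
  · rw [hm, hm, hs, hsub, h.ad, h'.ad, ad, Matrix.one_fin_two]

theorem relations_coaction : Relations q
    (gen q .α ⊗ₜ[k] (LaurentPolynomial.T 1 : LaurentPolynomial k))
    (gen q .β ⊗ₜ[k] (LaurentPolynomial.T (-1) : LaurentPolynomial k))
    (gen q .γ ⊗ₜ[k] (LaurentPolynomial.T 1 : LaurentPolynomial k))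
    (gen q .δ ⊗ₜ[k] (LaurentPolynomial.T (-1) : LaurentPolynomial k)) := by
  have h := relations_gen q
  have h1 : (LaurentPolynomial.T 1 * LaurentPolynomial.T (-1) : LaurentPolynomial k) = 1 := by
    rw [← LaurentPolynomial.T_add]; simp
  have h2 : (LaurentPolynomial.T (-1) * LaurentPolynomial.T 1 : LaurentPolynomial k) = 1 := by
    rw [← LaurentPolynomial.T_add]; simp
  constructor <;>
    simp only [Algebra.TensorProduct.tmul_mul_tmul, h1, h2, h.ba, h.ca, h.db, h.dc, h.cb,
      TensorProduct.smul_tmul', ← TensorProduct.sub_tmul, h.da, h.ad,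
      Algebra.TensorProduct.one_def]

/-- The coaction `Δ_A : A → A ⊗ H`, with `H = k[t, t⁻¹]`:
`α ↦ α ⊗ t`, `β ↦ β ⊗ t⁻¹`, `γ ↦ γ ⊗ t`, `δ ↦ δ ⊗ t⁻¹`. -/
def coaction : SUq q →ₐ[k] SUq q ⊗[k] LaurentPolynomial k :=
  homOfRelations (relations_coaction q)

/-- The elements `a` of degree `n`: `Δ_A a = a ⊗ tⁿ`. -/
def degreePart (n : ℤ) : Submodule k (SUq q) where
  carrier := {a | coaction q a = a ⊗ₜ LaurentPolynomial.T n}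
  add_mem' {a b} ha hb := by
    simp only [Set.mem_ofPred_eq] at ha hb ⊢
    rw [map_add, ha, hb, TensorProduct.add_tmul]
  zero_mem' := by simp
  smul_mem' r a ha := by
    simp only [Set.mem_ofPred_eq] at ha ⊢
    rw [map_smul, ha, TensorProduct.smul_tmul']

/-- The Podleś sphere `B = {a ∈ A | Δ_A a = a ⊗ 1}`. -/
def podles : Subalgebra k (SUq q) :=
  AlgHom.equalizer (coaction q) Algebra.TensorProduct.includeLeft

/-! ### The three-dimensional calculus on `O_q(SU(2))` -/

/-- The generators are `e⁺ = e 0`, `e⁻ = e 1`, `e⁰ = e 2`, with `e^± f = q^|f| f e^±`,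
`e⁰ f = q^(2|f|) f e⁰`, `e⁻ e⁺ = -q² e⁺ e⁻`, `e⁰ e⁺ = -q⁴ e⁺ e⁰`, `e⁰ e⁻ = -q⁻⁴ e⁻ e⁰`. -/
def dataA : FormData k (SUq q) 3 where
  σ := twist q
  w := ![1, 1, 2]
  c := ![![0, 0, 0], ![-(q : k) ^ 2, 0, 0], ![-(q : k) ^ 4, -((q : k) ^ 4)⁻¹, 0]]

/-- The algebra of forms `Ω(A)`. -/
abbrev FormsA : Type _ := Forms (dataA q)

/-- The inclusion of `A` in `Ω(A)`. -/
abbrev inclA : SUq q →ₐ[k] FormsA q := Forms.incl (dataA q)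

/-- The form `e⁺`. -/
def ePlus : FormsA q := Forms.e (dataA q) {0}

/-- The form `e⁻`. -/
def eMinus : FormsA q := Forms.e (dataA q) {1}

/-- The form `e⁰`. -/
def eZero : FormsA q := Forms.e (dataA q) {2}

theorem relations_partialPlus : Relations q
    !![gen q .α, (q : k) • gen q .β; 0, (q : k) • gen q .α]
    !![gen q .β, 0; 0, (q : k)⁻¹ • gen q .β]
    !![gen q .γ, (q : k) • gen q .δ; 0, (q : k) • gen q .γ]
    !![gen q .δ, 0; 0, (q : k)⁻¹ • gen q .δ] := by
  have hq : (q : k) ≠ 0 := q.ne_zero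
  have h := relations_gen q
  apply relations_triangular h (relations_scale q hq) <;>
    simp only [mul_zero, zero_mul, add_zero, zero_add, smul_zero, sub_self,
      smul_mul_assoc, mul_smul_comm, h.db, h.cb, gen_ad, gen_da] <;>
    match_scalars <;> field_simp

/-- `f ↦ (f, ∂⁺f; 0, σf)`, where `df = (∂⁺f) e⁺ + (∂⁻f) e⁻ + (∂⁰f) e⁰`. -/
def partialPlusHom : SUq q →ₐ[k] Matrix (Fin 2) (Fin 2) (SUq q) :=
  homOfRelations (relations_partialPlus q)

theorem relations_partialMinus : Relations q
    !![gen q .α, 0; 0, (q : k) • gen q .α]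
    !![gen q .β, gen q .α; 0, (q : k)⁻¹ • gen q .β]
    !![gen q .γ, 0; 0, (q : k) • gen q .γ]
    !![gen q .δ, gen q .γ; 0, (q : k)⁻¹ • gen q .δ] := by
  have hq : (q : k) ≠ 0 := q.ne_zero
  have h := relations_gen q
  apply relations_triangular h (relations_scale q hq) <;>
    simp only [mul_zero, zero_mul, add_zero, zero_add, smul_zero,
      mul_smul_comm, h.ca, h.cb, gen_ad, gen_da] <;>
    match_scalars <;> field_simp
  ring

/-- `f ↦ (f, ∂⁻f; 0, σf)`. -/
def partialMinusHom : SUq q →ₐ[k] Matrix (Fin 2) (Fin 2) (SUq q) :=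
  homOfRelations (relations_partialMinus q)

theorem relations_partialZero : Relations q
    !![gen q .α, gen q .α; 0, ((q : k) ^ 2) • gen q .α]
    !![gen q .β, -((q : k) ^ 2)⁻¹ • gen q .β; 0, ((q : k) ^ 2)⁻¹ • gen q .β]
    !![gen q .γ, gen q .γ; 0, ((q : k) ^ 2) • gen q .γ]
    !![gen q .δ, -((q : k) ^ 2)⁻¹ • gen q .δ; 0, ((q : k) ^ 2)⁻¹ • gen q .δ] := by
  have hq : (q : k) ≠ 0 := q.ne_zero
  have h := relations_gen q
  apply relations_triangular h (relations_scale q (pow_ne_zero 2 hq)) <;>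
    simp only [smul_mul_assoc, mul_smul_comm, h.ba, h.ca, h.db, h.dc, h.cb, gen_ad, gen_da] <;>
    match_scalars <;> field_simp <;> ring

/-- `f ↦ (f, ∂⁰f; 0, σ²f)`. -/
def partialZeroHom : SUq q →ₐ[k] Matrix (Fin 2) (Fin 2) (SUq q) :=
  homOfRelations (relations_partialZero q)

/-- The entry `∂f` of `(f, ∂f; 0, *)`, as a linear map. -/
def entry (P : SUq q →ₐ[k] Matrix (Fin 2) (Fin 2) (SUq q)) : SUq q →ₗ[k] SUq q :=
  Matrix.entryLinearMap k (SUq q) 0 1 ∘ₗ P.toLinearMap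

/-- The differential on `A`: the derivation with `dα = α e⁰ + q β e⁺`, `dβ = α e⁻ - q⁻² β e⁰`,
`dγ = γ e⁰ + q δ e⁺`, `dδ = γ e⁻ - q⁻² δ e⁰`. -/
def dFunctions : SUq q →ₗ[k] FormsA q :=
  LinearMap.mulRight k (ePlus q) ∘ₗ (inclA q).toLinearMap ∘ₗ
      entry q (partialPlusHom q) +
    LinearMap.mulRight k (eMinus q) ∘ₗ (inclA q).toLinearMap ∘ₗ
      entry q (partialMinusHom q) +
    LinearMap.mulRight k (eZero q) ∘ₗ (inclA q).toLinearMap ∘ₗ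
      entry q (partialZeroHom q)

/-- The differentials of the basis forms: `de⁺ = -q² [2] e⁺ ∧ e⁰`, `de⁻ = q⁻² [2] e⁻ ∧ e⁰`,
`de⁰ = q³ e⁺ ∧ e⁻`, where `[2] = 1 + q⁻²`; those of the other basis forms vanish. -/
def dBasis (S : Finset (Fin 3)) : FormsA q :=
  if S = {0} then (-((q : k) ^ 2 * (1 + ((q : k) ^ 2)⁻¹))) • (ePlus q * eZero q)
  else if S = {1} then (((q : k) ^ 2)⁻¹ * (1 + ((q : k) ^ 2)⁻¹)) • (eMinus q * eZero q)
  else if S = {2} then ((q : k) ^ 3) • (ePlus q * eMinus q)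
  else 0

/-- The differential of `Ω(A)`: `d(a e_S) = da ∧ e_S + a de_S`. -/
def dA : FormsA q →ₗ[k] FormsA q :=
  ∑ S : Finset (Fin 3),
    (LinearMap.mulRight k (Forms.e (dataA q) S) ∘ₗ dFunctions q +
      LinearMap.mulRight k (dBasis q S) ∘ₗ (inclA q).toLinearMap) ∘ₗ
      Forms.coeffAt (dataA q) S

/-! ### The calculus on `H = k[t, t⁻¹]` -/

/-- The automorphism `t ↦ q² t`. -/
def twistH : LaurentPolynomial k →ₐ[k] LaurentPolynomial k :=
  AddMonoidAlgebra.lift k (LaurentPolynomial k) ℤ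
    { toFun := fun n => ((q : k) ^ 2) ^ n.toAdd • LaurentPolynomial.T n.toAdd
      map_one' := by simp
      map_mul' := fun m n => by
        have hq : (q : k) ^ 2 ≠ 0 := pow_ne_zero 2 q.ne_zero
        rw [toAdd_mul, zpow_add₀ hq, LaurentPolynomial.T_add, smul_mul_smul_comm] }

/-- One generator `dt`, with `dt f(t) = f(q² t) dt` and `dt ∧ dt = 0`. -/
def dataH : FormData k (LaurentPolynomial k) 1 where
  σ := twistH q
  w := fun _ => 1
  c := fun _ _ => 0

/-- The algebra of forms `Ω(H) = H ⊕ H dt`. -/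
abbrev FormsH : Type _ := Forms (dataH q)

/-- The quantum integers in base `q²`: `1 + q² + ⋯ + q^(2(n-1))` for `n ≥ 0`, and
`-(q^(2n) + ⋯ + q⁻²)` for `n < 0`. -/
def qInt : ℤ → k
  | .ofNat n => ∑ i ∈ Finset.range n, ((q : k) ^ 2) ^ i
  | .negSucc n => -∑ i ∈ Finset.range (n + 1), (((q : k) ^ 2)⁻¹) ^ (i + 1)

/-- The `q`-derivative, `tⁿ ↦ [n] tⁿ⁻¹`. -/
def qDeriv : LaurentPolynomial k →ₗ[k] LaurentPolynomial k :=
  Finsupp.linearCombination k (fun n : ℤ => qInt q n • LaurentPolynomial.T (n - 1)) ∘ₗ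
    (AddMonoidAlgebra.coeffLinearEquiv k).toLinearMap

/-- The differential of `Ω(H)`: `d(f + g dt) = f' dt`, with `f'` the `q`-derivative of `f`. -/
def dH : FormsH q →ₗ[k] FormsH q :=
  LinearMap.mulRight k (Forms.e (dataH q) {0}) ∘ₗ (Forms.incl (dataH q)).toLinearMap ∘ₗ
    qDeriv q ∘ₗ Forms.coeffAt (dataH q) ∅

/-- Morphisms of differential graded algebras `Ω(A) → Ω(A) ⊗ Ω(H)` extending `Δ_A`. -/
def IsHopfExtension
    (Φ : FormsA q →ₐ[k] (Forms.degree (dataA q) ᵍ⊗[k] Forms.degree (dataH q))) : Prop :=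
  IsCompleteExtension (Forms.degree (dataA q)) (Forms.degree (dataH q)) (dA q) (dH q)
    (inclA q) (Forms.incl (dataH q)) (coaction q) Φ

/-- The inclusion of the Podleś sphere in the forms on `A`. -/
def podlesIncl : podles q →ₐ[k] FormsA q := (inclA q).comp (podles q).val

end Algebra

end QHopf

end

open QHopf

/-! Everything rests on a universal property of the algebra of forms. A homomorphism on coefficients
together with images of the generators that respect the commutation rules extends to all forms
(`Forms.lift`). It is used twice.

The first use gives the differential on `Ω(A)`. If the Leibniz rule holds, then `ω ↦ ((-1)^|ω| ω,
dω; 0, ω)` is multiplicative. Conversely, `jet_compatible` checks on generators that such triangular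
matrices satisfy the relations of the forms. `lift` then gives a homomorphism, `lift_jet` identifies
its corner with `dA`, and multiplicativity is the Leibniz rule. After that, `d² = 0` need only be
tested on generators. The forms are generated by functions because each `e i` lies in `A dA` and, by
Leibniz, `dA · A ⊆ A · dA`.

The second use gives the extended coaction. With `θ = t⁻¹dt`, the assignment `e^± ↦ e^± ⊗ t^{±2}`,
`e⁰ ↦ e⁰ ⊗ 1 + 1 ⊗ θ` respects the relations (`coactionGen_compatible`) and commutes with the
differentials on generators, hence everywhere. Uniqueness holds because functions and their
differentials generate `Ω(A)`.

Base forms are then read off coefficientwise (`mem_baseForms_iff`). A monomial containing `e⁰`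
contributes a `θ`-term that nothing else can cancel, so its coefficient vanishes, by injectivity of
the coaction. The remaining coefficients must have the degree opposite to that of their monomial.
This leaves `B` in degree 0, `A₋₂ e⁺ ⊕ A₂ e⁻` in degree 1, `B e⁺ ∧ e⁻` in degree 2, and nothing
above.

Generation by `B` comes from the squared quantum determinant. The differentials of `αβ`, `αδ`, `γδ`
have `(e⁺, e⁻)`-coefficients `(β², α²)`, `(βδ, αγ)`, `(δ², γ²)`. A left combination with multiples
of `γ²`, `αγ`, `α²` has `e⁺`-coefficient 1 and `e⁻`-coefficient 0 (`qdet_sq`, `qdet_sq_offdiag`);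
`δ²`, `βδ`, `β²` do the same for `e⁻`. When `a` has degree `∓2`, multiplying these left factors by
`a` puts them in `B`, so `a e^±` lies in `B dB`. Expanding `e⁻` inside `e⁺ ∧ e⁻` and moving `e⁺`
past the left factors treats the volume form. -/

noncomputable section

namespace QHopf

/-! ### Algebras of forms: basis, generators, universal property -/

namespace Forms

variable {k R S : Type*} [Field k] [Ring R] [Algebra k R] [Ring S] [Algebra k S] {n : ℕ}

/-- The product of the `x i`, `i ∈ T`, in increasing order. -/
def orderedProd (x : Fin n → S) (T : Finset (Fin n)) : S := (T.sort.map x).prod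

@[simp] theorem orderedProd_empty (x : Fin n → S) : orderedProd x ∅ = 1 := by
  simp [orderedProd]

theorem orderedProd_insert (x : Fin n → S) {m : Fin n} {T : Finset (Fin n)}
    (h : ∀ j ∈ T, m < j) : orderedProd x (insert m T) = x m * orderedProd x T := by
  rw [orderedProd, Finset.sort_insert _ (fun b hb => (h b hb).le) (fun hm => (h m hm).false)]
  simp [orderedProd]

theorem orderedProd_singleton (x : Fin n → S) (i : Fin n) : orderedProd x {i} = x i := by
  simp [orderedProd]

variable (D : FormData k R n)

@[simp] theorem coeffAt_apply (T : Finset (Fin n)) (ω : Forms D) : coeffAt D T ω = ω T := rfl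

theorem coeff_of_lt {i : Fin n} {T : Finset (Fin n)} (h : ∀ j ∈ T, i < j) : coeff D {i} T = 1 := by
  rw [coeff, Finset.prod_singleton]
  exact Finset.prod_eq_one fun j hj => if_neg (h j hj).not_gt

/-- The conditions under which an algebra homomorphism `f` on the coefficients and a family `x`
of images of the generators `e i` define a homomorphism on the algebra of forms. -/
structure Compatible (f : R →ₐ[k] S) (x : Fin n → S) : Prop where
  comm : ∀ i r, x i * f r = f ((D.σ ^ D.w i) r) * x i
  sq : ∀ i, x i * x i = 0
  anti : ∀ i j, j < i → x i * x j = D.c i j • (x j * x i)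

namespace Compatible

variable {D} {f : R →ₐ[k] S} {x : Fin n → S}

theorem orderedProd_comm (h : Compatible D f x) (T : Finset (Fin n)) (r : R) :
    orderedProd x T * f r = f ((D.σ ^ weight D T) r) * orderedProd x T := by
  induction T using Finset.induction_on_min generalizing r with
  | empty => simp [weight]
  | insert m T hm ih =>
    have hmT : m ∉ T := fun h' => (hm m h').false
    rw [orderedProd_insert x hm, mul_assoc, ih, ← mul_assoc, h.comm, mul_assoc, Finset.insert_eq,
      weight_union (Finset.disjoint_singleton_left.2 hmT), pow_add,
      show weight D {m} = D.w m from Finset.sum_singleton _ _]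
    rfl

/-- Normal ordering of one new generator: it moves right past the smaller ones, collecting a factor
`D.c` each time, and either reaches its place or meets its own copy and squares to zero. -/
theorem mul_orderedProd (h : Compatible D f x) (i : Fin n) (T : Finset (Fin n)) :
    x i * orderedProd x T = if i ∈ T then 0 else coeff D {i} T • orderedProd x (insert i T) := by
  induction T using Finset.induction_on_min with
  | empty => simp [coeff, orderedProd_singleton]
  | insert m T hm ih =>
    have hmT : m ∉ T := fun h' => (hm m h').false
    rcases lt_trichotomy i m with him | rfl | hmi
    · have hT : ∀ j ∈ insert m T, i < j := by
        intro j hj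
        rcases Finset.mem_insert.1 hj with rfl | hj
        · exact him
        · exact him.trans (hm j hj)
      rw [if_neg (fun h' => (hT i h').false), coeff_of_lt D hT, one_smul, orderedProd_insert x hT]
    · rw [orderedProd_insert x hm, ← mul_assoc, h.sq, zero_mul, if_pos (Finset.mem_insert_self _ _)]
    · rw [orderedProd_insert x hm, ← mul_assoc, h.anti i m hmi, smul_mul_assoc, mul_assoc, ih]
      by_cases hi : i ∈ T
      · rw [if_pos hi, if_pos (Finset.mem_insert_of_mem hi), mul_zero, smul_zero]
      · have hi' : i ∉ insert m T := by simp [hi, hmi.ne']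
        have hins : ∀ j ∈ insert i T, m < j := by
          intro j hj
          rcases Finset.mem_insert.1 hj with rfl | hj
          · exact hmi
          · exact hm j hj
        rw [if_neg hi, if_neg hi', Finset.insert_comm, orderedProd_insert x hins, mul_smul_comm,
          smul_smul]
        congr 1
        simp [coeff, Finset.prod_insert hmT, hmi]

theorem orderedProd_mul (h : Compatible D f x) (T U : Finset (Fin n)) :
    orderedProd x T * orderedProd x U =
      if Disjoint T U then coeff D T U • orderedProd x (T ∪ U) else 0 := by
  induction T using Finset.induction_on_min with
  | empty => simp [coeff]
  | insert m T hm ih =>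
    have hmT : m ∉ T := fun h' => (hm m h').false
    rw [orderedProd_insert x hm, mul_assoc, ih]
    by_cases hTU : Disjoint T U
    · rw [if_pos hTU, mul_smul_comm, h.mul_orderedProd]
      by_cases hmU : m ∈ U
      · simp [hmU]
      · rw [if_neg (by simp [hmT, hmU]), if_pos (Finset.disjoint_insert_left.2 ⟨hmU, hTU⟩),
          smul_smul, Finset.insert_union, Finset.insert_eq m T,
          coeff_union_left (Finset.disjoint_singleton_left.2 hmT), coeff_union_right _ hTU,
          coeff_of_lt D hm, one_mul, mul_comm]
    · rw [if_neg hTU, if_neg (fun h' => hTU (Finset.disjoint_insert_left.1 h').2), mul_zero]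

end Compatible

theorem mono_mul_mono (T U : Finset (Fin n)) (r s : R) :
    mono D T r * mono D U s =
      if Disjoint T U then mono D (T ∪ U) (coeff D T U • (r * (D.σ ^ weight D T) s)) else 0 := by
  ext V
  -- Only the summand indexed by `T` can be nonzero, but `T` need not be a subset of `V`. The index
  -- `T ∩ V` is always admissible and equals `T` exactly when `T ⊆ V`.
  rw [mul_apply, Finset.sum_eq_single_of_mem (T ∩ V) (by simp)]
  · by_cases hTV : T ⊆ V
    · rw [Finset.inter_eq_left.2 hTV]
      by_cases hU : V \ T = U
      · subst hU
        simp [mono, Finset.disjoint_sdiff, Finset.union_sdiff_of_subset hTV]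
      · have hne : ¬ (Disjoint T U ∧ V = T ∪ U) := by
          rintro ⟨hd, rfl⟩
          exact hU (by rw [Finset.union_sdiff_left, hd.symm.sdiff_eq_left])
        by_cases hd : Disjoint T U
        · have hV : V ≠ T ∪ U := fun h' => hne ⟨hd, h'⟩
          simp [mono, hU, hd, hV]
        · simp [mono, hU, hd]
    · have h1 : T ∩ V ≠ T := fun h' => hTV (Finset.inter_eq_left.1 h')
      have h2 : V ≠ T ∪ U := fun h' => hTV (h' ▸ Finset.subset_union_left)
      by_cases hd : Disjoint T U <;> simp [mono, h1, h2, hd]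
  · intro W hW hne
    have : W ≠ T := by
      rintro rfl
      exact hne (Finset.inter_eq_left.2 (Finset.mem_powerset.1 hW)).symm
    simp [mono, this]

theorem sum_mono (ω : Forms D) : ∑ T, mono D T (ω T) = ω := by
  ext U
  rw [sum_apply, Finset.sum_eq_single U] <;> simp +contextual [mono, eq_comm]

theorem incl_apply (r : R) : incl D r = mono D ∅ r := rfl

theorem incl_mul_mono (r s : R) (T : Finset (Fin n)) :
    incl D r * mono D T s = mono D T (r * s) := by
  rw [incl_apply, mono_mul_mono]
  simp [coeff, weight]

theorem incl_mul_e (r : R) (T : Finset (Fin n)) : incl D r * e D T = mono D T r := by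
  rw [e, incl_mul_mono, mul_one]

theorem e_mul_incl (r : R) (T : Finset (Fin n)) :
    e D T * incl D r = incl D ((D.σ ^ weight D T) r) * e D T := by
  rw [incl_mul_e, incl_apply, e, mono_mul_mono]
  simp [coeff]

theorem e_mul_e (T U : Finset (Fin n)) :
    e D T * e D U = if Disjoint T U then coeff D T U • e D (T ∪ U) else 0 := by
  rw [e, e, mono_mul_mono]
  split_ifs with h
  · ext V
    by_cases hV : V = T ∪ U <;> simp [e, mono, hV]
  · rfl

theorem orderedProd_e (T : Finset (Fin n)) : orderedProd (fun i => e D {i}) T = e D T := by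
  induction T using Finset.induction_on_min with
  | empty => rw [orderedProd_empty]; rfl
  | insert m T hm ih =>
    have hmT : m ∉ T := fun h' => (hm m h').false
    rw [orderedProd_insert _ hm, ih, e_mul_e, if_pos (Finset.disjoint_singleton_left.2 hmT),
      coeff_of_lt D hm, one_smul, Finset.insert_eq]

theorem sum_incl_mul_e (ω : Forms D) : ∑ T, incl D (ω T) * e D T = ω := by
  simp only [incl_mul_e, sum_mono]

theorem orderedProd_mem (P : Subalgebra k S) (x : Fin n → S) (h : ∀ i, x i ∈ P)
    (T : Finset (Fin n)) : orderedProd x T ∈ P :=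
  list_prod_mem fun y hy => by
    obtain ⟨i, _, rfl⟩ := List.mem_map.1 hy
    exact h i

theorem subalgebra_eq_top (P : Subalgebra k (Forms D)) (h₀ : ∀ r, incl D r ∈ P)
    (h₁ : ∀ i, e D {i} ∈ P) : P = ⊤ := by
  refine eq_top_iff.2 fun ω _ => ?_
  rw [← sum_incl_mul_e D ω]
  refine sum_mem fun T _ => mul_mem (h₀ _) ?_
  rw [← orderedProd_e]
  exact orderedProd_mem P _ h₁ T

variable {D} in
/-- The homomorphism on the algebra of forms defined by a homomorphism on the coefficients and the
images of the generators. -/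
def lift {f : R →ₐ[k] S} {x : Fin n → S} (h : Compatible D f x) : Forms D →ₐ[k] S :=
  AlgHom.ofLinearMap
    (∑ T, LinearMap.mulRight k (orderedProd x T) ∘ₗ f.toLinearMap ∘ₗ coeffAt D T)
    (by
      rw [LinearMap.sum_apply, Finset.sum_eq_single ∅]
      · simp [one_apply]
      · intro T _ hT
        simp [one_apply, hT]
      · simp)
    (by
      have hmono : ∀ T r, (∑ T, LinearMap.mulRight k (orderedProd x T) ∘ₗ f.toLinearMap ∘ₗ
          coeffAt D T) (mono D T r) = f r * orderedProd x T := by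
        intro T r
        rw [LinearMap.sum_apply, Finset.sum_eq_single T]
        · simp [mono]
        · intro U _ hU
          simp [mono, hU]
        · simp
      intro ω η
      rw [← sum_mono D ω, ← sum_mono D η]
      simp only [Finset.sum_mul_sum, map_sum]
      refine Finset.sum_congr rfl fun T _ => Finset.sum_congr rfl fun U _ => ?_
      rw [mono_mul_mono, hmono, hmono, mul_assoc, ← mul_assoc (orderedProd x T),
        h.orderedProd_comm, mul_assoc, h.orderedProd_mul]
      split_ifs
      · rw [hmono]
        simp [mul_assoc]
      · simp)

variable {D} in
theorem lift_apply {f : R →ₐ[k] S} {x : Fin n → S} (h : Compatible D f x) (ω : Forms D) :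
    lift h ω = ∑ T, f (ω T) * orderedProd x T := by
  change (∑ T, LinearMap.mulRight k (orderedProd x T) ∘ₗ f.toLinearMap ∘ₗ coeffAt D T) ω = _
  rw [LinearMap.sum_apply]
  rfl

variable {D} in
theorem lift_mono {f : R →ₐ[k] S} {x : Fin n → S} (h : Compatible D f x) (T : Finset (Fin n))
    (r : R) : lift h (mono D T r) = f r * orderedProd x T := by
  rw [lift_apply, Finset.sum_eq_single T]
  · simp [mono]
  · intro U _ hU
    simp [mono, hU]
  · simp

variable {D} in
@[simp] theorem lift_incl {f : R →ₐ[k] S} {x : Fin n → S} (h : Compatible D f x) (r : R) :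
    lift h (incl D r) = f r := by
  rw [incl_apply, lift_mono, orderedProd_empty, mul_one]

variable {D} in
theorem lift_e {f : R →ₐ[k] S} {x : Fin n → S} (h : Compatible D f x) (T : Finset (Fin n)) :
    lift h (e D T) = orderedProd x T := by
  rw [e, lift_mono, map_one, one_mul]

theorem incl_mem_degree (r : R) : incl D r ∈ degree D 0 := fun S hS => by
  have : S ≠ ∅ := fun h => hS (by simp [h])
  simp [incl_apply, mono, this]

theorem mono_mem_degree (T : Finset (Fin n)) (r : R) : mono D T r ∈ degree D T.card :=
  fun S hS => if_neg fun h : S = T => hS (by rw [h])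

theorem e_mem_degree (T : Finset (Fin n)) : e D T ∈ degree D T.card := mono_mem_degree D T 1

theorem incl_injective : Function.Injective (incl D) := fun r s h => by
  simpa [incl_apply, mono] using congrArg (fun ω : Forms D => ω ∅) h

theorem range_incl : LinearMap.range (incl D).toLinearMap = degree D 0 := by
  refine le_antisymm ?_ fun ω hω => ⟨ω ∅, ?_⟩
  · rintro _ ⟨r, rfl⟩
    exact incl_mem_degree D r
  · ext S
    change mono D ∅ (ω ∅) S = ω S
    by_cases hS : S = ∅
    · simp [mono, hS]
    · simp [mono, hS, hω S (by simpa using hS)]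

end Forms

/-! ### Differential calculi generated by functions -/

section Generated

variable {k A Ω : Type*} [Field k] [Ring A] [Algebra k A] [Ring Ω] [Algebra k Ω]
  {𝒜 : ℕ → Submodule k Ω} {d : Ω →ₗ[k] Ω} (ι : A →ₐ[k] Ω)

theorem range_mul_pow_le_generatedForms (n : ℕ) :
    LinearMap.range ι.toLinearMap * LinearMap.range (d ∘ₗ ι.toLinearMap) ^ n ≤
      generatedForms d ι n := by
  induction n with
  | zero =>
    rw [pow_zero, mul_one]
    rintro _ ⟨a, rfl⟩
    exact Submodule.subset_span ⟨a, Fin.elim0, by simp⟩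
  | succ n ih =>
    rw [pow_succ, ← mul_assoc]
    refine (mul_le_mul' ih le_rfl).trans (Submodule.mul_le.2 ?_)
    rintro ω hω _ ⟨b, rfl⟩
    refine Submodule.span_induction ?_ ?_ ?_ ?_ hω
    · rintro _ ⟨a₀, a, rfl⟩
      refine Submodule.subset_span ⟨a₀, Fin.snoc a b, ?_⟩
      rw [List.ofFn_succ', List.concat_eq_append]
      simp [mul_assoc]
    · simp
    · intro x y _ _ hx hy
      rw [add_mul]
      exact add_mem hx hy
    · intro r x _ hx
      rw [smul_mul_assoc]
      exact Submodule.smul_mem _ r hx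

theorem IsDGA.generatedForms_le (h : IsDGA 𝒜 d) (hι : ∀ a, ι a ∈ 𝒜 0) (n : ℕ) :
    generatedForms d ι n ≤ 𝒜 n := by
  refine Submodule.span_le.2 ?_
  rintro _ ⟨a₀, a, rfl⟩
  have : ∀ (m : ℕ) (b : Fin m → A), (List.ofFn fun i => d (ι (b i))).prod ∈ 𝒜 m := by
    intro m
    induction m with
    | zero => simpa using h.one_mem
    | succ m ih =>
      intro b
      rw [List.ofFn_succ, List.prod_cons]
      have hmul := h.mul_mem 1 m _ (h.d_mem 0 _ (hι (b 0))) _ (ih fun i => b i.succ)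
      rwa [add_comm] at hmul
  simpa using h.mul_mem _ _ _ (hι a₀) _ (this n a)

/-- All functions in a product of forms `a db` can be collected on the left, which turns products of
one-forms in `A dA` into the shape required of a calculus. -/
theorem IsDGA.range_mul_range_pow_le (h : IsDGA 𝒜 d) (hι : ∀ a, ι a ∈ 𝒜 0) (n : ℕ) :
    (LinearMap.range ι.toLinearMap * LinearMap.range (d ∘ₗ ι.toLinearMap)) ^ n ≤
      LinearMap.range ι.toLinearMap * LinearMap.range (d ∘ₗ ι.toLinearMap) ^ n := by
  set R := LinearMap.range ι.toLinearMap with hR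
  set E := LinearMap.range (d ∘ₗ ι.toLinearMap) with hE
  have h1 : (1 : Submodule k Ω) ≤ R := by
    rw [Submodule.one_le]
    exact ⟨1, map_one ι⟩
  have hRR : R * R ≤ R := by
    refine Submodule.mul_le.2 ?_
    rintro _ ⟨a, rfl⟩ _ ⟨b, rfl⟩
    exact ⟨a * b, map_mul ι a b⟩
  -- This is the Leibniz rule read as `(da) b = d(ab) - a db`.
  have hER : E * R ≤ R * E := by
    refine Submodule.mul_le.2 ?_
    rintro _ ⟨a, rfl⟩ _ ⟨b, rfl⟩
    have hl : d (ι a) * ι b = 1 * d (ι (a * b)) - ι a * d (ι b) := by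
      rw [map_mul, h.leibniz 0 _ (hι a)]
      simp
    change d (ι a) * ι b ∈ _
    rw [hl]
    exact sub_mem (Submodule.mul_mem_mul ⟨1, map_one ι⟩ ⟨_, rfl⟩)
      (Submodule.mul_mem_mul ⟨_, rfl⟩ ⟨_, rfl⟩)
  have hEnR : ∀ m : ℕ, E ^ m * R ≤ R * E ^ m := by
    intro m
    induction m with
    | zero => simp
    | succ m ih =>
      calc E ^ (m + 1) * R = E ^ m * (E * R) := by rw [pow_succ, mul_assoc]
        _ ≤ E ^ m * (R * E) := mul_le_mul' le_rfl hER
        _ = E ^ m * R * E := by rw [mul_assoc]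
        _ ≤ R * E ^ m * E := mul_le_mul' ih le_rfl
        _ = R * E ^ (m + 1) := by rw [pow_succ, mul_assoc]
  induction n with
  | zero => simpa using h1
  | succ m ih =>
    calc (R * E) ^ (m + 1) = (R * E) ^ m * (R * E) := pow_succ _ _
      _ ≤ R * E ^ m * (R * E) := mul_le_mul' ih le_rfl
      _ = R * (E ^ m * R) * E := by simp only [mul_assoc]
      _ ≤ R * (R * E ^ m) * E := mul_le_mul' (mul_le_mul' le_rfl (hEnR m)) le_rfl
      _ = R * R * (E ^ m * E) := by simp only [mul_assoc]
      _ ≤ R * (E ^ m * E) := mul_le_mul' hRR le_rfl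
      _ = R * E ^ (m + 1) := by rw [pow_succ]

variable {ι} in
/-- A differential graded algebra whose forms of degree `n` are sums of forms
`a⁰ da¹ ∧ ⋯ ∧ daⁿ` is a differential calculus. -/
theorem IsDGA.isDifferentialCalculus (h : IsDGA 𝒜 d) (hinj : Function.Injective ι)
    (hι : LinearMap.range ι.toLinearMap = 𝒜 0)
    (hgen : ∀ n, 𝒜 n ≤
      LinearMap.range ι.toLinearMap * LinearMap.range (d ∘ₗ ι.toLinearMap) ^ n) :
    IsDifferentialCalculus 𝒜 d ι where
  toIsDGA := h
  ι_injective := hinj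
  range_ι := hι
  generated n := le_antisymm ((hgen n).trans (range_mul_pow_le_generatedForms ι n))
    (h.generatedForms_le ι (fun a => hι.le ⟨a, rfl⟩) n)

end Generated

theorem Forms.orderedProd_mem_pow {k S : Type*} [Field k] [Ring S] [Algebra k S] {n : ℕ}
    (P : Submodule k S) (x : Fin n → S) (h : ∀ i, x i ∈ P) (T : Finset (Fin n)) :
    Forms.orderedProd x T ∈ P ^ T.card := by
  induction T using Finset.induction_on_min with
  | empty => simpa using ⟨1, map_one _⟩
  | insert i T hi ih =>
    rw [Forms.orderedProd_insert _ hi,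
      Finset.card_insert_of_notMem (fun h' => (hi i h').false), pow_succ']
    exact Submodule.mul_mem_mul (h i) ih

/-- An algebra of forms which is a differential graded algebra, and whose generators lie in
`R dR`, is a differential calculus. -/
theorem Forms.isDifferentialCalculus {k R : Type*} [Field k] [Ring R] [Algebra k R] {n : ℕ}
    (D : FormData k R n) {d : Forms D →ₗ[k] Forms D} (h : IsDGA (Forms.degree D) d)
    (he : ∀ i, Forms.e D {i} ∈ LinearMap.range (Forms.incl D).toLinearMap *
      LinearMap.range (d ∘ₗ (Forms.incl D).toLinearMap)) :
    IsDifferentialCalculus (Forms.degree D) d (Forms.incl D) := by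
  refine h.isDifferentialCalculus (Forms.incl_injective D) (Forms.range_incl D) fun m ω hω => ?_
  rw [← Forms.sum_incl_mul_e D ω]
  refine sum_mem fun T _ => ?_
  by_cases hT : T.card = m
  · subst hT
    -- The basis form of `T` is the ordered product of `T.card` generators, each in `R dR` by
    -- hypothesis.
    have hpow := h.range_mul_range_pow_le _ (Forms.incl_mem_degree D) _
      (Forms.orderedProd_mem_pow _ _ he T)
    rw [Forms.orderedProd_e] at hpow
    have hR : LinearMap.range (Forms.incl D).toLinearMap *
        LinearMap.range (Forms.incl D).toLinearMap ≤
          LinearMap.range (Forms.incl D).toLinearMap := by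
      refine Submodule.mul_le.2 ?_
      rintro _ ⟨a, rfl⟩ _ ⟨b, rfl⟩
      exact ⟨a * b, map_mul (Forms.incl D) a b⟩
    refine mul_le_mul' hR le_rfl ?_
    rw [mul_assoc]
    exact Submodule.mul_mem_mul ⟨_, rfl⟩ hpow
  · rw [hω T hT, map_zero, zero_mul]
    exact zero_mem _

/-! ### The graded tensor product of differential graded algebras -/

section Tensor

variable {k Ω Ω' : Type*} [Field k] [Ring Ω] [Algebra k Ω] [Ring Ω'] [Algebra k Ω']
  {𝒜 : ℕ → Submodule k Ω} {ℬ : ℕ → Submodule k Ω'} [GradedAlgebra 𝒜] [GradedAlgebra ℬ]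
  {d : Ω →ₗ[k] Ω} {d' : Ω' →ₗ[k] Ω'}

theorem parity_of_mem {n : ℕ} {ω : Ω} (hω : ω ∈ 𝒜 n) : parity 𝒜 ω = (-1 : k) ^ n • ω := by
  lift ω to 𝒜 n using hω
  rw [parity, LinearMap.comp_apply, LinearEquiv.coe_coe, DirectSum.decomposeLinearEquiv_apply,
    DirectSum.decompose_coe, ← DirectSum.lof_eq_of k, DirectSum.toModule_lof]
  rfl

theorem tmul_mul_tmul_of_mem {i j : ℕ} (ω : Ω) {η : Ω'} (hη : η ∈ ℬ j) {ω' : Ω} (hω' : ω' ∈ 𝒜 i)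
    (η' : Ω') : (GradedTensorProduct.tmul k ω η * GradedTensorProduct.tmul k ω' η' : 𝒜 ᵍ⊗[k] ℬ) =
      (-1 : k) ^ (j * i) • GradedTensorProduct.tmul k (ω * ω') (η * η') := by
  rw [GradedTensorProduct.tmul_coe_mul_coe_tmul 𝒜 ℬ ω ⟨η, hη⟩ ⟨ω', hω'⟩ η']
  rcases Nat.even_or_odd (j * i) with h | h
  · simp [h.neg_one_pow]
  · simp [h.neg_one_pow]

theorem add_gtmul (ω ω' : Ω) (η : Ω') :
    (GradedTensorProduct.tmul k (ω + ω') η : 𝒜 ᵍ⊗[k] ℬ) =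
      GradedTensorProduct.tmul k ω η + GradedTensorProduct.tmul k ω' η := by
  simp only [GradedTensorProduct.tmul, TensorProduct.add_tmul, map_add]

theorem sub_gtmul (ω ω' : Ω) (η : Ω') :
    (GradedTensorProduct.tmul k (ω - ω') η : 𝒜 ᵍ⊗[k] ℬ) =
      GradedTensorProduct.tmul k ω η - GradedTensorProduct.tmul k ω' η := by
  simp only [GradedTensorProduct.tmul, TensorProduct.sub_tmul, map_sub]

theorem gtmul_add (ω : Ω) (η η' : Ω') :
    (GradedTensorProduct.tmul k ω (η + η') : 𝒜 ᵍ⊗[k] ℬ) =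
      GradedTensorProduct.tmul k ω η + GradedTensorProduct.tmul k ω η' := by
  simp only [GradedTensorProduct.tmul, TensorProduct.tmul_add, map_add]

@[simp] theorem zero_gtmul (η : Ω') : (GradedTensorProduct.tmul k (0 : Ω) η : 𝒜 ᵍ⊗[k] ℬ) = 0 := by
  rw [GradedTensorProduct.tmul, TensorProduct.zero_tmul, map_zero]

@[simp] theorem gtmul_zero (ω : Ω) : (GradedTensorProduct.tmul k ω (0 : Ω') : 𝒜 ᵍ⊗[k] ℬ) = 0 := by
  rw [GradedTensorProduct.tmul, TensorProduct.tmul_zero, map_zero]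

theorem smul_gtmul (r : k) (ω : Ω) (η : Ω') :
    (GradedTensorProduct.tmul k (r • ω) η : 𝒜 ᵍ⊗[k] ℬ) = r • GradedTensorProduct.tmul k ω η := by
  rw [GradedTensorProduct.tmul, ← TensorProduct.smul_tmul', map_smul]

theorem gtmul_smul (r : k) (ω : Ω) (η : Ω') :
    (GradedTensorProduct.tmul k ω (r • η) : 𝒜 ᵍ⊗[k] ℬ) = r • GradedTensorProduct.tmul k ω η := by
  rw [GradedTensorProduct.tmul, TensorProduct.tmul_smul, map_smul]

theorem gradedTensor_induction {p : (𝒜 ᵍ⊗[k] ℬ) → Prop} (zero : p 0)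
    (add : ∀ x y, p x → p y → p (x + y))
    (tmul : ∀ i j, ∀ ω ∈ 𝒜 i, ∀ η ∈ ℬ j, p (GradedTensorProduct.tmul k ω η)) (x : 𝒜 ᵍ⊗[k] ℬ) :
    p x := by
  obtain ⟨x, rfl⟩ := (GradedTensorProduct.of k 𝒜 ℬ).surjective x
  induction x using TensorProduct.induction_on with
  | zero => simpa using zero
  | add x y hx hy => simpa using add _ _ hx hy
  | tmul ω η =>
    induction ω using DirectSum.Decomposition.inductionOn 𝒜 with
    | zero => simpa using zero
    | add ω ω' h₁ h₂ => simpa [TensorProduct.add_tmul] using add _ _ h₁ h₂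
    | homogeneous ω =>
      induction η using DirectSum.Decomposition.inductionOn ℬ with
      | zero => simpa using zero
      | add ω ω' h₁ h₂ => simpa [TensorProduct.tmul_add] using add _ _ h₁ h₂
      | homogeneous η => exact tmul _ _ _ ω.2 _ η.2

theorem tensorD_tmul {i : ℕ} {ω : Ω} (hω : ω ∈ 𝒜 i) (η : Ω') :
    tensorD 𝒜 ℬ d d' (GradedTensorProduct.tmul k ω η) =
      GradedTensorProduct.tmul k (d ω) η +
        (-1 : k) ^ i • GradedTensorProduct.tmul k ω (d' η) := by
  rw [← smul_gtmul]
  simp [tensorD, parity_of_mem hω]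

/-- Both sides expand into the same four terms, one for each factor that can be differentiated; only
the signs have to be compared. -/
theorem tensorD_tmul_mul_tmul (h : IsDGA 𝒜 d) (h' : IsDGA ℬ d') {i j i' : ℕ} {ω ω' : Ω}
    {η η' : Ω'} (hω : ω ∈ 𝒜 i) (hη : η ∈ ℬ j) (hω' : ω' ∈ 𝒜 i') :
    tensorD 𝒜 ℬ d d' (GradedTensorProduct.tmul k ω η * GradedTensorProduct.tmul k ω' η') =
      tensorD 𝒜 ℬ d d' (GradedTensorProduct.tmul k ω η) * GradedTensorProduct.tmul k ω' η' +
      (-1 : k) ^ (i + j) • (GradedTensorProduct.tmul k ω η *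
        tensorD 𝒜 ℬ d d' (GradedTensorProduct.tmul k ω' η')) := by
  rw [tmul_mul_tmul_of_mem _ hη hω', map_smul, tensorD_tmul (h.mul_mem _ _ _ hω _ hω'),
    tensorD_tmul hω, tensorD_tmul hω', h.leibniz _ _ hω, h'.leibniz _ _ hη, add_mul, mul_add,
    smul_mul_assoc, mul_smul_comm, tmul_mul_tmul_of_mem _ hη hω',
    tmul_mul_tmul_of_mem _ (h'.d_mem _ _ hη) hω', tmul_mul_tmul_of_mem _ hη (h.d_mem _ _ hω'),
    tmul_mul_tmul_of_mem _ hη hω']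
  simp only [add_gtmul, gtmul_add, smul_gtmul, gtmul_smul, smul_add, smul_smul, ← pow_add]
  -- The sign exponents on the two sides agree only modulo 2, so an even part must be discarded
  -- before they can be matched.
  have hsq : ∀ (a b : ℕ), (-1 : k) ^ (a + 2 * b) = (-1) ^ a := by
    intro a b
    simp [pow_add, pow_mul]
  rw [show i + j + j * (i' + 1) = j * i' + i + 2 * j by ring, hsq,
    show j * i' + (i + i') = i + (j + 1) * i' by ring,
    show i + j + (i' + j * i') = j * i' + (i + i' + j) by ring]
  abel

/-- If `x` has total degree `n`, the differential of the tensor product satisfies the Leibniz rule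
for products with `x` on the left. -/
theorem tensorD_mul (h : IsDGA 𝒜 d) (h' : IsDGA ℬ d') {n : ℕ} {x : 𝒜 ᵍ⊗[k] ℬ}
    (hx : x ∈ tensorDegree 𝒜 ℬ n) (y : 𝒜 ᵍ⊗[k] ℬ) :
    tensorD 𝒜 ℬ d d' (x * y) =
      tensorD 𝒜 ℬ d d' x * y + (-1 : k) ^ n • (x * tensorD 𝒜 ℬ d d' y) := by
  induction y using gradedTensor_induction with
  | zero => simp
  | add y z hy hz => rw [mul_add, map_add, hy, hz, map_add, mul_add, mul_add, smul_add]; abel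
  | tmul i' j' ω' hω' η' _ =>
    induction hx using Submodule.span_induction with
    | mem x hx =>
      obtain ⟨i, j, rfl, ω, hω, η, hη, rfl⟩ := hx
      exact tensorD_tmul_mul_tmul h h' hω hη hω'
    | zero => simp
    | add x z _ _ hx hz => rw [add_mul, map_add, hx, hz, map_add, add_mul, add_mul, smul_add]; abel
    | smul r x _ hx =>
      rw [smul_mul_assoc, map_smul, hx, map_smul, smul_mul_assoc, smul_mul_assoc, smul_add,
        smul_comm r]

theorem tmul_mem_tensorDegree {i j : ℕ} {ω : Ω} {η : Ω'} (hω : ω ∈ 𝒜 i) (hη : η ∈ ℬ j) :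
    GradedTensorProduct.tmul k ω η ∈ tensorDegree 𝒜 ℬ (i + j) :=
  Submodule.subset_span ⟨i, j, rfl, ω, hω, η, hη, rfl⟩

instance : SetLike.GradedMonoid (tensorDegree 𝒜 ℬ) where
  one_mem := tmul_mem_tensorDegree (i := 0) (j := 0) SetLike.GradedOne.one_mem
    SetLike.GradedOne.one_mem
  mul_mem m n x y hx hy := by
    induction hx using Submodule.span_induction with
    | zero => simp
    | add x z _ _ hx hz => rw [add_mul]; exact add_mem hx hz
    | smul r x _ hx => rw [smul_mul_assoc]; exact Submodule.smul_mem _ _ hx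
    | mem x hx =>
      obtain ⟨i, j, rfl, ω, hω, η, hη, rfl⟩ := hx
      induction hy using Submodule.span_induction with
      | zero => simp
      | add x z _ _ hx hz => rw [mul_add]; exact add_mem hx hz
      | smul r x _ hx => rw [mul_smul_comm]; exact Submodule.smul_mem _ _ hx
      | mem y hy =>
        obtain ⟨i', j', rfl, ω', hω', η', hη', rfl⟩ := hy
        rw [tmul_mul_tmul_of_mem _ hη hω', add_add_add_comm]
        exact Submodule.smul_mem _ _ (tmul_mem_tensorDegree (SetLike.GradedMul.mul_mem hω hω')
          (SetLike.GradedMul.mul_mem hη hη'))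

end Tensor

/-! ### Checking properties of maps out of forms on generators -/

section FormsMaps

open Forms

variable {k R Ω' S : Type*} [Field k] [Ring R] [Algebra k R] [Ring Ω'] [Algebra k Ω'] {n : ℕ}
  {D : FormData k R n} {ℬ : ℕ → Submodule k Ω'} [GradedAlgebra ℬ] [Ring S] [Algebra k S]

theorem Forms.orderedProd_mem_graded (P : ℕ → Submodule k S) [SetLike.GradedMonoid P]
    (x : Fin n → S) (h : ∀ i, x i ∈ P 1) (T : Finset (Fin n)) : orderedProd x T ∈ P T.card := by
  induction T using Finset.induction_on_min with
  | empty => simpa using SetLike.GradedOne.one_mem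
  | insert i T hi ih =>
    rw [Forms.orderedProd_insert _ hi,
      Finset.card_insert_of_notMem (fun h' => (hi i h').false), add_comm]
    exact SetLike.GradedMul.mul_mem (h i) ih

/-- A homomorphism out of an algebra of forms respects degrees if it does so on the
coefficients and on the generators. -/
theorem Forms.map_mem_of_generators (P : ℕ → Submodule k S) [SetLike.GradedMonoid P]
    (F : Forms D →ₐ[k] S) (h₀ : ∀ r, F (incl D r) ∈ P 0) (h₁ : ∀ i, F (e D {i}) ∈ P 1) {m : ℕ}
    {ω : Forms D} (hω : ω ∈ degree D m) : F ω ∈ P m := by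
  rw [← sum_incl_mul_e D ω, map_sum]
  refine sum_mem fun T _ => ?_
  by_cases hT : T.card = m
  · subst hT
    have hF : F (e D T) = orderedProd (fun i => F (e D {i})) T := by
      rw [← orderedProd_e, orderedProd, orderedProd, map_list_prod, List.map_map]
      rfl
    rw [map_mul, hF, ← zero_add T.card]
    exact SetLike.GradedMul.mul_mem (h₀ _) (orderedProd_mem_graded P _ h₁ T)
  · rw [hω T hT]
    simp

/-- A property of forms which holds for the coefficients and for the generators, and which is stable
under sums and under products with homogeneous left factors, holds for all forms. -/
theorem Forms.induction_generators {p : Forms D → Prop} (add : ∀ ω η, p ω → p η → p (ω + η))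
    (mul : ∀ m, ∀ ω ∈ degree D m, ∀ η, p ω → p η → p (ω * η)) (incl : ∀ r, p (incl D r))
    (gen : ∀ i, p (e D {i})) (ω : Forms D) : p ω := by
  rw [← sum_incl_mul_e D ω]
  refine Finset.sum_induction _ p add (by simpa using incl 0) fun T hT => ?_
  refine mul 0 _ (incl_mem_degree D _) _ (incl _) ?_
  clear hT
  rw [← orderedProd_e]
  induction T using Finset.induction_on_min with
  | empty => simpa using incl 1
  | insert i T hi ih =>
    rw [orderedProd_insert _ hi]
    exact mul 1 _ (by simpa using e_mem_degree D {i}) _ (gen i) ih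

/-- A degree preserving homomorphism out of an algebra of forms commutes with the differentials if
it does so on the coefficients and on the generators. -/
theorem Forms.comm_tensorD_of_generators {d : Forms D →ₗ[k] Forms D} {d' : Ω' →ₗ[k] Ω'}
    (h : IsDGA (degree D) d) (h' : IsDGA ℬ d') (F : Forms D →ₐ[k] (degree D ᵍ⊗[k] ℬ))
    (hdeg : ∀ m, ∀ ω ∈ degree D m, F ω ∈ tensorDegree (degree D) ℬ m)
    (h₀ : ∀ r, F (d (incl D r)) = tensorD (degree D) ℬ d d' (F (incl D r)))
    (h₁ : ∀ i, F (d (e D {i})) = tensorD (degree D) ℬ d d' (F (e D {i}))) (ω : Forms D) :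
    F (d ω) = tensorD (degree D) ℬ d d' (F ω) := by
  refine Forms.induction_generators (p := fun ω => F (d ω) = tensorD (degree D) ℬ d d' (F ω))
    (fun ω η h1 h2 => ?_) (fun m ω hω η h1 h2 => ?_) h₀ h₁ ω
  · rw [map_add, map_add, h1, h2, map_add, map_add]
  · rw [h.leibniz m ω hω, map_mul F ω, tensorD_mul h h' (hdeg m ω hω), map_add, map_smul,
      map_mul, map_mul, h1, h2]

end FormsMaps

/-! ### Generators of the function algebra and twisted derivations -/

section FunctionAlgebra

variable {k : Type*} [Field k] (q : kˣ)

theorem subalgebra_eq_top_of_gen (P : Subalgebra k (SUq q)) (h : ∀ g, gen q g ∈ P) : P = ⊤ := by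
  refine eq_top_iff.2 fun a _ => ?_
  obtain ⟨a, rfl⟩ := RingQuot.mkAlgHom_surjective k (Rel q) a
  have hle : Algebra.adjoin k (Set.range (FreeAlgebra.ι k)) ≤
      P.comap (RingQuot.mkAlgHom k (Rel q)) := by
    refine Algebra.adjoin_le ?_
    rintro _ ⟨g, rfl⟩
    exact h g
  rw [FreeAlgebra.adjoin_range_ι] at hle
  exact hle (Algebra.mem_top (R := k))

variable {q} in
theorem gen_induction {p : SUq q → Prop} (gen : ∀ g, p (gen q g))
    (algebraMap : ∀ r, p (algebraMap k _ r)) (add : ∀ a b, p a → p b → p (a + b))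
    (mul : ∀ a b, p a → p b → p (a * b)) (a : SUq q) : p a := by
  let Q : Subalgebra k (SUq q) :=
    { carrier := {a | p a}
      mul_mem' := fun {a b} => mul a b
      add_mem' := fun {a b} => add a b
      algebraMap_mem' := algebraMap }
  have hQ : a ∈ Q := by
    rw [subalgebra_eq_top_of_gen q Q gen]
    trivial
  exact hQ

variable {q} in
theorem homOfRelations_gen {S : Type*} [Ring S] [Algebra k S] {a b c d : S}
    (h : Relations q a b c d) (g : Gen) : homOfRelations h (gen q g) = genMap a b c d g := by
  simp [homOfRelations, gen, RingQuot.liftAlgHom_mkAlgHom_apply]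

@[simp] theorem twist_α : twist q (gen q .α) = (q : k) • gen q .α := homOfRelations_gen _ _
@[simp] theorem twist_β : twist q (gen q .β) = (q : k)⁻¹ • gen q .β := homOfRelations_gen _ _
@[simp] theorem twist_γ : twist q (gen q .γ) = (q : k) • gen q .γ := homOfRelations_gen _ _
@[simp] theorem twist_δ : twist q (gen q .δ) = (q : k)⁻¹ • gen q .δ := homOfRelations_gen _ _

/-- A homomorphism to `2 × 2` matrices which on generators has the form `(g, *; 0, τ g)` has this
form everywhere. -/
theorem triangular_of_gen {P : SUq q →ₐ[k] Matrix (Fin 2) (Fin 2) (SUq q)} {τ : SUq q →ₐ[k] SUq q}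
    (h : ∀ g, P (gen q g) 0 0 = gen q g ∧ P (gen q g) 1 0 = 0 ∧ P (gen q g) 1 1 = τ (gen q g))
    (f : SUq q) : P f 0 0 = f ∧ P f 1 0 = 0 ∧ P f 1 1 = τ f := by
  induction f using gen_induction with
  | gen g => exact h g
  | algebraMap r => simp [Matrix.algebraMap_matrix_apply]
  | add f g hf hg =>
    obtain ⟨h1, h2, h3⟩ := hf
    obtain ⟨h4, h5, h6⟩ := hg
    simp [h1, h2, h3, h4, h5, h6]
  | mul f g hf hg =>
    obtain ⟨h1, h2, h3⟩ := hf
    obtain ⟨h4, h5, h6⟩ := hg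
    simp [Matrix.mul_apply, h1, h2, h3, h4, h5, h6]

/-- The corner of a product of triangular matrices is a twisted Leibniz rule. Encoding a partial
derivative as a matrix homomorphism therefore makes it well defined on the quotient algebra. -/
theorem entry_mul {P : SUq q →ₐ[k] Matrix (Fin 2) (Fin 2) (SUq q)} {τ : SUq q →ₐ[k] SUq q}
    (h : ∀ g, P (gen q g) 0 0 = gen q g ∧ P (gen q g) 1 0 = 0 ∧ P (gen q g) 1 1 = τ (gen q g))
    (f g : SUq q) : entry q P (f * g) = f * entry q P g + entry q P f * τ g := by
  simp [entry, Matrix.mul_apply, (triangular_of_gen q h f).1, (triangular_of_gen q h g).2.2]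

theorem entry_partialPlus_mul (f g : SUq q) : entry q (partialPlusHom q) (f * g) =
    f * entry q (partialPlusHom q) g + entry q (partialPlusHom q) f * twist q g :=
  entry_mul q (fun g => by cases g <;> simp [partialPlusHom, homOfRelations_gen, genMap]) f g

theorem entry_partialMinus_mul (f g : SUq q) : entry q (partialMinusHom q) (f * g) =
    f * entry q (partialMinusHom q) g + entry q (partialMinusHom q) f * twist q g :=
  entry_mul q (fun g => by cases g <;> simp [partialMinusHom, homOfRelations_gen, genMap]) f g

theorem entry_partialZero_mul (f g : SUq q) : entry q (partialZeroHom q) (f * g) =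
    f * entry q (partialZeroHom q) g + entry q (partialZeroHom q) f * (twist q ^ 2) g :=
  entry_mul q (fun g => by
    cases g <;> simp [partialZeroHom, homOfRelations_gen, genMap, smul_smul, pow_two]) f g

/-- The elements satisfying a twisted commutation rule with a fixed `x` form a subalgebra, so the
rule reduces to four checks. -/
theorem comm_of_gen {S : Type*} [Ring S] [Algebra k S] {F : SUq q →ₐ[k] S} {x : S}
    {τ : SUq q →ₐ[k] SUq q} (h : ∀ g, x * F (gen q g) = F (τ (gen q g)) * x) (a : SUq q) :
    x * F a = F (τ a) * x := by
  induction a using gen_induction with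
  | gen g => exact h g
  | algebraMap r => rw [AlgHom.commutes, AlgHom.commutes, AlgHom.commutes, Algebra.commutes]
  | add a b ha hb => rw [map_add, mul_add, ha, hb, map_add, map_add, add_mul]
  | mul a b ha hb => rw [map_mul, ← mul_assoc, ha, mul_assoc, hb, ← mul_assoc, map_mul, map_mul]

end FunctionAlgebra

/-! ### The differential on `Ω(A)` -/

section FormsOnSUq

open Forms

variable {k : Type*} [Field k] (q : kˣ)

theorem ePlus_mul_incl (a : SUq q) : ePlus q * inclA q a = inclA q (twist q a) * ePlus q := by
  have hw : weight (dataA q) {0} = 1 := by simp [weight, dataA]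
  have h := e_mul_incl (dataA q) a {0}
  rwa [hw, pow_one] at h

theorem eMinus_mul_incl (a : SUq q) : eMinus q * inclA q a = inclA q (twist q a) * eMinus q := by
  have hw : weight (dataA q) {1} = 1 := by simp [weight, dataA]
  have h := e_mul_incl (dataA q) a {1}
  rwa [hw, pow_one] at h

theorem eZero_mul_incl (a : SUq q) :
    eZero q * inclA q a = inclA q (twist q (twist q a)) * eZero q := by
  have hw : weight (dataA q) {2} = 2 := by simp [weight, dataA]
  have h := e_mul_incl (dataA q) a {2}
  rwa [hw, pow_two] at h

theorem ePlus_mul_incl_mul (a : SUq q) (x : FormsA q) :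
    ePlus q * (inclA q a * x) = inclA q (twist q a) * (ePlus q * x) := by
  rw [← mul_assoc, ePlus_mul_incl, mul_assoc]

theorem eMinus_mul_incl_mul (a : SUq q) (x : FormsA q) :
    eMinus q * (inclA q a * x) = inclA q (twist q a) * (eMinus q * x) := by
  rw [← mul_assoc, eMinus_mul_incl, mul_assoc]

theorem eZero_mul_incl_mul (a : SUq q) (x : FormsA q) :
    eZero q * (inclA q a * x) = inclA q (twist q (twist q a)) * (eZero q * x) := by
  rw [← mul_assoc, eZero_mul_incl, mul_assoc]

theorem ePlus_mul_ePlus : ePlus q * ePlus q = 0 := by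
  rw [ePlus, e_mul_e, if_neg (by decide)]

theorem eMinus_mul_eMinus : eMinus q * eMinus q = 0 := by
  rw [eMinus, e_mul_e, if_neg (by decide)]

theorem eZero_mul_eZero : eZero q * eZero q = 0 := by
  rw [eZero, e_mul_e, if_neg (by decide)]

theorem ePlus_mul_eMinus : ePlus q * eMinus q = e (dataA q) {0, 1} := by
  rw [ePlus, eMinus, e_mul_e, if_pos (by decide)]
  simp [coeff]

theorem ePlus_mul_eZero : ePlus q * eZero q = e (dataA q) {0, 2} := by
  rw [ePlus, eZero, e_mul_e, if_pos (by decide)]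
  simp [coeff]

theorem eMinus_mul_eZero : eMinus q * eZero q = e (dataA q) {1, 2} := by
  rw [eMinus, eZero, e_mul_e, if_pos (by decide)]
  simp [coeff]

theorem eMinus_mul_ePlus : eMinus q * ePlus q = -((q : k) ^ 2) • (ePlus q * eMinus q) := by
  have hc : coeff (dataA q) {1} {0} = -((q : k) ^ 2) := by simp [coeff, dataA]
  rw [ePlus_mul_eMinus, ePlus, eMinus, e_mul_e, if_pos (by decide), Finset.union_comm, hc,
    ← Finset.insert_eq]

theorem eZero_mul_ePlus : eZero q * ePlus q = -((q : k) ^ 4) • (ePlus q * eZero q) := by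
  have hc : coeff (dataA q) {2} {0} = -((q : k) ^ 4) := by simp [coeff, dataA]
  rw [ePlus_mul_eZero, ePlus, eZero, e_mul_e, if_pos (by decide), Finset.union_comm, hc,
    ← Finset.insert_eq]

theorem eZero_mul_eMinus : eZero q * eMinus q = -((q : k) ^ 4)⁻¹ • (eMinus q * eZero q) := by
  have hc : coeff (dataA q) {2} {1} = -((q : k) ^ 4)⁻¹ := by simp [coeff, dataA]
  rw [eMinus_mul_eZero, eMinus, eZero, e_mul_e, if_pos (by decide), Finset.union_comm, hc,
    ← Finset.insert_eq]

theorem dFunctions_apply (a : SUq q) : dFunctions q a =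
    inclA q (entry q (partialPlusHom q) a) * ePlus q +
    inclA q (entry q (partialMinusHom q) a) * eMinus q +
    inclA q (entry q (partialZeroHom q) a) * eZero q := rfl

theorem dFunctions_α : dFunctions q (gen q .α) =
    inclA q (gen q .α) * eZero q + (q : k) • (inclA q (gen q .β) * ePlus q) := by
  simp [dFunctions_apply, entry, partialPlusHom, partialMinusHom, partialZeroHom,
    homOfRelations_gen, genMap]
  abel

theorem dFunctions_β : dFunctions q (gen q .β) =
    inclA q (gen q .α) * eMinus q - ((q : k) ^ 2)⁻¹ • (inclA q (gen q .β) * eZero q) := by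
  simp [dFunctions_apply, entry, partialPlusHom, partialMinusHom, partialZeroHom,
    homOfRelations_gen, genMap]
  abel

theorem dFunctions_γ : dFunctions q (gen q .γ) =
    inclA q (gen q .γ) * eZero q + (q : k) • (inclA q (gen q .δ) * ePlus q) := by
  simp [dFunctions_apply, entry, partialPlusHom, partialMinusHom, partialZeroHom,
    homOfRelations_gen, genMap]
  abel

theorem dFunctions_δ : dFunctions q (gen q .δ) =
    inclA q (gen q .γ) * eMinus q - ((q : k) ^ 2)⁻¹ • (inclA q (gen q .δ) * eZero q) := by
  simp [dFunctions_apply, entry, partialPlusHom, partialMinusHom, partialZeroHom,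
    homOfRelations_gen, genMap]
  abel

/-- The twist in each partial derivative is exactly the one produced by moving the corresponding `e
i` past a function, so the twisted rules combine into an untwisted one. -/
theorem dFunctions_mul (a b : SUq q) :
    dFunctions q (a * b) = inclA q a * dFunctions q b + dFunctions q a * inclA q b := by
  simp only [dFunctions_apply, entry_partialPlus_mul, entry_partialMinus_mul,
    entry_partialZero_mul, map_add, map_mul, add_mul, mul_add, mul_assoc, ePlus_mul_incl,
    eMinus_mul_incl, eZero_mul_incl, pow_two, AlgHom.mul_apply]
  abel

theorem dFunctions_one : dFunctions q 1 = 0 := by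
  have h := dFunctions_mul q 1 1
  simpa using h

/-- `a ↦ (a, da; 0, a)`. -/
def jetHom : SUq q →ₐ[k] Matrix (Fin 2) (Fin 2) (FormsA q) :=
  AlgHom.ofLinearMap
    { toFun := fun a => !![inclA q a, dFunctions q a; 0, inclA q a]
      map_add' := fun a b => by ext i j; fin_cases i <;> fin_cases j <;> simp
      map_smul' := fun r a => by ext i j; fin_cases i <;> fin_cases j <;> simp }
    (by simp [dFunctions_one, Matrix.one_fin_two])
    (fun a b => by simp [dFunctions_mul])

theorem jetHom_apply (a : SUq q) :
    jetHom q a = !![inclA q a, dFunctions q a; 0, inclA q a] := rfl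

/-- `e i ↦ (-e i, d(e i); 0, e i)`. -/
def jetGen (i : Fin 3) : Matrix (Fin 2) (Fin 2) (FormsA q) :=
  !![-e (dataA q) {i}, dBasis q {i}; 0, e (dataA q) {i}]

theorem jetGen_zero : jetGen q 0 = !![-ePlus q,
    (-((q : k) ^ 2 * (1 + ((q : k) ^ 2)⁻¹))) • (ePlus q * eZero q); 0, ePlus q] := by
  simp [jetGen, dBasis, ePlus]

theorem jetGen_one : jetGen q 1 = !![-eMinus q,
    (((q : k) ^ 2)⁻¹ * (1 + ((q : k) ^ 2)⁻¹)) • (eMinus q * eZero q); 0, eMinus q] := by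
  simp [jetGen, dBasis, eMinus]

theorem jetGen_two : jetGen q 2 =
    !![-eZero q, ((q : k) ^ 3) • (ePlus q * eMinus q); 0, eZero q] := by
  simp [jetGen, dBasis, eZero]

theorem eMinus_mul_ePlus_mul (x : FormsA q) :
    eMinus q * (ePlus q * x) = -((q : k) ^ 2) • (ePlus q * (eMinus q * x)) := by
  rw [← mul_assoc, eMinus_mul_ePlus, smul_mul_assoc, mul_assoc]

theorem eZero_mul_ePlus_mul (x : FormsA q) :
    eZero q * (ePlus q * x) = -((q : k) ^ 4) • (ePlus q * (eZero q * x)) := by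
  rw [← mul_assoc, eZero_mul_ePlus, smul_mul_assoc, mul_assoc]

theorem eZero_mul_eMinus_mul (x : FormsA q) :
    eZero q * (eMinus q * x) = -((q : k) ^ 4)⁻¹ • (eMinus q * (eZero q * x)) := by
  rw [← mul_assoc, eZero_mul_eMinus, smul_mul_assoc, mul_assoc]

theorem ePlus_mul_ePlus_mul (x : FormsA q) : ePlus q * (ePlus q * x) = 0 := by
  rw [← mul_assoc, ePlus_mul_ePlus, zero_mul]

theorem eMinus_mul_eMinus_mul (x : FormsA q) : eMinus q * (eMinus q * x) = 0 := by
  rw [← mul_assoc, eMinus_mul_eMinus, zero_mul]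

/-- With `y = dx`, `b = da`, `b' = da'`, the second hypothesis is the differential of the first. -/
theorem triangular_comm {S : Type*} [Ring S] {x y a b a' b' : S} (h₁ : x * a = a' * x)
    (h₂ : y * a - x * b = a' * y + b' * x) :
    !![-x, y; 0, x] * !![a, b; 0, a] = !![a', b'; 0, a'] * !![-x, y; 0, x] := by
  rw [Matrix.mul_fin_two, Matrix.mul_fin_two]
  simp [h₁, ← h₂, neg_add_eq_sub]

/-- This says that the differential is consistent with the bimodule relations `e i * a = σ^(w i) a *
e i`. It is here that the coefficients of `de⁺`, `de⁻`, `de⁰` have to fit those of `dα`, `dβ`, `dγ`,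
`dδ`. -/
theorem jetGen_comm (i : Fin 3) (a : SUq q) :
    jetGen q i * jetHom q a = jetHom q ((twist q ^ (dataA q).w i) a) * jetGen q i := by
  have hq : (q : k) ≠ 0 := q.ne_zero
  fin_cases i
  · refine comm_of_gen q (fun g => ?_) a
    change jetGen q 0 * _ = jetHom q ((twist q ^ 1) _) * jetGen q 0
    rw [jetGen_zero, pow_one]
    refine triangular_comm (ePlus_mul_incl q _) ?_
    cases g <;>
    · simp only [twist_α, twist_β, twist_γ, twist_δ, map_smul, dFunctions_α, dFunctions_β,
        dFunctions_γ, dFunctions_δ, smul_mul_assoc, mul_smul_comm, mul_add, mul_sub, add_mul,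
        sub_mul, mul_assoc, eZero_mul_incl, ePlus_mul_incl_mul, ePlus_mul_ePlus, eMinus_mul_ePlus,
        eZero_mul_ePlus, mul_zero]
      match_scalars <;> field_simp <;> ring_nf
  · refine comm_of_gen q (fun g => ?_) a
    change jetGen q 1 * _ = jetHom q ((twist q ^ 1) _) * jetGen q 1
    rw [jetGen_one, pow_one]
    refine triangular_comm (eMinus_mul_incl q _) ?_
    cases g <;>
    · simp only [twist_α, twist_β, twist_γ, twist_δ, map_smul, dFunctions_α, dFunctions_β,
        dFunctions_γ, dFunctions_δ, smul_mul_assoc, mul_smul_comm, mul_add, mul_sub, add_mul,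
        sub_mul, mul_assoc, eZero_mul_incl, eMinus_mul_incl_mul, eMinus_mul_eMinus,
        eMinus_mul_ePlus, eZero_mul_eMinus, mul_zero]
      match_scalars <;> field_simp <;> ring_nf
  · refine comm_of_gen q (fun g => ?_) a
    change jetGen q 2 * _ = jetHom q ((twist q ^ 2) _) * jetGen q 2
    rw [jetGen_two, pow_two]
    refine triangular_comm (eZero_mul_incl q _) ?_
    cases g <;>
    · simp only [twist_α, twist_β, twist_γ, twist_δ, map_smul, dFunctions_α, dFunctions_β,
        dFunctions_γ, dFunctions_δ, smul_mul_assoc, mul_smul_comm, mul_add, mul_sub, add_mul,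
        sub_mul, mul_assoc, eMinus_mul_incl, ePlus_mul_incl_mul, eZero_mul_incl_mul,
        eZero_mul_eZero, eZero_mul_ePlus, eZero_mul_eMinus, mul_zero, AlgHom.mul_apply]
      match_scalars <;> field_simp

/-- As in `triangular_comm`, the second hypothesis is the differential of the first, now with the
sign for an odd left factor. -/
theorem triangular_anti {S : Type*} [Ring S] [Algebra k S] {x y x' y' : S} {c : k}
    (h₁ : x * x' = c • (x' * x)) (h₂ : y * x' - x * y' = c • (y' * x - x' * y)) :
    !![-x, y; 0, x] * !![-x', y'; 0, x'] = c • (!![-x', y'; 0, x'] * !![-x, y; 0, x]) := by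
  rw [Matrix.mul_fin_two, Matrix.mul_fin_two]
  simp [h₁, neg_add_eq_sub, h₂]

theorem triangular_sq {S : Type*} [Ring S] {x y : S} (h₁ : x * x = 0) (h₂ : y * x = x * y) :
    !![-x, y; 0, x] * !![-x, y; 0, x] = 0 := by
  rw [Matrix.mul_fin_two]
  ext i j
  fin_cases i <;> fin_cases j <;> simp [h₁, h₂]

/-- The differential respects every defining relation of the forms. The resulting lift is the source
of the graded Leibniz rule. -/
theorem jet_compatible : Compatible (dataA q) (jetHom q) (jetGen q) where
  comm := jetGen_comm q
  sq i := by
    fin_cases i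
    · change jetGen q 0 * jetGen q 0 = 0
      rw [jetGen_zero]
      refine triangular_sq (ePlus_mul_ePlus q) ?_
      simp [ePlus_mul_ePlus_mul, mul_assoc, eZero_mul_ePlus]
    · change jetGen q 1 * jetGen q 1 = 0
      rw [jetGen_one]
      refine triangular_sq (eMinus_mul_eMinus q) ?_
      simp [eMinus_mul_eMinus_mul, mul_assoc, eZero_mul_eMinus]
    · change jetGen q 2 * jetGen q 2 = 0
      have hq : (q : k) ≠ 0 := q.ne_zero
      rw [jetGen_two]
      refine triangular_sq (eZero_mul_eZero q) ?_
      simp [eZero_mul_ePlus_mul, mul_assoc, eZero_mul_eMinus, smul_smul, hq]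
  anti i j hij := by
    have hq : (q : k) ≠ 0 := q.ne_zero
    have h10 : jetGen q 1 * jetGen q 0 = -((q : k) ^ 2) • (jetGen q 0 * jetGen q 1) := by
      rw [jetGen_zero, jetGen_one]
      refine triangular_anti (eMinus_mul_ePlus q) ?_
      simp only [smul_mul_assoc, mul_smul_comm, mul_assoc, eZero_mul_ePlus, eZero_mul_eMinus,
        eMinus_mul_ePlus_mul]
      match_scalars
      field_simp
      ring
    have h20 : jetGen q 2 * jetGen q 0 = -((q : k) ^ 4) • (jetGen q 0 * jetGen q 2) := by
      rw [jetGen_zero, jetGen_two]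
      refine triangular_anti (eZero_mul_ePlus q) ?_
      simp [mul_assoc, eZero_mul_ePlus_mul, eMinus_mul_ePlus, ePlus_mul_ePlus_mul,
        eZero_mul_eZero]
    have h21 : jetGen q 2 * jetGen q 1 = -((q : k) ^ 4)⁻¹ • (jetGen q 1 * jetGen q 2) := by
      rw [jetGen_one, jetGen_two]
      refine triangular_anti (eZero_mul_eMinus q) ?_
      simp [mul_assoc, eZero_mul_eMinus_mul, eMinus_mul_eMinus, eMinus_mul_ePlus_mul,
        eZero_mul_eZero]
    fin_cases i <;> fin_cases j <;> first | exact absurd hij (by decide) | assumption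

theorem finset_fin_three_cases (S : Finset (Fin 3)) : S = ∅ ∨ S = {0} ∨ S = {1} ∨ S = {2} ∨
    S = {0, 1} ∨ S = {0, 2} ∨ S = {1, 2} ∨ S = {0, 1, 2} := by
  revert S
  decide

theorem dBasis_of_card_ne_one {T : Finset (Fin 3)} (hT : T.card ≠ 1) : dBasis q T = 0 := by
  rw [dBasis, if_neg, if_neg, if_neg] <;> rintro rfl <;> simp at hT

/-- The corner of this product is what the Leibniz rule forces as the differential of the basis
form, whereas `dBasis` is given by a table. The content is that they agree, so the lift really
computes `dA`. -/
theorem orderedProd_jetGen (T : Finset (Fin 3)) : orderedProd (jetGen q) T =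
    !![(-1 : k) ^ T.card • e (dataA q) T, dBasis q T; 0, e (dataA q) T] := by
  have hdiag : ∃ y, orderedProd (jetGen q) T =
      !![(-1 : k) ^ T.card • e (dataA q) T, y; 0, e (dataA q) T] := by
    rw [← orderedProd_e (dataA q) T]
    induction T using Finset.induction_on_min with
    | empty => exact ⟨0, by simp [Matrix.one_fin_two]⟩
    | insert m T hm ih =>
      obtain ⟨y, hy⟩ := ih
      refine ⟨-e (dataA q) {m} * y + dBasis q {m} * orderedProd (fun i => e (dataA q) {i}) T, ?_⟩
      rw [orderedProd_insert _ hm, hy, orderedProd_insert _ hm, jetGen, Matrix.mul_fin_two,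
        Finset.card_insert_of_notMem (fun h' => (hm m h').false), pow_succ]
      simp only [zero_mul, mul_zero, add_zero, zero_add, mul_neg, mul_one, neg_mul, neg_smul,
        mul_smul_comm, smul_neg, smul_zero]
  have hq : (q : k) ≠ 0 := q.ne_zero
  -- Only degrees two and three need an argument: the corner must vanish there. For `e⁺ ∧ e⁻` two
  -- multiples of `e⁺ ∧ e⁻ ∧ e⁰` cancel; in the other cases each term repeats a generator.
  have h01 : orderedProd (jetGen q) T 0 1 = dBasis q T := by
    have h12 : orderedProd (jetGen q) {1, 2} = jetGen q 1 * jetGen q 2 := by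
      rw [orderedProd_insert _ (by decide), orderedProd_singleton]
    have h02 : orderedProd (jetGen q) {0, 2} = jetGen q 0 * jetGen q 2 := by
      rw [orderedProd_insert _ (by decide), orderedProd_singleton]
    have h01 : orderedProd (jetGen q) {0, 1} = jetGen q 0 * jetGen q 1 := by
      rw [orderedProd_insert _ (by decide), orderedProd_singleton]
    have h012 : orderedProd (jetGen q) {0, 1, 2} = jetGen q 0 * (jetGen q 1 * jetGen q 2) := by
      rw [orderedProd_insert _ (by decide), h12]
    have hB := fun T => dBasis_of_card_ne_one q (T := T)
    rcases finset_fin_three_cases T with rfl | rfl | rfl | rfl | rfl | rfl | rfl | rfl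
    · simp [hB ∅ (by decide)]
    · rw [orderedProd_singleton]; rfl
    · rw [orderedProd_singleton]; rfl
    · rw [orderedProd_singleton]; rfl
    · rw [h01, hB _ (by decide), jetGen_zero, jetGen_one, Matrix.mul_fin_two]
      simp only [Matrix.of_apply, Matrix.cons_val', Matrix.cons_val_zero, Matrix.cons_val_one,
        smul_mul_assoc, mul_smul_comm, neg_mul, mul_assoc, eZero_mul_eMinus]
      match_scalars
      field_simp
      ring
    · rw [h02, hB _ (by decide), jetGen_zero, jetGen_two, Matrix.mul_fin_two]
      simp [mul_assoc, ePlus_mul_ePlus_mul, eZero_mul_eZero]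
    · rw [h12, hB _ (by decide), jetGen_one, jetGen_two, Matrix.mul_fin_two]
      simp [mul_assoc, eMinus_mul_ePlus_mul, eMinus_mul_eMinus, eZero_mul_eZero]
    · rw [h012, hB _ (by decide), jetGen_zero, jetGen_one, jetGen_two, Matrix.mul_fin_two,
        Matrix.mul_fin_two]
      simp [mul_assoc, eMinus_mul_ePlus_mul, eMinus_mul_eMinus, eZero_mul_eZero,
        eZero_mul_eMinus_mul]
  obtain ⟨y, hy⟩ := hdiag
  rw [hy] at h01 ⊢
  rw [← h01]
  rfl

theorem dA_eq_sum (ω : FormsA q) : dA q ω = ∑ T, (dFunctions q (ω T) * e (dataA q) T +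
    inclA q (ω T) * dBasis q T) := by
  rw [dA, LinearMap.sum_apply]
  rfl

theorem dA_mono (T : Finset (Fin 3)) (a : SUq q) : dA q (mono (dataA q) T a) =
    dFunctions q a * e (dataA q) T + inclA q a * dBasis q T := by
  rw [dA_eq_sum, Finset.sum_eq_single T]
  · simp [mono]
  · intro U _ hU
    simp [mono, hU]
  · simp

theorem dA_incl (a : SUq q) : dA q (inclA q a) = dFunctions q a := by
  rw [incl_apply, dA_mono, dBasis, if_neg (by decide), if_neg (by decide), if_neg (by decide),
    mul_zero, add_zero, show e (dataA q) ∅ = 1 from rfl, mul_one]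

theorem dA_incl_mul_e (a : SUq q) (T : Finset (Fin 3)) : dA q (inclA q a * e (dataA q) T) =
    dFunctions q a * e (dataA q) T + inclA q a * dBasis q T := by
  rw [incl_mul_e, dA_mono]

theorem dA_e (T : Finset (Fin 3)) : dA q (e (dataA q) T) = dBasis q T := by
  rw [e, dA_mono, dFunctions_one, map_one, zero_mul, zero_add, one_mul]

/-- The homomorphism `ω ↦ ((-1)^|ω| ω, dω; 0, ω)`. -/
theorem lift_jet {m : ℕ} {ω : FormsA q} (hω : ω ∈ degree (dataA q) m) :
    lift (jet_compatible q) ω = !![(-1 : k) ^ m • ω, dA q ω; 0, ω] := by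
  have hsum : ∀ T, jetHom q (ω T) * orderedProd (jetGen q) T =
      !![(-1 : k) ^ m • (inclA q (ω T) * e (dataA q) T),
        dFunctions q (ω T) * e (dataA q) T + inclA q (ω T) * dBasis q T; 0,
        inclA q (ω T) * e (dataA q) T] := by
    intro T
    by_cases hT : T.card = m
    · rw [jetHom_apply, orderedProd_jetGen, Matrix.mul_fin_two, hT, mul_smul_comm]
      simp [add_comm]
    · rw [hω T hT]
      ext i j
      fin_cases i <;> fin_cases j <;> simp
  rw [lift_apply]
  simp only [hsum]
  ext i j
  fin_cases i <;> fin_cases j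
  · simp [Matrix.sum_apply, ← Finset.smul_sum, sum_incl_mul_e]
  · simp [Matrix.sum_apply, dA_eq_sum]
  · simp [Matrix.sum_apply]
  · simp [Matrix.sum_apply, sum_incl_mul_e]

theorem dBasis_mem_degree (T : Finset (Fin 3)) : dBasis q T ∈ degree (dataA q) (T.card + 1) := by
  have h2 : ∀ i j : Fin 3, i ≠ j → e (dataA q) {i, j} ∈ degree (dataA q) (1 + 1) := by
    intro i j hij
    have h := e_mem_degree (dataA q) {i, j}
    rwa [Finset.card_pair hij] at h
  rw [dBasis, ePlus_mul_eMinus, ePlus_mul_eZero, eMinus_mul_eZero]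
  split_ifs with h h h
  · rw [h, Finset.card_singleton]
    exact Submodule.smul_mem _ _ (h2 _ _ (by decide))
  · rw [h, Finset.card_singleton]
    exact Submodule.smul_mem _ _ (h2 _ _ (by decide))
  · rw [h, Finset.card_singleton]
    exact Submodule.smul_mem _ _ (h2 _ _ (by decide))
  · exact zero_mem _

theorem dFunctions_mem_degree (a : SUq q) : dFunctions q a ∈ degree (dataA q) 1 := by
  rw [dFunctions_apply, ePlus, eMinus, eZero, incl_mul_e, incl_mul_e, incl_mul_e]
  exact add_mem (add_mem (mono_mem_degree (dataA q) {0} _) (mono_mem_degree (dataA q) {1} _))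
    (mono_mem_degree (dataA q) {2} _)

theorem dA_mem_degree {m : ℕ} {ω : FormsA q} (hω : ω ∈ degree (dataA q) m) :
    dA q ω ∈ degree (dataA q) (m + 1) := by
  rw [dA_eq_sum]
  refine sum_mem fun T _ => ?_
  by_cases hT : T.card = m
  · subst hT
    refine add_mem ?_ ?_
    · rw [add_comm]
      exact SetLike.GradedMul.mul_mem (dFunctions_mem_degree q _) (e_mem_degree _ _)
    · have h := SetLike.GradedMul.mul_mem (incl_mem_degree (dataA q) (ω T)) (dBasis_mem_degree q T)
      rwa [zero_add] at h
  · rw [hω T hT]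
    simp

/-- The rule is the upper right entry of the multiplicativity of the lift from `jet_compatible`. -/
theorem dA_leibniz {m : ℕ} {ω : FormsA q} (hω : ω ∈ degree (dataA q) m) (η : FormsA q) :
    dA q (ω * η) = dA q ω * η + (-1 : k) ^ m • (ω * dA q η) := by
  induction η using DirectSum.Decomposition.inductionOn (degree (dataA q)) with
  | zero => simp
  | add η η' h₁ h₂ => rw [mul_add, map_add, h₁, h₂, map_add, mul_add, mul_add, smul_add]; abel
  | homogeneous η =>
    -- The matrix description of the lift is available only for homogeneous forms, whence the
    -- reduction to homogeneous `η`.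
    have h := lift_jet q (SetLike.GradedMul.mul_mem hω η.2)
    rw [map_mul, lift_jet q hω, lift_jet q η.2, Matrix.mul_fin_two] at h
    have h01 := congrFun (congrFun h 0) 1
    simp only [Matrix.of_apply, Matrix.cons_val', Matrix.cons_val_zero, Matrix.cons_val_one] at h01
    rw [← h01, smul_mul_assoc, add_comm]

/-- The two mixed terms `dω ∧ dη` carry the signs `(-1)^(m+1)` and `(-1)^m` and cancel. -/
theorem dA_dA_mul {m : ℕ} {ω η : FormsA q} (hω : ω ∈ degree (dataA q) m)
    (h₁ : dA q (dA q ω) = 0) (h₂ : dA q (dA q η) = 0) : dA q (dA q (ω * η)) = 0 := by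
  rw [dA_leibniz q hω, map_add, map_smul, dA_leibniz q (dA_mem_degree q hω), dA_leibniz q hω,
    h₁, h₂,
    zero_mul, mul_zero, smul_zero, zero_add, add_zero, pow_succ]
  simp

theorem dA_dA_gen (g : Gen) : dA q (dA q (inclA q (gen q g))) = 0 := by
  have hq : (q : k) ≠ 0 := q.ne_zero
  have hP : ∀ a, dA q (inclA q a * ePlus q) = dFunctions q a * ePlus q + inclA q a *
      (-((q : k) ^ 2 * (1 + ((q : k) ^ 2)⁻¹))) • (ePlus q * eZero q) := fun a => dA_incl_mul_e q a _
  have hM : ∀ a, dA q (inclA q a * eMinus q) = dFunctions q a * eMinus q + inclA q a *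
      (((q : k) ^ 2)⁻¹ * (1 + ((q : k) ^ 2)⁻¹)) • (eMinus q * eZero q) := fun a =>
    dA_incl_mul_e q a _
  have hZ : ∀ a, dA q (inclA q a * eZero q) = dFunctions q a * eZero q + inclA q a *
      ((q : k) ^ 3) • (ePlus q * eMinus q) := fun a => dA_incl_mul_e q a _
  rw [dA_incl]
  cases g <;>
  · simp only [dFunctions_α, dFunctions_β, dFunctions_γ, dFunctions_δ, map_add, map_sub, map_smul,
      hP, hM, hZ, add_mul, sub_mul, smul_mul_assoc, mul_smul_comm, mul_assoc, eMinus_mul_ePlus,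
      eZero_mul_ePlus, eZero_mul_eMinus, eZero_mul_eZero, mul_zero]
    match_scalars <;> field_simp <;> ring

theorem dA_dA_incl (a : SUq q) : dA q (dA q (inclA q a)) = 0 := by
  induction a using gen_induction with
  | gen g => exact dA_dA_gen q g
  | algebraMap r =>
    rw [dA_incl, Algebra.algebraMap_eq_smul_one, map_smul, dFunctions_one, smul_zero, map_zero]
  | add a b ha hb => rw [map_add, map_add, map_add, ha, hb, add_zero]
  | mul a b ha hb =>
    rw [map_mul]
    exact dA_dA_mul q (incl_mem_degree _ a) ha hb

theorem dA_dA (ω : FormsA q) : dA q (dA q ω) = 0 := by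
  refine Forms.induction_generators (p := fun ω => dA q (dA q ω) = 0) (fun ω η h₁ h₂ => ?_)
    (fun m ω hω η h₁ h₂ => dA_dA_mul q hω h₁ h₂) (dA_dA_incl q) (fun i => ?_) ω
  · rw [map_add, map_add, h₁, h₂, add_zero]
  · rw [dA_e, dBasis, ePlus_mul_eMinus, ePlus_mul_eZero, eMinus_mul_eZero]
    split_ifs
    · rw [map_smul, dA_e, dBasis_of_card_ne_one q (by decide), smul_zero]
    · rw [map_smul, dA_e, dBasis_of_card_ne_one q (by decide), smul_zero]
    · rw [map_smul, dA_e, dBasis_of_card_ne_one q (by decide), smul_zero]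
    · exact map_zero _

theorem isDGA_formsA : IsDGA (degree (dataA q)) (dA q) where
  one_mem := SetLike.GradedOne.one_mem
  mul_mem _ _ _ hω _ hη := SetLike.GradedMul.mul_mem hω hη
  internal := DirectSum.Decomposition.isInternal _
  d_mem _ _ hω := dA_mem_degree q hω
  d_d := dA_dA q
  leibniz _ _ hω η := dA_leibniz q hω η

/-- In this combination of `dα` and `dγ` the `e⁰` terms cancel by `γα = qαγ`, and the coefficient of
`e⁺` is the quantum determinant. The formulas for `e⁻` and `e⁰` arise in the same way. They serve
both generation and the uniqueness of the extended coaction. -/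
theorem ePlus_eq : ePlus q = (q : k)⁻¹ • (inclA q (gen q .α) * dA q (inclA q (gen q .γ))) -
    ((q : k) ^ 2)⁻¹ • (inclA q (gen q .γ) * dA q (inclA q (gen q .α))) := by
  have hq : (q : k) ≠ 0 := q.ne_zero
  have h := relations_gen q
  simp only [dA_incl, dFunctions_α, dFunctions_γ, mul_add, mul_smul_comm, ← mul_assoc, ← map_mul,
    h.ca, h.cb, gen_ad, map_add, map_smul, map_one, add_mul, one_mul, smul_mul_assoc]
  match_scalars <;> field_simp <;> ring

theorem eMinus_eq : eMinus q = inclA q (gen q .δ) * dA q (inclA q (gen q .β)) -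
    (q : k) • (inclA q (gen q .β) * dA q (inclA q (gen q .δ))) := by
  have hq : (q : k) ≠ 0 := q.ne_zero
  have h := relations_gen q
  simp only [dA_incl, dFunctions_β, dFunctions_δ, mul_sub, mul_smul_comm, ← mul_assoc, ← map_mul,
    h.db, gen_da, map_add, map_smul, map_one, add_mul, one_mul, smul_mul_assoc]
  match_scalars <;> field_simp <;> ring

theorem eZero_eq : eZero q = inclA q (gen q .δ) * dA q (inclA q (gen q .α)) -
    (q : k) • (inclA q (gen q .β) * dA q (inclA q (gen q .γ))) := by
  have hq : (q : k) ≠ 0 := q.ne_zero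
  have h := relations_gen q
  simp only [dA_incl, dFunctions_α, dFunctions_γ, mul_add, mul_smul_comm, ← mul_assoc, ← map_mul,
    h.db, gen_da, map_add, map_smul, map_one, add_mul, one_mul, smul_mul_assoc]
  match_scalars <;> field_simp <;> ring

theorem isDifferentialCalculus_formsA :
    IsDifferentialCalculus (degree (dataA q)) (dA q) (inclA q) := by
  refine Forms.isDifferentialCalculus (dataA q) (isDGA_formsA q) fun i => ?_
  have hmem : ∀ a b, inclA q a * dA q (inclA q b) ∈ LinearMap.range (inclA q).toLinearMap *
      LinearMap.range (dA q ∘ₗ (inclA q).toLinearMap) := fun a b =>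
    Submodule.mul_mem_mul ⟨a, rfl⟩ ⟨b, rfl⟩
  fin_cases i
  · change ePlus q ∈ _
    rw [ePlus_eq]
    exact sub_mem (Submodule.smul_mem _ _ (hmem _ _)) (Submodule.smul_mem _ _ (hmem _ _))
  · change eMinus q ∈ _
    rw [eMinus_eq]
    exact sub_mem (hmem _ _) (Submodule.smul_mem _ _ (hmem _ _))
  · change eZero q ∈ _
    rw [eZero_eq]
    exact sub_mem (hmem _ _) (Submodule.smul_mem _ _ (hmem _ _))

end FormsOnSUq

/-! ### The differential on `Ω(H)` -/

section FormsOnLaurent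

open Forms LaurentPolynomial

variable {k : Type*} [Field k] (q : kˣ)

theorem twistH_T (n : ℤ) : twistH q (T n) = ((q : k) ^ 2) ^ n • (T n : LaurentPolynomial k) :=
  (AddMonoidAlgebra.lift_single _ _ _).trans (one_smul _ _)

theorem qDeriv_T (n : ℤ) :
    qDeriv q (T n) = qInt q n • (T (n - 1) : LaurentPolynomial k) := by
  change Finsupp.linearCombination k _ (Finsupp.single n 1) = _
  rw [Finsupp.linearCombination_single, one_smul]

theorem qInt_zero : qInt q 0 = (0 : k) := by
  change ∑ i ∈ Finset.range 0, _ = _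
  simp

theorem qInt_one : qInt q 1 = (1 : k) := by
  change ∑ i ∈ Finset.range 1, _ = _
  simp

theorem qInt_add_one (n : ℤ) : qInt q (n + 1) = (qInt q n + ((q : k) ^ 2) ^ n : k) := by
  have hq : (q : k) ^ 2 ≠ 0 := pow_ne_zero 2 q.ne_zero
  rcases n with n | n
  · change ∑ i ∈ Finset.range (n + 1), _ = ∑ i ∈ Finset.range n, _ + _
    rw [Finset.sum_range_succ]
    simp
  · rcases n with _ | n
    · change qInt q 0 = -∑ i ∈ Finset.range 1, _ + _
      simp [qInt_zero]
    · change -∑ i ∈ Finset.range (n + 1), _ = -∑ i ∈ Finset.range (n + 1 + 1), _ + _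
      rw [Finset.sum_range_succ _ (n + 1), zpow_negSucc, inv_pow _ (n + 1 + 1)]
      ring

/-- This cocycle identity is the twisted Leibniz rule for the `q`-derivative on monomials. -/
theorem qInt_add (m n : ℤ) : qInt q (m + n) = (qInt q m * ((q : k) ^ 2) ^ n + qInt q n : k) := by
  have hq : (q : k) ^ 2 ≠ 0 := pow_ne_zero 2 q.ne_zero
  -- The defect of the identity does not change under `m ↦ m + 1`, so it equals its value at `m =
  -- 0`.
  have hstep : ∀ m : ℤ, qInt q (m + 1 + n) - qInt q (m + 1) * ((q : k) ^ 2) ^ n =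
      (qInt q (m + n) - qInt q m * ((q : k) ^ 2) ^ n : k) := by
    intro m
    rw [add_right_comm, qInt_add_one, qInt_add_one, zpow_add₀ hq]
    ring
  have key : qInt q (m + n) - qInt q m * ((q : k) ^ 2) ^ n = (qInt q n : k) := by
    induction m with
    | zero => simp [qInt_zero]
    | succ m ih => rw [hstep, ih]
    | pred m ih => rw [← hstep, sub_add_cancel, ih]
  rw [← key]
  ring

/-- The twist falls on the right factor because `dt` is kept on the right of coefficients and `dt g
= σ(g) dt`. -/
theorem qDeriv_mul (f g : LaurentPolynomial k) :
    qDeriv q (f * g) = qDeriv q f * twistH q g + f * qDeriv q g := by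
  have hq : (q : k) ^ 2 ≠ 0 := pow_ne_zero 2 q.ne_zero
  induction f using LaurentPolynomial.induction_on' with
  | add f f' h₁ h₂ => rw [add_mul, map_add, h₁, h₂, map_add, add_mul, add_mul]; abel
  | C_mul_T m a =>
    induction g using LaurentPolynomial.induction_on' with
    | add g g' h₁ h₂ =>
      rw [mul_add, map_add, h₁, h₂, map_add, map_add, mul_add, mul_add]; abel
    | C_mul_T n b =>
      rw [← smul_eq_C_mul, ← smul_eq_C_mul, smul_mul_smul_comm, ← T_add, map_smul, map_smul,
        map_smul, map_smul, qDeriv_T, qDeriv_T, qDeriv_T, twistH_T, qInt_add]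
      simp only [smul_mul_assoc, mul_smul_comm, smul_smul, ← T_add]
      rw [show m - 1 + n = m + n - 1 by ring, show m + (n - 1) = m + n - 1 by ring]
      module

theorem formsH_eq (η : FormsH q) :
    η = mono (dataH q) ∅ (η ∅) + mono (dataH q) {0} (η {0}) := by
  have huniv : (Finset.univ : Finset (Finset (Fin 1))) = {∅, {0}} := by decide
  conv_lhs => rw [← sum_mono (dataH q) η, huniv, Finset.sum_pair (by decide)]

theorem dH_apply (ω : FormsH q) : dH q ω = mono (dataH q) {0} (qDeriv q (ω ∅)) := by
  rw [← incl_mul_e]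
  rfl

theorem dH_incl (f : LaurentPolynomial k) :
    dH q (incl (dataH q) f) = mono (dataH q) {0} (qDeriv q f) := by
  rw [dH_apply, incl_apply]
  simp [mono]

theorem mono_singleton_apply_empty (f : LaurentPolynomial k) : mono (dataH q) {0} f ∅ = 0 := by
  simp [mono]

theorem dH_mono_singleton (f : LaurentPolynomial k) : dH q (mono (dataH q) {0} f) = 0 := by
  rw [dH_apply, mono_singleton_apply_empty, map_zero]
  ext U
  simp [mono]

theorem mono_zero_mul_incl (f g : LaurentPolynomial k) :
    mono (dataH q) {0} f * incl (dataH q) g = mono (dataH q) {0} (f * twistH q g) := by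
  have hw : weight (dataH q) {0} = 1 := by simp [weight, dataH]
  rw [incl_apply, mono_mul_mono, if_pos (by simp), hw, pow_one, Finset.union_empty]
  simp [coeff]
  rfl

theorem mono_zero_mul_mono_zero (f g : LaurentPolynomial k) :
    mono (dataH q) {0} f * mono (dataH q) {0} g = 0 := by
  rw [mono_mul_mono, if_neg (by decide)]

theorem dH_leibniz {m : ℕ} {ω : FormsH q} (hω : ω ∈ degree (dataH q) m) (η : FormsH q) :
    dH q (ω * η) = dH q ω * η + (-1 : k) ^ m • (ω * dH q η) := by
  have hempty : ∀ f, mono (dataH q) ∅ f = incl (dataH q) f := fun _ => rfl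
  have h₀ : ω = incl (dataH q) (ω ∅) + mono (dataH q) {0} (ω {0}) := formsH_eq q ω
  have h₁ : η = incl (dataH q) (η ∅) + mono (dataH q) {0} (η {0}) := formsH_eq q η
  have hmadd : ∀ f g, mono (dataH q) {0} (f + g) = mono (dataH q) {0} f + mono (dataH q) {0} g := by
    intro f g
    simp only [← incl_mul_e, map_add, add_mul]
  rcases m with _ | m
  · rw [hω {0} (by decide)] at h₀
    rw [show mono (dataH q) {0} (0 : LaurentPolynomial k) = 0 by ext U; simp [mono], add_zero] at h₀
    rw [h₀, h₁, mul_add, map_add, map_add, ← map_mul, incl_mul_mono, dH_incl, dH_incl, dH_incl,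
      dH_mono_singleton, dH_mono_singleton, mul_add, mono_zero_mul_incl, mono_zero_mul_mono_zero,
      qDeriv_mul, hmadd, add_zero, add_zero, add_zero, incl_mul_mono]
    simp
  · rw [hω ∅ (by simp), map_zero, zero_add] at h₀
    rw [h₀, h₁, mul_add, map_add, mono_zero_mul_incl, mono_zero_mul_mono_zero, dH_mono_singleton,
      dH_mono_singleton, map_add, dH_incl, dH_mono_singleton, add_zero, mono_zero_mul_mono_zero]
    simp

theorem isDGA_formsH : IsDGA (degree (dataH q)) (dH q) where
  one_mem := SetLike.GradedOne.one_mem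
  mul_mem _ _ _ hω _ hη := SetLike.GradedMul.mul_mem hω hη
  internal := DirectSum.Decomposition.isInternal _
  d_mem m ω hω := by
    rw [dH_apply]
    rcases m with _ | m
    · exact mono_mem_degree (dataH q) {0} _
    · rw [hω ∅ (by simp), map_zero]
      intro U _
      simp [mono]
  d_d ω := by rw [dH_apply q ω, dH_mono_singleton]
  leibniz _ _ hω η := dH_leibniz q hω η

theorem isDifferentialCalculus_formsH :
    IsDifferentialCalculus (degree (dataH q)) (dH q) (incl (dataH q)) := by
  refine Forms.isDifferentialCalculus (dataH q) (isDGA_formsH q) fun i => ?_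
  have h : e (dataH q) {i} = incl (dataH q) 1 * dH q (incl (dataH q) (T 1)) := by
    rw [Subsingleton.elim i 0, map_one, one_mul, dH_incl, qDeriv_T, qInt_one, one_smul, sub_self,
      T_zero]
    rfl
  rw [h]
  exact Submodule.mul_mem_mul ⟨_, rfl⟩ ⟨_, rfl⟩

end FormsOnLaurent

/-! ### Products in the graded tensor product without signs -/

section GradedTensorZero

variable {k Ω Ω' : Type*} [Field k] [Ring Ω] [Algebra k Ω] [Ring Ω'] [Algebra k Ω']
  {𝒜 : ℕ → Submodule k Ω} {ℬ : ℕ → Submodule k Ω'} [GradedAlgebra 𝒜] [GradedAlgebra ℬ]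

/-- The sign is trivial when one of the two inner factors has degree zero, so the others need not be
homogeneous. -/
theorem gtmul_mul_gtmul_of_right_zero (ω : Ω) {η : Ω'} (hη : η ∈ ℬ 0) (ω' : Ω) (η' : Ω') :
    (GradedTensorProduct.tmul k ω η * GradedTensorProduct.tmul k ω' η' : 𝒜 ᵍ⊗[k] ℬ) =
      GradedTensorProduct.tmul k (ω * ω') (η * η') := by
  induction ω' using DirectSum.Decomposition.inductionOn 𝒜 with
  | zero => simp
  | add x y hx hy => rw [add_gtmul, mul_add, hx, hy, ← add_gtmul, ← mul_add]
  | homogeneous x => rw [tmul_mul_tmul_of_mem ω hη x.2, zero_mul, pow_zero, one_smul]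

theorem gtmul_mul_gtmul_of_left_zero (ω : Ω) (η : Ω') {ω' : Ω} (hω' : ω' ∈ 𝒜 0) (η' : Ω') :
    (GradedTensorProduct.tmul k ω η * GradedTensorProduct.tmul k ω' η' : 𝒜 ᵍ⊗[k] ℬ) =
      GradedTensorProduct.tmul k (ω * ω') (η * η') := by
  induction η using DirectSum.Decomposition.inductionOn ℬ with
  | zero => simp
  | add x y hx hy => rw [gtmul_add, add_mul, hx, hy, ← gtmul_add, ← add_mul]
  | homogeneous x => rw [tmul_mul_tmul_of_mem ω x.2 hω', mul_zero, pow_zero, one_smul]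

end GradedTensorZero

/-! ### The extension of the coaction to forms -/

section Extension

open Forms LaurentPolynomial

variable {k : Type*} [Field k] (q : kˣ)

/-- The graded tensor product `Ω(A) ⊗ Ω(H)`. -/
abbrev FormsAH : Type _ := degree (dataA q) ᵍ⊗[k] degree (dataH q)

/-- The inclusion of `H` in `Ω(H)`. -/
abbrev inclH : LaurentPolynomial k →ₐ[k] FormsH q := incl (dataH q)

/-- The inclusion `A ⊗ H → Ω(A) ⊗ Ω(H)`. -/
def inclAH : SUq q ⊗[k] LaurentPolynomial k →ₐ[k] FormsAH q :=
  Algebra.TensorProduct.lift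
    ((GradedTensorProduct.includeLeft (degree (dataA q)) (degree (dataH q))).comp (inclA q))
    ((GradedTensorProduct.includeRight (degree (dataA q)) (degree (dataH q))).comp (inclH q))
    (fun a h => by
      change (GradedTensorProduct.tmul k (inclA q a) 1 * GradedTensorProduct.tmul k 1 (inclH q h) :
        FormsAH q) = GradedTensorProduct.tmul k 1 (inclH q h) *
          GradedTensorProduct.tmul k (inclA q a) 1
      rw [gtmul_mul_gtmul_of_right_zero _ SetLike.GradedOne.one_mem,
        gtmul_mul_gtmul_of_right_zero _ (incl_mem_degree _ h)]
      simp)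

theorem inclAH_tmul (a : SUq q) (h : LaurentPolynomial k) :
    inclAH q (a ⊗ₜ h) = GradedTensorProduct.tmul k (inclA q a) (inclH q h) := by
  rw [inclAH, Algebra.TensorProduct.lift_tmul]
  exact GradedTensorProduct.tmul_one_mul_one_tmul _ _ _ _

theorem inclAH_apply (x : SUq q ⊗[k] LaurentPolynomial k) :
    inclAH q x = GradedTensorProduct.of k (degree (dataA q)) (degree (dataH q))
      (TensorProduct.map (inclA q).toLinearMap (inclH q).toLinearMap x) := by
  induction x using TensorProduct.induction_on with
  | zero => simp
  | add x y hx hy => rw [map_add, hx, hy, map_add, map_add]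
  | tmul a h => rw [inclAH_tmul]; rfl

/-- The coaction, with values in `Ω(A) ⊗ Ω(H)`. -/
def coactionForms : SUq q →ₐ[k] FormsAH q := (inclAH q).comp (coaction q)

theorem coaction_gen (g : Gen) : coaction q (gen q g) = genMap
    (gen q .α ⊗ₜ[k] (T 1 : LaurentPolynomial k)) (gen q .β ⊗ₜ[k] (T (-1) : LaurentPolynomial k))
    (gen q .γ ⊗ₜ[k] (T 1 : LaurentPolynomial k)) (gen q .δ ⊗ₜ[k] (T (-1) : LaurentPolynomial k))
    g := homOfRelations_gen _ g

theorem coactionForms_α : coactionForms q (gen q .α) =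
    GradedTensorProduct.tmul k (inclA q (gen q .α)) (inclH q (T 1)) := by
  rw [coactionForms, AlgHom.comp_apply, coaction_gen, genMap, inclAH_tmul]

theorem coactionForms_β : coactionForms q (gen q .β) =
    GradedTensorProduct.tmul k (inclA q (gen q .β)) (inclH q (T (-1))) := by
  rw [coactionForms, AlgHom.comp_apply, coaction_gen, genMap, inclAH_tmul]

theorem coactionForms_γ : coactionForms q (gen q .γ) =
    GradedTensorProduct.tmul k (inclA q (gen q .γ)) (inclH q (T 1)) := by
  rw [coactionForms, AlgHom.comp_apply, coaction_gen, genMap, inclAH_tmul]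

theorem coactionForms_δ : coactionForms q (gen q .δ) =
    GradedTensorProduct.tmul k (inclA q (gen q .δ)) (inclH q (T (-1))) := by
  rw [coactionForms, AlgHom.comp_apply, coaction_gen, genMap, inclAH_tmul]

/-- The form `t⁻¹ dt`. -/
def theta : FormsH q := mono (dataH q) {0} (T (-1))

theorem theta_mul_inclH (n : ℤ) :
    theta q * inclH q (T n) = ((q : k) ^ 2) ^ n • (inclH q (T n) * theta q) := by
  rw [theta, mono_zero_mul_incl, twistH_T, incl_mul_mono, mul_smul_comm, mul_comm (T n),
    ← incl_mul_e, ← incl_mul_e, map_smul, smul_mul_assoc]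

theorem theta_mul_theta : theta q * theta q = 0 := mono_zero_mul_mono_zero q _ _

theorem dH_theta : dH q (theta q) = 0 := dH_mono_singleton q _

theorem theta_mem_degree : theta q ∈ degree (dataH q) 1 := mono_mem_degree (dataH q) {0} _

theorem dH_inclH_T (n : ℤ) : dH q (inclH q (T n)) = qInt q n • (inclH q (T n) * theta q) := by
  rw [dH_incl, qDeriv_T, theta, incl_mul_mono, ← T_add, ← incl_mul_e, ← incl_mul_e, map_smul,
    smul_mul_assoc, sub_eq_add_neg]

theorem ePlus_mem_degree : ePlus q ∈ degree (dataA q) 1 := e_mem_degree (dataA q) {0}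

theorem eMinus_mem_degree : eMinus q ∈ degree (dataA q) 1 := e_mem_degree (dataA q) {1}

theorem eZero_mem_degree : eZero q ∈ degree (dataA q) 1 := e_mem_degree (dataA q) {2}

/-- The images `e⁺ ⊗ t²`, `e⁻ ⊗ t⁻²`, `e⁰ ⊗ 1 + 1 ⊗ t⁻¹ dt` of the basis one-forms. -/
def coactionGen : Fin 3 → FormsAH q :=
  ![GradedTensorProduct.tmul k (ePlus q) (inclH q (T 2)),
    GradedTensorProduct.tmul k (eMinus q) (inclH q (T (-2))),
    GradedTensorProduct.tmul k (eZero q) 1 + GradedTensorProduct.tmul k 1 (theta q)]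

/-- The constants fit because `θ = t⁻¹dt` imitates `e⁰`: the rule `θ tⁿ = q^(2n) tⁿ θ` matches `e⁰ f
= q^(2|f|) f e⁰`. For `n = ±2`, together with the sign of the graded tensor product, it matches `e⁰
e^± = -q^(±4) e^± e⁰`. -/
theorem coactionGen_compatible : Compatible (dataA q) (coactionForms q) (coactionGen q) where
  comm i a := by
    have hT : ∀ m n : ℤ, (inclH q (T m) * inclH q (T n)) = inclH q (T n) * inclH q (T m) :=
      fun m n => by rw [← map_mul, mul_comm, map_mul]
    have hH : ∀ h, inclH q h ∈ degree (dataH q) 0 := incl_mem_degree _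
    have hA : ∀ a, inclA q a ∈ degree (dataA q) 0 := incl_mem_degree _
    fin_cases i
    · refine comm_of_gen q (fun g => ?_) a
      change GradedTensorProduct.tmul k (ePlus q) (inclH q (T 2)) * _ =
        coactionForms q ((twist q ^ 1) _) * GradedTensorProduct.tmul k (ePlus q) (inclH q (T 2))
      rw [pow_one]
      cases g <;>
        simp only [twist_α, twist_β, twist_γ, twist_δ, map_smul, coactionForms_α, coactionForms_β,
          coactionForms_γ, coactionForms_δ, smul_mul_assoc,
          gtmul_mul_gtmul_of_right_zero _ (hH _), ePlus_mul_incl, smul_gtmul, hT 2]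
    · refine comm_of_gen q (fun g => ?_) a
      change GradedTensorProduct.tmul k (eMinus q) (inclH q (T (-2))) * _ =
        coactionForms q ((twist q ^ 1) _) * GradedTensorProduct.tmul k (eMinus q) (inclH q (T (-2)))
      rw [pow_one]
      cases g <;>
        simp only [twist_α, twist_β, twist_γ, twist_δ, map_smul, coactionForms_α, coactionForms_β,
          coactionForms_γ, coactionForms_δ, smul_mul_assoc,
          gtmul_mul_gtmul_of_right_zero _ (hH _), eMinus_mul_incl, smul_gtmul, hT (-2)]
    · refine comm_of_gen q (fun g => ?_) a
      change (GradedTensorProduct.tmul k (eZero q) 1 + GradedTensorProduct.tmul k 1 (theta q)) * _ =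
        coactionForms q ((twist q ^ 2) _) *
          (GradedTensorProduct.tmul k (eZero q) 1 + GradedTensorProduct.tmul k 1 (theta q))
      rw [pow_two, AlgHom.mul_apply]
      cases g <;>
      · simp only [twist_α, twist_β, twist_γ, twist_δ, map_smul, coactionForms_α, coactionForms_β,
          coactionForms_γ, coactionForms_δ, smul_mul_assoc, add_mul, mul_add,
          gtmul_mul_gtmul_of_right_zero _ (hH _), gtmul_mul_gtmul_of_left_zero _ _ (hA _),
          eZero_mul_incl, smul_gtmul, gtmul_smul, theta_mul_inclH, one_mul, mul_one]
        simp [smul_smul, pow_two]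
  sq i := by
    have hH : ∀ h, inclH q h ∈ degree (dataH q) 0 := incl_mem_degree _
    fin_cases i
    · change GradedTensorProduct.tmul k (ePlus q) (inclH q (T 2)) *
        GradedTensorProduct.tmul k (ePlus q) (inclH q (T 2)) = 0
      rw [gtmul_mul_gtmul_of_right_zero _ (hH _), ePlus_mul_ePlus]
      simp
    · change GradedTensorProduct.tmul k (eMinus q) (inclH q (T (-2))) *
        GradedTensorProduct.tmul k (eMinus q) (inclH q (T (-2))) = 0
      rw [gtmul_mul_gtmul_of_right_zero _ (hH _), eMinus_mul_eMinus]
      simp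
    · change (GradedTensorProduct.tmul k (eZero q) 1 + GradedTensorProduct.tmul k 1 (theta q)) *
        (GradedTensorProduct.tmul k (eZero q) 1 + GradedTensorProduct.tmul k 1 (theta q)) = 0
      -- The mixed products `(e⁰ ⊗ 1)(1 ⊗ θ)` and `(1 ⊗ θ)(e⁰ ⊗ 1)` differ by the graded sign and
      -- cancel.
      rw [add_mul, mul_add, mul_add,
        gtmul_mul_gtmul_of_right_zero _ SetLike.GradedOne.one_mem,
        gtmul_mul_gtmul_of_right_zero _ SetLike.GradedOne.one_mem,
        gtmul_mul_gtmul_of_left_zero _ _ SetLike.GradedOne.one_mem,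
        tmul_mul_tmul_of_mem _ (theta_mem_degree q) (eZero_mem_degree q), eZero_mul_eZero,
        theta_mul_theta]
      simp
  anti i j hij := by
    have hq : (q : k) ≠ 0 := q.ne_zero
    have hH : ∀ h, inclH q h ∈ degree (dataH q) 0 := incl_mem_degree _
    have h10 : coactionGen q 1 * coactionGen q 0 =
        -((q : k) ^ 2) • (coactionGen q 0 * coactionGen q 1) := by
      change GradedTensorProduct.tmul k (eMinus q) (inclH q (T (-2))) *
        GradedTensorProduct.tmul k (ePlus q) (inclH q (T 2)) =
          -((q : k) ^ 2) • (GradedTensorProduct.tmul k (ePlus q) (inclH q (T 2)) *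
            GradedTensorProduct.tmul k (eMinus q) (inclH q (T (-2))))
      rw [gtmul_mul_gtmul_of_right_zero _ (hH _), gtmul_mul_gtmul_of_right_zero _ (hH _),
        eMinus_mul_ePlus, smul_gtmul, ← map_mul, ← map_mul, mul_comm (T 2)]
    have hz : ((q : k) ^ 2) ^ (2 : ℤ) = (q : k) ^ 4 := by
      norm_cast
      rw [← pow_mul]
    have h20 : coactionGen q 2 * coactionGen q 0 =
        -((q : k) ^ 4) • (coactionGen q 0 * coactionGen q 2) := by
      change (GradedTensorProduct.tmul k (eZero q) 1 + GradedTensorProduct.tmul k 1 (theta q)) *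
        GradedTensorProduct.tmul k (ePlus q) (inclH q (T 2)) =
          -((q : k) ^ 4) • (GradedTensorProduct.tmul k (ePlus q) (inclH q (T 2)) *
            (GradedTensorProduct.tmul k (eZero q) 1 + GradedTensorProduct.tmul k 1 (theta q)))
      rw [add_mul, mul_add, gtmul_mul_gtmul_of_right_zero _ (hH _),
        gtmul_mul_gtmul_of_right_zero _ (hH _),
        gtmul_mul_gtmul_of_right_zero _ SetLike.GradedOne.one_mem,
        tmul_mul_tmul_of_mem _ (theta_mem_degree q) (ePlus_mem_degree q), eZero_mul_ePlus,
        theta_mul_inclH, hz, smul_gtmul, gtmul_smul]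
      simp only [one_mul, mul_one]
      match_scalars <;> simp
    have hz : ((q : k) ^ 2) ^ (-2 : ℤ) = ((q : k) ^ 4)⁻¹ := by rw [zpow_neg, hz]
    have h21 : coactionGen q 2 * coactionGen q 1 =
        -((q : k) ^ 4)⁻¹ • (coactionGen q 1 * coactionGen q 2) := by
      change (GradedTensorProduct.tmul k (eZero q) 1 + GradedTensorProduct.tmul k 1 (theta q)) *
        GradedTensorProduct.tmul k (eMinus q) (inclH q (T (-2))) =
          -((q : k) ^ 4)⁻¹ • (GradedTensorProduct.tmul k (eMinus q) (inclH q (T (-2))) *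
            (GradedTensorProduct.tmul k (eZero q) 1 + GradedTensorProduct.tmul k 1 (theta q)))
      rw [add_mul, mul_add, gtmul_mul_gtmul_of_right_zero _ (hH _),
        gtmul_mul_gtmul_of_right_zero _ (hH _),
        gtmul_mul_gtmul_of_right_zero _ SetLike.GradedOne.one_mem,
        tmul_mul_tmul_of_mem _ (theta_mem_degree q) (eMinus_mem_degree q), eZero_mul_eMinus,
        theta_mul_inclH, hz, smul_gtmul, gtmul_smul]
      simp only [one_mul, mul_one]
      match_scalars <;> simp
    fin_cases i <;> fin_cases j <;> first | exact absurd hij (by decide) | assumption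

/-- The morphism `Ω(A) → Ω(A) ⊗ Ω(H)` which extends the coaction. -/
def formsCoaction : FormsA q →ₐ[k] FormsAH q := lift (coactionGen_compatible q)

theorem formsCoaction_incl (a : SUq q) : formsCoaction q (inclA q a) = coactionForms q a :=
  lift_incl _ _

theorem formsCoaction_ePlus : formsCoaction q (ePlus q) =
    GradedTensorProduct.tmul k (ePlus q) (inclH q (T 2)) :=
  (lift_e _ _).trans (orderedProd_singleton _ _)

theorem formsCoaction_eMinus : formsCoaction q (eMinus q) =
    GradedTensorProduct.tmul k (eMinus q) (inclH q (T (-2))) :=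
  (lift_e _ _).trans (orderedProd_singleton _ _)

theorem formsCoaction_eZero : formsCoaction q (eZero q) =
    GradedTensorProduct.tmul k (eZero q) 1 + GradedTensorProduct.tmul k 1 (theta q) :=
  (lift_e _ _).trans (orderedProd_singleton _ _)

theorem formsCoaction_mem_tensorDegree {m : ℕ} {ω : FormsA q} (hω : ω ∈ degree (dataA q) m) :
    formsCoaction q ω ∈ tensorDegree (degree (dataA q)) (degree (dataH q)) m := by
  refine map_mem_of_generators _ _ (fun a => ?_) (fun i => ?_) hω
  · rw [formsCoaction_incl, coactionForms, AlgHom.comp_apply]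
    induction coaction q a using TensorProduct.induction_on with
    | zero => simp
    | add x y hx hy => rw [map_add]; exact add_mem hx hy
    | tmul a h =>
      rw [inclAH_tmul]
      exact tmul_mem_tensorDegree (i := 0) (j := 0) (incl_mem_degree (dataA q) a)
        (incl_mem_degree (dataH q) h)
  · fin_cases i
    · change formsCoaction q (ePlus q) ∈ _
      rw [formsCoaction_ePlus]
      exact tmul_mem_tensorDegree (i := 1) (j := 0) (ePlus_mem_degree q)
        (incl_mem_degree (dataH q) (T 2))
    · change formsCoaction q (eMinus q) ∈ _
      rw [formsCoaction_eMinus]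
      exact tmul_mem_tensorDegree (i := 1) (j := 0) (eMinus_mem_degree q)
        (incl_mem_degree (dataH q) (T (-2)))
    · change formsCoaction q (eZero q) ∈ _
      rw [formsCoaction_eZero]
      exact add_mem (tmul_mem_tensorDegree (i := 1) (j := 0) (eZero_mem_degree q)
          SetLike.GradedOne.one_mem)
        (tmul_mem_tensorDegree (i := 0) (j := 1) SetLike.GradedOne.one_mem (theta_mem_degree q))

theorem qInt_neg_one : qInt q (-1) = -((q : k) ^ 2)⁻¹ := by
  change -∑ i ∈ Finset.range 1, _ = _
  simp

theorem qInt_two : qInt q 2 = (1 + (q : k) ^ 2 : k) := by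
  change ∑ i ∈ Finset.range 2, _ = _
  simp [Finset.sum_range_succ]

theorem qInt_neg_two : qInt q (-2) = -(((q : k) ^ 2)⁻¹ + (((q : k) ^ 2)⁻¹) ^ 2 : k) := by
  change -∑ i ∈ Finset.range 2, _ = _
  simp [Finset.sum_range_succ]

/-- The `e⁰`-coefficients 1 and `-q⁻²` are the `q`-integers of 1 and -1, so the `θ`-part of the
image is the differential of the `H`-leg; the factors `t^{±2}` account for the change of degree in
the `e^±` terms. -/
theorem formsCoaction_dA_gen (g : Gen) : formsCoaction q (dA q (inclA q (gen q g))) =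
    tensorD (degree (dataA q)) (degree (dataH q)) (dA q) (dH q)
      (formsCoaction q (inclA q (gen q g))) := by
  have hH : ∀ h, inclH q h ∈ degree (dataH q) 0 := incl_mem_degree _
  have hA : ∀ a, inclA q a ∈ degree (dataA q) 0 := incl_mem_degree _
  have h₁ : inclH q (T (-1)) * inclH q (T 2) = inclH q (T 1) := by
    rw [← map_mul, ← T_add]
    norm_num
  have h₂ : inclH q (T 1) * inclH q (T (-2)) = inclH q (T (-1)) := by
    rw [← map_mul, ← T_add]
    norm_num
  cases g <;>
  · simp only [formsCoaction_incl, dA_incl, dFunctions_α, dFunctions_β, dFunctions_γ, dFunctions_δ,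
      map_add, map_sub, map_smul, map_mul, formsCoaction_ePlus, formsCoaction_eMinus,
      formsCoaction_eZero, coactionForms_α, coactionForms_β, coactionForms_γ, coactionForms_δ,
      mul_add, gtmul_mul_gtmul_of_right_zero _ (hH _), tensorD_tmul (hA _), dH_inclH_T,
      qInt_one, qInt_neg_one, h₁, h₂, gtmul_smul, smul_gtmul, add_gtmul, sub_gtmul, mul_one]
    module

/-- Since `d(t²) = (1 + q²) t² θ`, the `θ`-terms agree exactly because `q²(1 + q⁻²) = 1 + q²` is the
constant in `de⁺`. For `e⁻` the same role is played by the `q`-integer of -2. -/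
theorem formsCoaction_dA_ePlus : formsCoaction q (dA q (ePlus q)) =
    tensorD (degree (dataA q)) (degree (dataH q)) (dA q) (dH q) (formsCoaction q (ePlus q)) := by
  have hq : (q : k) ≠ 0 := q.ne_zero
  have hH : ∀ h, inclH q h ∈ degree (dataH q) 0 := incl_mem_degree _
  have hd : dA q (ePlus q) = (-((q : k) ^ 2 * (1 + ((q : k) ^ 2)⁻¹))) • (ePlus q * eZero q) :=
    dA_e q {0}
  rw [formsCoaction_ePlus, tensorD_tmul (ePlus_mem_degree q), hd, map_smul, map_mul,
    formsCoaction_ePlus, formsCoaction_eZero,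
    mul_add (GradedTensorProduct.tmul k (ePlus q) (inclH q (T 2))),
    gtmul_mul_gtmul_of_right_zero _ (hH _),
    gtmul_mul_gtmul_of_right_zero _ (hH _), dH_inclH_T, qInt_two, smul_gtmul, gtmul_smul]
  simp only [mul_one]
  match_scalars <;> field_simp
  ring

theorem formsCoaction_dA_eMinus : formsCoaction q (dA q (eMinus q)) =
    tensorD (degree (dataA q)) (degree (dataH q)) (dA q) (dH q) (formsCoaction q (eMinus q)) := by
  have hq : (q : k) ≠ 0 := q.ne_zero
  have hH : ∀ h, inclH q h ∈ degree (dataH q) 0 := incl_mem_degree _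
  have hd : dA q (eMinus q) =
      (((q : k) ^ 2)⁻¹ * (1 + ((q : k) ^ 2)⁻¹)) • (eMinus q * eZero q) := dA_e q {1}
  rw [formsCoaction_eMinus, tensorD_tmul (eMinus_mem_degree q), hd, map_smul, map_mul,
    formsCoaction_eMinus, formsCoaction_eZero,
    mul_add (GradedTensorProduct.tmul k (eMinus q) (inclH q (T (-2)))),
    gtmul_mul_gtmul_of_right_zero _ (hH _),
    gtmul_mul_gtmul_of_right_zero _ (hH _), dH_inclH_T, qInt_neg_two, smul_gtmul, gtmul_smul]
  simp only [mul_one]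
  match_scalars <;> field_simp

/-- Here `θ` is closed and `e⁺ ∧ e⁻` is coinvariant, because `t²` and `t⁻²` cancel. -/
theorem formsCoaction_dA_eZero : formsCoaction q (dA q (eZero q)) =
    tensorD (degree (dataA q)) (degree (dataH q)) (dA q) (dH q) (formsCoaction q (eZero q)) := by
  have hH : ∀ h, inclH q h ∈ degree (dataH q) 0 := incl_mem_degree _
  have hd : dA q (eZero q) = ((q : k) ^ 3) • (ePlus q * eMinus q) := dA_e q {2}
  have h1 : dH q 1 = 0 := by
    have h := dH_inclH_T q 0
    rwa [qInt_zero, zero_smul, T_zero, map_one] at h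
  have h1' : dA q 1 = 0 := by
    rw [← map_one (inclA q), dA_incl, dFunctions_one]
  rw [formsCoaction_eZero, map_add, tensorD_tmul (eZero_mem_degree q),
    tensorD_tmul (𝒜 := degree (dataA q)) (i := 0) SetLike.GradedOne.one_mem, hd, h1, h1', dH_theta,
    map_smul, map_mul, formsCoaction_ePlus, formsCoaction_eMinus,
    gtmul_mul_gtmul_of_right_zero _ (hH _), ← map_mul, ← T_add, smul_gtmul]
  simp

theorem formsCoaction_dA_incl (a : SUq q) : formsCoaction q (dA q (inclA q a)) =
    tensorD (degree (dataA q)) (degree (dataH q)) (dA q) (dH q)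
      (formsCoaction q (inclA q a)) := by
  induction a using gen_induction with
  | gen g => exact formsCoaction_dA_gen q g
  | algebraMap r =>
    have h : formsCoaction q (inclA q 1) = GradedTensorProduct.tmul k (inclA q 1) (inclH q 1) := by
      simp only [map_one]
      rfl
    rw [Algebra.algebraMap_eq_smul_one, map_smul, map_smul, map_smul, map_smul, map_smul, h,
      tensorD_tmul (incl_mem_degree (dataA q) 1), dA_incl, dFunctions_one, ← T_zero, dH_inclH_T,
      qInt_zero]
    simp
  | add a b ha hb => rw [map_add, map_add, map_add, ha, hb, map_add, map_add]
  | mul a b ha hb =>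
    have hdeg := formsCoaction_mem_tensorDegree q (incl_mem_degree (dataA q) a)
    rw [map_mul, dA_leibniz q (incl_mem_degree _ a), map_mul,
      tensorD_mul (isDGA_formsA q) (isDGA_formsH q) hdeg, map_add, map_smul, map_mul, map_mul, ha,
      hb]

theorem formsCoaction_dA (ω : FormsA q) : formsCoaction q (dA q ω) =
    tensorD (degree (dataA q)) (degree (dataH q)) (dA q) (dH q) (formsCoaction q ω) := by
  refine comm_tensorD_of_generators (isDGA_formsA q) (isDGA_formsH q) (formsCoaction q)
    (fun m ω hω => formsCoaction_mem_tensorDegree q hω) (formsCoaction_dA_incl q) (fun i => ?_) ω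
  fin_cases i
  · exact formsCoaction_dA_ePlus q
  · exact formsCoaction_dA_eMinus q
  · exact formsCoaction_dA_eZero q

theorem isHopfExtension_formsCoaction : IsHopfExtension q (formsCoaction q) where
  extends_coaction a := by
    rw [formsCoaction_incl, coactionForms, AlgHom.comp_apply, inclAH_apply]
  graded _ _ hω := formsCoaction_mem_tensorDegree q hω
  comm_d := formsCoaction_dA q

/-- An extension is fixed on functions, hence on their differentials, and the `e i` are built from
these. -/
theorem IsHopfExtension.unique {Φ Ψ : FormsA q →ₐ[k] FormsAH q} (hΦ : IsHopfExtension q Φ)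
    (hΨ : IsHopfExtension q Ψ) : Φ = Ψ := by
  have h₀ : ∀ a, Φ (inclA q a) = Ψ (inclA q a) := fun a => by
    rw [hΦ.extends_coaction, hΨ.extends_coaction]
  have hd : ∀ a, Φ (dA q (inclA q a)) = Ψ (dA q (inclA q a)) := fun a => by
    rw [hΦ.comm_d, hΨ.comm_d, h₀]
  have htop : AlgHom.equalizer Φ Ψ = ⊤ := by
    refine subalgebra_eq_top (dataA q) _ h₀ fun i => ?_
    change Φ _ = Ψ _
    fin_cases i
    · change Φ (ePlus q) = Ψ (ePlus q)
      rw [ePlus_eq]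
      simp only [map_sub, map_smul, map_mul, h₀, hd]
    · change Φ (eMinus q) = Ψ (eMinus q)
      rw [eMinus_eq]
      simp only [map_sub, map_smul, map_mul, h₀, hd]
    · change Φ (eZero q) = Ψ (eZero q)
      rw [eZero_eq]
      simp only [map_sub, map_smul, map_mul, h₀, hd]
  ext ω
  have hω : ω ∈ AlgHom.equalizer Φ Ψ := by
    rw [htop]
    trivial
  exact hω

end Extension

/-! ### The base forms by coefficients -/

section BaseForms

open Forms LaurentPolynomial

variable {k : Type*} [Field k] (q : kˣ)

/-- The degree of `e T` under the coaction, up to terms which contain `t⁻¹ dt`. -/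
def coactionWeight (T : Finset (Fin 3)) : ℤ := (if 0 ∈ T then 2 else 0) - if 1 ∈ T then 2 else 0

theorem formsCoaction_e_of_notMem {T : Finset (Fin 3)} (hT : 2 ∉ T) :
    formsCoaction q (e (dataA q) T) =
      GradedTensorProduct.tmul k (e (dataA q) T)
        (inclH q (LaurentPolynomial.T (coactionWeight T))) := by
  rcases finset_fin_three_cases T with rfl | rfl | rfl | rfl | rfl | rfl | rfl | rfl <;>
    try exact absurd (by decide) hT
  · rw [show coactionWeight ∅ = 0 by decide, T_zero, map_one, show e (dataA q) ∅ = 1 from rfl,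
      map_one]
    rfl
  · exact formsCoaction_ePlus q
  · exact formsCoaction_eMinus q
  · rw [show coactionWeight {0, 1} = 2 + -2 by decide, ← ePlus_mul_eMinus, map_mul,
      formsCoaction_ePlus, formsCoaction_eMinus,
      gtmul_mul_gtmul_of_right_zero _ (incl_mem_degree _ _), T_add, map_mul]

theorem e_eq_mul_eZero {T : Finset (Fin 3)} (hT : 2 ∈ T) :
    e (dataA q) T = e (dataA q) (T.erase 2) * eZero q := by
  have hc : coeff (dataA q) (T.erase 2) {2} = 1 := by
    refine Finset.prod_eq_one fun i _ => ?_
    rw [Finset.prod_singleton, if_neg (by omega)]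
  rw [eZero, e_mul_e, if_pos (by simp), hc, one_smul, Finset.union_comm, ← Finset.insert_eq,
    Finset.insert_erase hT]

theorem coactionWeight_erase (T : Finset (Fin 3)) :
    coactionWeight (T.erase 2) = coactionWeight T := by
  revert T
  decide

theorem formsCoaction_e_of_mem {T : Finset (Fin 3)} (hT : 2 ∈ T) :
    formsCoaction q (e (dataA q) T) =
      GradedTensorProduct.tmul k (e (dataA q) T)
        (inclH q (LaurentPolynomial.T (coactionWeight T))) +
      GradedTensorProduct.tmul k (e (dataA q) (T.erase 2))
        (inclH q (LaurentPolynomial.T (coactionWeight T)) * theta q) := by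
  rw [e_eq_mul_eZero q hT, map_mul, formsCoaction_e_of_notMem q (Finset.notMem_erase 2 T),
    formsCoaction_eZero, mul_add, gtmul_mul_gtmul_of_right_zero _ (incl_mem_degree _ _),
    gtmul_mul_gtmul_of_right_zero _ (incl_mem_degree _ _), mul_one, mul_one, coactionWeight_erase]

/-- The coefficient of `e U ⊗ e V` in an element of `Ω(A) ⊗ Ω(H)`. -/
def tensorCoeff (U : Finset (Fin 3)) (V : Finset (Fin 1)) :
    FormsAH q →ₗ[k] SUq q ⊗[k] LaurentPolynomial k :=
  TensorProduct.map (coeffAt (dataA q) U) (coeffAt (dataH q) V) ∘ₗ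
    (GradedTensorProduct.of k (degree (dataA q)) (degree (dataH q))).symm.toLinearMap

theorem tensorCoeff_tmul (U : Finset (Fin 3)) (V : Finset (Fin 1)) (ω : FormsA q) (η : FormsH q) :
    tensorCoeff q U V (GradedTensorProduct.tmul k ω η) = ω U ⊗ₜ η V := rfl

theorem incl_mul_apply {R : Type*} [Ring R] [Algebra k R] {n : ℕ} (D : FormData k R n) (r : R)
    (ω : Forms D) (U : Finset (Fin n)) : (incl D r * ω) U = r * ω U := by
  conv_lhs => rw [← sum_mono D ω, Finset.mul_sum]
  simp only [incl_mul_mono, Forms.sum_apply]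
  rw [Finset.sum_eq_single U] <;> simp +contextual [mono, eq_comm]

theorem tensorCoeff_inclAH_mul (U T : Finset (Fin 3)) (V : Finset (Fin 1)) (η : FormsH q)
    (x : SUq q ⊗[k] LaurentPolynomial k) :
    tensorCoeff q U V (inclAH q x * GradedTensorProduct.tmul k (e (dataA q) T) η) =
      if U = T then x * (1 ⊗ₜ η V) else 0 := by
  induction x using TensorProduct.induction_on with
  | zero => simp
  | add x y hx hy => rw [map_add, add_mul, map_add, hx, hy, add_mul]; split_ifs <;> simp
  | tmul a h =>
    rw [inclAH_tmul, gtmul_mul_gtmul_of_right_zero _ (incl_mem_degree _ _), tensorCoeff_tmul,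
      incl_mul_apply, incl_mul_apply]
    split_ifs with hU <;> simp [e, mono, hU]

theorem formsCoaction_eq_sum (ω : FormsA q) : formsCoaction q ω =
    ∑ T, inclAH q (coaction q (ω T)) * formsCoaction q (e (dataA q) T) := by
  conv_lhs => rw [← sum_incl_mul_e (dataA q) ω, map_sum]
  simp only [map_mul, formsCoaction_incl]
  rfl

/-- Only the monomial `U` contributes: the extra summand in the image of a monomial containing `e⁰`
carries `dt`, which is invisible at `∅`. -/
theorem tensorCoeff_empty_formsCoaction (ω : FormsA q) (U : Finset (Fin 3)) :
    tensorCoeff q U ∅ (formsCoaction q ω) =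
      coaction q (ω U) * (1 ⊗ₜ LaurentPolynomial.T (coactionWeight U)) := by
  have hterm : ∀ T, tensorCoeff q U ∅ (inclAH q (coaction q (ω T)) *
      formsCoaction q (e (dataA q) T)) = if U = T then
        coaction q (ω T) * (1 ⊗ₜ LaurentPolynomial.T (coactionWeight T)) else 0 := by
    intro T
    by_cases hT : 2 ∈ T
    · rw [formsCoaction_e_of_mem q hT, mul_add, map_add, tensorCoeff_inclAH_mul,
        tensorCoeff_inclAH_mul, incl_mul_apply, theta, mono_singleton_apply_empty]
      simp [incl_apply, mono]
    · rw [formsCoaction_e_of_notMem q hT, tensorCoeff_inclAH_mul]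
      simp [incl_apply, mono]
  rw [formsCoaction_eq_sum, map_sum]
  simp only [hterm]
  simp

/-- Deleting `e⁰` is injective on monomials that contain it, so this `dt`-coefficient isolates the
coefficient at `U`. The exponent is shifted by one because `θ = t⁻¹dt`. -/
theorem tensorCoeff_zero_formsCoaction (ω : FormsA q) {U : Finset (Fin 3)} (hU : 2 ∈ U) :
    tensorCoeff q (U.erase 2) {0} (formsCoaction q ω) =
      coaction q (ω U) * (1 ⊗ₜ LaurentPolynomial.T (coactionWeight U - 1)) := by
  have hterm : ∀ T, tensorCoeff q (U.erase 2) {0} (inclAH q (coaction q (ω T)) *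
      formsCoaction q (e (dataA q) T)) = if U = T then
        coaction q (ω T) * (1 ⊗ₜ LaurentPolynomial.T (coactionWeight T - 1)) else 0 := by
    intro T
    by_cases hT : 2 ∈ T
    · have hUT : U.erase 2 = T.erase 2 ↔ U = T := by
        constructor
        · intro h
          rw [← Finset.insert_erase hU, h, Finset.insert_erase hT]
        · rintro rfl
          rfl
      have hθ : theta q {0} = LaurentPolynomial.T (-1) := by simp [theta, mono]
      have hi : ∀ f, inclH q f {0} = 0 := fun f => by simp [incl_apply, mono]
      rw [formsCoaction_e_of_mem q hT, mul_add, map_add, tensorCoeff_inclAH_mul,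
        tensorCoeff_inclAH_mul, incl_mul_apply, hi, hθ, ← T_add, ← sub_eq_add_neg]
      simp only [hUT, TensorProduct.tmul_zero, mul_zero, ite_self, zero_add]
    · have hUT : U ≠ T := fun h => hT (h ▸ hU)
      rw [formsCoaction_e_of_notMem q hT, tensorCoeff_inclAH_mul]
      simp [incl_apply, mono, hUT]
  rw [formsCoaction_eq_sum, map_sum]
  simp only [hterm]
  simp

/-- The counit `t ↦ 1` of `H`. -/
def counitH : LaurentPolynomial k →ₐ[k] k := AddMonoidAlgebra.lift k k ℤ 1

theorem counitH_T (n : ℤ) : counitH (k := k) (LaurentPolynomial.T n) = 1 :=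
  (AddMonoidAlgebra.lift_single _ _ _).trans (one_smul _ _)

theorem counit_coaction (a : SUq q) : Algebra.TensorProduct.rid k k (SUq q)
    (Algebra.TensorProduct.map (AlgHom.id k (SUq q)) counitH (coaction q a)) = a := by
  induction a using gen_induction with
  | gen g => cases g <;> simp [coaction_gen, genMap, counitH_T]
  | algebraMap r => simp only [AlgHom.commutes, AlgEquiv.commutes]
  | add a b ha hb => simp only [map_add, ha, hb]
  | mul a b ha hb => simp only [map_mul, ha, hb]

/-- The counit `t ↦ 1` on the second leg is a left inverse. -/
theorem coaction_injective : Function.Injective (coaction q) :=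
  fun a b h => by rw [← counit_coaction q a, h, counit_coaction]

theorem one_tmul_T_mul (m n : ℤ) : ((1 : SUq q) ⊗ₜ[k] (LaurentPolynomial.T m :
    LaurentPolynomial k)) * (1 ⊗ₜ LaurentPolynomial.T n) = 1 ⊗ₜ LaurentPolynomial.T (m + n) := by
  rw [Algebra.TensorProduct.tmul_mul_tmul, one_mul, T_add]

theorem mem_degreePart {n : ℤ} {a : SUq q} :
    a ∈ degreePart q n ↔ coaction q a = a ⊗ₜ LaurentPolynomial.T n := Iff.rfl

/-- Coinvariance is tested on the coefficients of the image: the `dt`-components exclude `e⁰`, and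
the components without `dt` fix the degrees. -/
theorem mem_baseForms_iff (ω : FormsA q) : ω ∈ baseForms (formsCoaction q) ↔
    ∀ U, (2 ∈ U → ω U = 0) ∧ (2 ∉ U → ω U ∈ degreePart q (-coactionWeight U)) := by
  have hmem : ω ∈ baseForms (formsCoaction q) ↔
      formsCoaction q ω = GradedTensorProduct.tmul k ω 1 := Iff.rfl
  rw [hmem]
  constructor
  · intro h U
    refine ⟨fun hU => ?_, fun _ => ?_⟩
    · have h1 := tensorCoeff_zero_formsCoaction q ω hU
      rw [h, tensorCoeff_tmul, show (1 : FormsH q) {0} = 0 by simp [one_apply],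
        TensorProduct.tmul_zero] at h1
      -- Powers of `t` are invertible, so the factor can be removed, leaving that the coaction kills
      -- `ω U`.
      have h2 := congrArg (· * ((1 : SUq q) ⊗ₜ[k] (LaurentPolynomial.T (-(coactionWeight U - 1)) :
        LaurentPolynomial k))) h1
      simp only [zero_mul, mul_assoc, one_tmul_T_mul, add_neg_cancel, T_zero,
        ← Algebra.TensorProduct.one_def, mul_one] at h2
      exact coaction_injective q (h2.symm.trans (map_zero _).symm)
    · have h1 := tensorCoeff_empty_formsCoaction q ω U
      rw [h, tensorCoeff_tmul, show (1 : FormsH q) ∅ = 1 by simp [one_apply]] at h1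
      have h2 := congrArg (· * ((1 : SUq q) ⊗ₜ[k] (LaurentPolynomial.T (-coactionWeight U) :
        LaurentPolynomial k))) h1
      simp only [mul_assoc, Algebra.TensorProduct.tmul_mul_tmul, ← T_add, add_neg_cancel, T_zero,
        ← Algebra.TensorProduct.one_def, mul_one, one_mul] at h2
      exact h2.symm
  · intro h
    have hterm : ∀ T, inclAH q (coaction q (ω T)) * formsCoaction q (e (dataA q) T) =
        GradedTensorProduct.tmul k (inclA q (ω T) * e (dataA q) T) 1 := by
      intro T
      by_cases hT : 2 ∈ T
      · rw [(h T).1 hT]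
        simp
      · rw [formsCoaction_e_of_notMem q hT, (mem_degreePart q).1 ((h T).2 hT), inclAH_tmul,
          gtmul_mul_gtmul_of_right_zero _ (incl_mem_degree _ _), ← map_mul, ← T_add,
          neg_add_cancel, T_zero, map_one]
    rw [formsCoaction_eq_sum]
    simp only [hterm]
    have hinc := map_sum (GradedTensorProduct.includeLeft (degree (dataA q)) (degree (dataH q)))
      (fun T => inclA q (ω T) * e (dataA q) T) Finset.univ
    rw [sum_incl_mul_e] at hinc
    exact hinc.symm

end BaseForms

/-! ### Forms generated by the Podleś sphere -/

section PodlesForms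

open Forms LaurentPolynomial

variable {k : Type*} [Field k] (q : kˣ)

theorem mul_mem_degreePart {m n : ℤ} {a b : SUq q} (ha : a ∈ degreePart q m)
    (hb : b ∈ degreePart q n) : a * b ∈ degreePart q (m + n) := by
  rw [mem_degreePart] at ha hb ⊢
  rw [map_mul, ha, hb, Algebra.TensorProduct.tmul_mul_tmul, T_add]

theorem α_mem_degreePart : gen q .α ∈ degreePart q 1 := coaction_gen q .α
theorem β_mem_degreePart : gen q .β ∈ degreePart q (-1) := coaction_gen q .β
theorem γ_mem_degreePart : gen q .γ ∈ degreePart q 1 := coaction_gen q .γ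
theorem δ_mem_degreePart : gen q .δ ∈ degreePart q (-1) := coaction_gen q .δ

theorem mem_podles_iff {a : SUq q} : a ∈ podles q ↔ a ∈ degreePart q 0 := by
  rw [mem_degreePart, T_zero]
  exact Iff.rfl

/-- The two `e⁰` terms cancel, as they must for the differential of a function of degree zero. The
same happens for `αδ` and `γδ`. -/
theorem dA_αβ : dA q (inclA q (gen q .α * gen q .β)) =
    inclA q (gen q .β * gen q .β) * ePlus q + inclA q (gen q .α * gen q .α) * eMinus q := by
  have hq : (q : k) ≠ 0 := q.ne_zero
  rw [dA_incl, dFunctions_mul]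
  simp only [dFunctions_α, dFunctions_β, add_mul, mul_sub,
    smul_mul_assoc, mul_smul_comm, mul_assoc, ePlus_mul_incl, eZero_mul_incl, twist_β, map_smul,
    map_mul]
  match_scalars <;> field_simp <;> ring

theorem dA_αδ : dA q (inclA q (gen q .α * gen q .δ)) =
    inclA q (gen q .β * gen q .δ) * ePlus q + inclA q (gen q .α * gen q .γ) * eMinus q := by
  have hq : (q : k) ≠ 0 := q.ne_zero
  rw [dA_incl, dFunctions_mul]
  simp only [dFunctions_α, dFunctions_δ, add_mul, mul_sub,
    smul_mul_assoc, mul_smul_comm, mul_assoc, ePlus_mul_incl, eZero_mul_incl, twist_δ, map_smul,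
    map_mul]
  match_scalars <;> field_simp <;> ring

theorem dA_γδ : dA q (inclA q (gen q .γ * gen q .δ)) =
    inclA q (gen q .δ * gen q .δ) * ePlus q + inclA q (gen q .γ * gen q .γ) * eMinus q := by
  have hq : (q : k) ≠ 0 := q.ne_zero
  rw [dA_incl, dFunctions_mul]
  simp only [dFunctions_γ, dFunctions_δ, add_mul, mul_sub,
    smul_mul_assoc, mul_smul_comm, mul_assoc, ePlus_mul_incl, eZero_mul_incl, twist_δ, map_smul,
    map_mul]
  match_scalars <;> field_simp <;> ring

theorem gen_γα_mul (x : SUq q) :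
    gen q .γ * (gen q .α * x) = (q : k) • (gen q .α * (gen q .γ * x)) := by
  rw [← mul_assoc, (relations_gen q).ca, smul_mul_assoc, mul_assoc]

theorem gen_δβ_mul (x : SUq q) :
    gen q .δ * (gen q .β * x) = (q : k) • (gen q .β * (gen q .δ * x)) := by
  rw [← mul_assoc, (relations_gen q).db, smul_mul_assoc, mul_assoc]

theorem gen_αδ_mul (x : SUq q) : gen q .α * (gen q .δ * x) =
    x + (q : k)⁻¹ • (gen q .β * (gen q .γ * x)) := by
  rw [← mul_assoc, gen_ad, add_mul, one_mul, smul_mul_assoc, mul_assoc]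

theorem gen_δα_mul (x : SUq q) : gen q .δ * (gen q .α * x) =
    x + (q : k) • (gen q .β * (gen q .γ * x)) := by
  rw [← mul_assoc, gen_da, add_mul, one_mul, smul_mul_assoc, mul_assoc]

theorem gen_γβ_mul (x : SUq q) : gen q .γ * (gen q .β * x) = gen q .β * (gen q .γ * x) := by
  rw [← mul_assoc, (relations_gen q).cb, mul_assoc]

theorem gen_βα_mul (x : SUq q) :
    gen q .α * (gen q .β * x) = (q : k)⁻¹ • (gen q .β * (gen q .α * x)) := by
  rw [← mul_assoc (gen q .β), (relations_gen q).ba, smul_mul_assoc, smul_smul,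
    inv_mul_cancel₀ q.ne_zero, one_smul, mul_assoc]

theorem gen_αγ_mul (x : SUq q) :
    gen q .α * (gen q .γ * x) = (q : k)⁻¹ • (gen q .γ * (gen q .α * x)) := by
  rw [gen_γα_mul, smul_smul, inv_mul_cancel₀ q.ne_zero, one_smul]

theorem gen_δγ_mul (x : SUq q) :
    gen q .δ * (gen q .γ * x) = (q : k) • (gen q .γ * (gen q .δ * x)) := by
  rw [← mul_assoc, (relations_gen q).dc, smul_mul_assoc, mul_assoc]

/-- The square of the quantum determinant. -/
theorem qdet_sq : ((q : k) ^ 2)⁻¹ • (gen q .γ * gen q .γ * (gen q .β * gen q .β)) -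
    ((q : k) + (q : k)⁻¹) • (gen q .α * gen q .γ * (gen q .β * gen q .δ)) +
    gen q .α * gen q .α * (gen q .δ * gen q .δ) = 1 := by
  have hq : (q : k) ≠ 0 := q.ne_zero
  have h := relations_gen q
  -- Each `α` is moved right past `β` and `γ` until it meets a `δ`, where `αδ = 1 + q⁻¹βγ` removes
  -- both. What remains is an identity between polynomials in the commuting elements `β` and `γ`.
  simp only [mul_assoc, gen_γβ_mul, gen_βα_mul, gen_αγ_mul, gen_αδ_mul, gen_ad, h.cb, mul_add,
    mul_smul_comm, smul_add, smul_smul, mul_one]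
  match_scalars <;> field_simp <;> ring

/-- With the left factors of `qdet_sq`, the `e⁻`-coefficient is a multiple of `α²γ²` by `q² - (q² +
1) + 1`. -/
theorem qdet_sq_offdiag : ((q : k) ^ 2)⁻¹ • (gen q .γ * gen q .γ * (gen q .α * gen q .α)) -
    ((q : k) + (q : k)⁻¹) • (gen q .α * gen q .γ * (gen q .α * gen q .γ)) +
    gen q .α * gen q .α * (gen q .γ * gen q .γ) = 0 := by
  have hq : (q : k) ≠ 0 := q.ne_zero
  simp only [mul_assoc, gen_γα_mul, (relations_gen q).ca, mul_smul_comm, smul_smul]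
  match_scalars
  field_simp
  ring

/-- The square of the quantum determinant, with the factors in the opposite order. -/
theorem qdet_sq' : gen q .δ * gen q .δ * (gen q .α * gen q .α) -
    ((q : k) ^ 3 + (q : k)) • (gen q .β * gen q .δ * (gen q .α * gen q .γ)) +
    ((q : k) ^ 2) • (gen q .β * gen q .β * (gen q .γ * gen q .γ)) = 1 := by
  have hq : (q : k) ≠ 0 := q.ne_zero
  have h := relations_gen q
  -- The mirror image of the computation in `qdet_sq`: each `δ` is moved right until it meets an
  -- `α`.
  simp only [mul_assoc, gen_δα_mul, gen_δβ_mul, gen_δγ_mul, gen_da, mul_add, mul_smul_comm,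
    smul_add, smul_smul, mul_one, gen_γβ_mul]
  match_scalars <;> field_simp <;> ring

theorem qdet_sq_offdiag' : gen q .δ * gen q .δ * (gen q .β * gen q .β) -
    ((q : k) ^ 3 + (q : k)) • (gen q .β * gen q .δ * (gen q .β * gen q .δ)) +
    ((q : k) ^ 2) • (gen q .β * gen q .β * (gen q .δ * gen q .δ)) = 0 := by
  have hq : (q : k) ≠ 0 := q.ne_zero
  have h := relations_gen q
  simp only [mul_assoc, gen_δβ_mul, h.db, mul_smul_comm, smul_smul]
  match_scalars
  ring

/-- This inverts the expression of `d(αβ)`, `d(αδ)`, `d(γδ)` through `e⁺` and `e⁻`. The left factors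
`γ²`, `αγ`, `α²` have degree 2, so they land in `B` after multiplication by `a` of degree -2. -/
theorem incl_mul_ePlus_eq (a : SUq q) : inclA q a * ePlus q =
    ((q : k) ^ 2)⁻¹ • (inclA q (a * (gen q .γ * gen q .γ)) * dA q (inclA q (gen q .α * gen q .β))) -
    ((q : k) + (q : k)⁻¹) • (inclA q (a * (gen q .α * gen q .γ)) *
      dA q (inclA q (gen q .α * gen q .δ))) +
    inclA q (a * (gen q .α * gen q .α)) * dA q (inclA q (gen q .γ * gen q .δ)) := by
  -- The determinant identities are inserted as the coefficient 1 of `a e⁺` and the coefficient 0 of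
  -- `a e⁻`.
  have h₁ := congrArg (fun x => inclA q a * inclA q x * ePlus q) (qdet_sq q)
  have h₂ := congrArg (fun x => inclA q a * inclA q x * eMinus q) (qdet_sq_offdiag q)
  simp only [map_add, map_sub, map_smul, map_one, map_zero, mul_one, mul_zero, zero_mul] at h₁ h₂
  rw [dA_αβ, dA_αδ, dA_γδ, ← h₁, ← add_zero (_ * ePlus q), ← h₂]
  simp only [map_mul, mul_add, mul_sub, add_mul, sub_mul, smul_mul_assoc, mul_smul_comm, mul_assoc]
  module

theorem incl_mul_eMinus_eq (a : SUq q) : inclA q a * eMinus q =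
    inclA q (a * (gen q .δ * gen q .δ)) * dA q (inclA q (gen q .α * gen q .β)) -
    ((q : k) ^ 3 + (q : k)) • (inclA q (a * (gen q .β * gen q .δ)) *
      dA q (inclA q (gen q .α * gen q .δ))) +
    ((q : k) ^ 2) • (inclA q (a * (gen q .β * gen q .β)) *
      dA q (inclA q (gen q .γ * gen q .δ))) := by
  have h₁ := congrArg (fun x => inclA q a * inclA q x * eMinus q) (qdet_sq' q)
  have h₂ := congrArg (fun x => inclA q a * inclA q x * ePlus q) (qdet_sq_offdiag' q)
  simp only [map_add, map_sub, map_smul, map_one, map_zero, mul_one, mul_zero, zero_mul] at h₁ h₂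
  rw [dA_αβ, dA_αδ, dA_γδ, ← h₁, ← add_zero (_ * eMinus q), ← h₂]
  simp only [map_mul, mul_add, mul_sub, add_mul, sub_mul, smul_mul_assoc, mul_smul_comm, mul_assoc]
  module

/-- The functions on the Podleś sphere, as forms. -/
def podlesRange : Submodule k (FormsA q) := LinearMap.range (podlesIncl q).toLinearMap

/-- The differentials of the functions on the Podleś sphere. -/
def podlesDRange : Submodule k (FormsA q) :=
  LinearMap.range (dA q ∘ₗ (podlesIncl q).toLinearMap)

theorem incl_mem_podlesRange {a : SUq q} (ha : a ∈ degreePart q 0) :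
    inclA q a ∈ podlesRange q :=
  ⟨⟨a, (mem_podles_iff q).2 ha⟩, rfl⟩

theorem dA_incl_mem_podlesDRange {a : SUq q} (ha : a ∈ degreePart q 0) :
    dA q (inclA q a) ∈ podlesDRange q :=
  ⟨⟨a, (mem_podles_iff q).2 ha⟩, rfl⟩

theorem podlesRange_mul_podlesRange : podlesRange q * podlesRange q ≤ podlesRange q := by
  refine Submodule.mul_le.2 ?_
  rintro _ ⟨a, rfl⟩ _ ⟨b, rfl⟩
  exact ⟨a * b, map_mul (podlesIncl q) a b⟩

theorem dA_αβ_mem : dA q (inclA q (gen q .α * gen q .β)) ∈ podlesDRange q :=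
  dA_incl_mem_podlesDRange q (mul_mem_degreePart q (α_mem_degreePart q) (β_mem_degreePart q))

theorem dA_αδ_mem : dA q (inclA q (gen q .α * gen q .δ)) ∈ podlesDRange q :=
  dA_incl_mem_podlesDRange q (mul_mem_degreePart q (α_mem_degreePart q) (δ_mem_degreePart q))

theorem dA_γδ_mem : dA q (inclA q (gen q .γ * gen q .δ)) ∈ podlesDRange q :=
  dA_incl_mem_podlesDRange q (mul_mem_degreePart q (γ_mem_degreePart q) (δ_mem_degreePart q))

theorem incl_mul_ePlus_mem {a : SUq q} (ha : a ∈ degreePart q (-2)) :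
    inclA q a * ePlus q ∈ podlesRange q * podlesDRange q := by
  have hR : ∀ {b c}, b ∈ degreePart q 1 → c ∈ degreePart q 1 →
      inclA q (a * (b * c)) ∈ podlesRange q := fun hb hc =>
    incl_mem_podlesRange q (mul_mem_degreePart q ha (mul_mem_degreePart q hb hc))
  have hα := α_mem_degreePart q
  have hγ := γ_mem_degreePart q
  rw [incl_mul_ePlus_eq]
  exact add_mem (sub_mem
    (Submodule.smul_mem _ _ (Submodule.mul_mem_mul (hR hγ hγ) (dA_αβ_mem q)))
    (Submodule.smul_mem _ _ (Submodule.mul_mem_mul (hR hα hγ) (dA_αδ_mem q))))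
    (Submodule.mul_mem_mul (hR hα hα) (dA_γδ_mem q))

theorem incl_mul_eMinus_mem {a : SUq q} (ha : a ∈ degreePart q 2) :
    inclA q a * eMinus q ∈ podlesRange q * podlesDRange q := by
  have hR : ∀ {b c}, b ∈ degreePart q (-1) → c ∈ degreePart q (-1) →
      inclA q (a * (b * c)) ∈ podlesRange q := fun hb hc =>
    incl_mem_podlesRange q (mul_mem_degreePart q ha (mul_mem_degreePart q hb hc))
  have hβ := β_mem_degreePart q
  have hδ := δ_mem_degreePart q
  rw [incl_mul_eMinus_eq]
  exact add_mem (sub_mem (Submodule.mul_mem_mul (hR hδ hδ) (dA_αβ_mem q))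
    (Submodule.smul_mem _ _ (Submodule.mul_mem_mul (hR hβ hδ) (dA_αδ_mem q))))
    (Submodule.smul_mem _ _ (Submodule.mul_mem_mul (hR hβ hβ) (dA_γδ_mem q)))

/-- Expand `e⁻` by `incl_mul_eMinus_eq` at `a = 1`. Its left factors have degree -2, not 0, but
combined with `e⁺` they form one-forms in `B dB`. -/
theorem ePlus_mul_eMinus_mem :
    ePlus q * eMinus q ∈ podlesRange q * podlesDRange q * podlesDRange q := by
  -- Moving `e⁺` to the right of `b c` costs only the scalar `q⁻²`.
  have hR : ∀ {b c}, b ∈ degreePart q (-1) → c ∈ degreePart q (-1) →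
      twist q b = (q : k)⁻¹ • b → twist q c = (q : k)⁻¹ • c →
      ePlus q * inclA q (b * c) ∈ podlesRange q * podlesDRange q := by
    intro b c hb hc hb' hc'
    rw [ePlus_mul_incl, map_mul, hb', hc', smul_mul_smul_comm, map_smul, smul_mul_assoc]
    exact Submodule.smul_mem _ _ (incl_mul_ePlus_mem q (mul_mem_degreePart q hb hc))
  have hβ := β_mem_degreePart q
  have hδ := δ_mem_degreePart q
  have h := incl_mul_eMinus_eq q 1
  rw [map_one, one_mul] at h
  rw [h, mul_add, mul_sub, mul_smul_comm, mul_smul_comm]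
  simp only [one_mul, ← mul_assoc (ePlus q)]
  exact add_mem (sub_mem (Submodule.mul_mem_mul (hR hδ hδ (twist_δ q) (twist_δ q)) (dA_αβ_mem q))
    (Submodule.smul_mem _ _ (Submodule.mul_mem_mul (hR hβ hδ (twist_β q) (twist_δ q))
      (dA_αδ_mem q))))
    (Submodule.smul_mem _ _ (Submodule.mul_mem_mul (hR hβ hβ (twist_β q) (twist_β q))
      (dA_γδ_mem q)))

end PodlesForms

/-! ### The calculus of base forms -/

section BaseCalculus

open Forms

variable {k : Type*} [Field k] (q : kˣ)

theorem coactionWeight_empty : coactionWeight ∅ = 0 := by decide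

theorem coactionWeight_zero : coactionWeight {0} = 2 := by decide

theorem coactionWeight_one : coactionWeight {1} = -2 := by decide

theorem coactionWeight_zero_one : coactionWeight {0, 1} = 0 := by decide

theorem dA_mem_baseForms {Φ : FormsA q →ₐ[k] FormsAH q} (hΦ : IsHopfExtension q Φ)
    {ω : FormsA q} (hω : ω ∈ baseForms Φ) : dA q ω ∈ baseForms Φ := by
  have h1 : dH q 1 = 0 := by
    have h := dH_inclH_T q 0
    rwa [LaurentPolynomial.T_zero, map_one, qInt_zero, zero_smul] at h
  have h2 : Φ ω = GradedTensorProduct.tmul k ω 1 := hω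
  have h3 : Φ (dA q ω) = GradedTensorProduct.tmul k (dA q ω) 1 := by
    rw [hΦ.comm_d, h2]
    -- The sign operator acts only in the summand containing `d1 = 0`, so `ω` need not be
    -- homogeneous.
    change GradedTensorProduct.of k _ _ (dA q ω ⊗ₜ[k] 1 + parity _ ω ⊗ₜ[k] dH q 1) = _
    rw [h1, TensorProduct.tmul_zero, add_zero]
  exact h3

theorem podlesIncl_mem_baseForms (b : podles q) :
    podlesIncl q b ∈ baseForms (formsCoaction q) := by
  rw [mem_baseForms_iff]
  intro U
  have hU : podlesIncl q b U = if U = ∅ then (b : SUq q) else 0 := rfl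
  rw [hU]
  split_ifs with h
  · subst h
    exact ⟨by simp, fun _ => by simpa [coactionWeight_empty] using (mem_podles_iff q).1 b.2⟩
  · exact ⟨fun _ => rfl, fun _ => zero_mem _⟩

theorem incl_mul_ePlus_add_incl_mul_eMinus_apply (a b : SUq q) (U : Finset (Fin 3)) :
    (inclA q a * ePlus q + inclA q b * eMinus q) U =
      (if U = {0} then a else 0) + if U = {1} then b else 0 := by
  rw [ePlus, eMinus, incl_mul_e, incl_mul_e]
  rfl

theorem mem_baseForms_degree_one_iff (ω : FormsA q) :
    (ω ∈ degree (dataA q) 1 ∧ ω ∈ baseForms (formsCoaction q)) ↔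
      ∃ a ∈ degreePart q (-2), ∃ b ∈ degreePart q 2,
        ω = inclA q a * ePlus q + inclA q b * eMinus q := by
  rw [mem_baseForms_iff]
  constructor
  · rintro ⟨h1, h⟩
    have ha := (h {0}).2 (by decide)
    have hb := (h {1}).2 (by decide)
    rw [coactionWeight_zero] at ha
    rw [coactionWeight_one, neg_neg] at hb
    refine ⟨ω {0}, ha, ω {1}, hb, ?_⟩
    ext U
    rw [incl_mul_ePlus_add_incl_mul_eMinus_apply]
    by_cases h0 : U = {0}
    · subst h0; simp
    by_cases h1' : U = {1}
    · subst h1'; simp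
    rw [if_neg h0, if_neg h1', add_zero]
    by_cases h2 : U = {2}
    · exact (h U).1 (by simp [h2])
    · refine h1 U ?_
      revert h0 h1' h2
      revert U
      decide
  · rintro ⟨a, ha, b, hb, rfl⟩
    refine ⟨fun U hU => ?_, fun U => ?_⟩
    · rw [incl_mul_ePlus_add_incl_mul_eMinus_apply, if_neg, if_neg, add_zero] <;>
        · rintro rfl
          exact hU rfl
    · rw [incl_mul_ePlus_add_incl_mul_eMinus_apply]
      by_cases h0 : U = {0}
      · subst h0
        exact ⟨fun h => absurd h (by decide), fun _ => by simpa [coactionWeight_zero] using ha⟩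
      by_cases h1 : U = {1}
      · subst h1
        exact ⟨fun h => absurd h (by decide), fun _ => by simpa [coactionWeight_one] using hb⟩
      rw [if_neg h0, if_neg h1, add_zero]
      exact ⟨fun _ => rfl, fun _ => zero_mem _⟩

theorem incl_mul_ePlus_add_incl_mul_eMinus_mem {a b : SUq q} (ha : a ∈ degreePart q (-2))
    (hb : b ∈ degreePart q 2) :
    inclA q a * ePlus q + inclA q b * eMinus q ∈ podlesRange q * podlesDRange q :=
  add_mem (incl_mul_ePlus_mem q ha) (incl_mul_eMinus_mem q hb)

theorem podlesRange_mul_podlesDRange_le : podlesRange q * podlesDRange q ≤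
    Submodule.span k {ω | ∃ b₀ b₁ : podles q,
      ω = podlesIncl q b₀ * dA q (podlesIncl q b₁)} := by
  refine Submodule.mul_le.2 ?_
  rintro _ ⟨b₀, rfl⟩ _ ⟨b₁, rfl⟩
  exact Submodule.subset_span ⟨b₀, b₁, rfl⟩

theorem podlesRange_mul_podlesDRange_mul_podlesDRange_le :
    podlesRange q * podlesDRange q * podlesDRange q ≤
      Submodule.span k {ω | ∃ b₀ b₁ b₂ : podles q,
        ω = podlesIncl q b₀ * dA q (podlesIncl q b₁) * dA q (podlesIncl q b₂)} := by
  refine (mul_le_mul' (podlesRange_mul_podlesDRange_le q) le_rfl).trans (Submodule.mul_le.2 ?_)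
  rintro ω hω _ ⟨b₂, rfl⟩
  refine Submodule.span_induction ?_ ?_ ?_ ?_ hω
  · rintro _ ⟨b₀, b₁, rfl⟩
    exact Submodule.subset_span ⟨b₀, b₁, b₂, rfl⟩
  · rw [zero_mul]
    exact zero_mem _
  · intro x y _ _ hx hy
    rw [add_mul]
    exact add_mem hx hy
  · intro r x _ hx
    rw [smul_mul_assoc]
    exact Submodule.smul_mem _ r hx

/-- The criterion `mem_baseForms_iff` looks at one coefficient at a time, so it survives setting
some of them to zero. Hence the base forms inherit the grading. -/
theorem proj_mem_baseForms {ω : FormsA q} (hω : ω ∈ baseForms (formsCoaction q)) (m : ℕ) :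
    (proj (dataA q) m ω : FormsA q) ∈ baseForms (formsCoaction q) := by
  rw [mem_baseForms_iff] at hω ⊢
  intro U
  rw [proj_apply]
  split_ifs
  · exact hω U
  · exact ⟨fun _ => rfl, fun _ => zero_mem _⟩

theorem proj_of_mem {R : Type*} [Ring R] [Algebra k R] {n : ℕ} {D : FormData k R n} {i : ℕ}
    {ω : Forms D} (hω : ω ∈ degree D i) (m : ℕ) :
    (proj D m ω : Forms D) = if i = m then ω else 0 := by
  ext S
  rw [proj_apply]
  by_cases hS : S.card = i
  · subst hS
    split_ifs <;> rfl
  · rw [hω S hS]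
    split_ifs <;> simp [hω S hS]

theorem sum_proj {R : Type*} [Ring R] [Algebra k R] {n : ℕ} (D : FormData k R n) (ω : Forms D) :
    ∑ m ∈ Finset.range (n + 1), (proj D m ω : Forms D) = ω := by
  ext S
  have hS : S.card < n + 1 := Nat.lt_succ_of_le (by simpa using Finset.card_le_univ S)
  simp only [Forms.sum_apply, proj_apply]
  simp [hS]

theorem isInternal_baseGrading : DirectSum.IsInternal (baseGrading (formsCoaction q)) := by
  have hmem : ∀ {m : ℕ} {x : baseForms (formsCoaction q)}, x ∈ baseGrading (formsCoaction q) m ↔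
      (x : FormsA q) ∈ degree (dataA q) m := Iff.rfl
  constructor
  -- The projections recover each component from the sum, which gives injectivity.
  · have hproj : ∀ (x : DirectSum ℕ fun m => baseGrading (formsCoaction q) m) (m : ℕ),
        (proj (dataA q) m (DirectSum.coeAddMonoidHom (baseGrading (formsCoaction q)) x :
          baseForms (formsCoaction q)) : FormsA q) = (x m : baseForms (formsCoaction q)) := by
      intro x m
      induction x using DirectSum.induction_on with
      | zero => simp
      | of i x =>
        rw [DirectSum.coeAddMonoidHom_of, proj_of_mem (hmem.1 x.2)]
        split_ifs with h
        · subst h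
          rw [DirectSum.of_eq_same]
        · rw [DirectSum.of_eq_of_ne _ _ _ (Ne.symm h)]
          rfl
      | add x y hx hy =>
        rw [map_add, AddMemClass.coe_add, map_add, AddMemClass.coe_add, hx, hy,
          DirectSum.add_apply]
        rfl
    intro x y hxy
    refine DFinsupp.ext fun m => Subtype.ext (Subtype.ext ?_)
    rw [← hproj x, ← hproj y]
    exact congrArg (fun z : baseForms (formsCoaction q) =>
      (proj (dataA q) m (z : FormsA q) : FormsA q)) hxy
  · intro ω
    refine ⟨∑ m ∈ Finset.range (3 + 1), DirectSum.of
      (fun m => baseGrading (formsCoaction q) m) m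
        ⟨⟨proj (dataA q) m ω, proj_mem_baseForms q ω.2 m⟩, (proj (dataA q) m (ω : FormsA q)).2⟩, ?_⟩
    rw [map_sum]
    simp only [DirectSum.coeAddMonoidHom_of]
    refine Subtype.ext ?_
    rw [AddSubmonoidClass.coe_finsetSum]
    exact sum_proj (dataA q) (ω : FormsA q)

theorem isDGA_base (hd : ∀ ω ∈ baseForms (formsCoaction q), dA q ω ∈ baseForms (formsCoaction q)) :
    IsDGA (baseGrading (formsCoaction q)) (baseD (formsCoaction q) (dA q) hd) where
  one_mem := (isDGA_formsA q).one_mem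
  mul_mem m n ω hω η hη := (isDGA_formsA q).mul_mem m n ω hω η hη
  internal := isInternal_baseGrading q
  d_mem n ω hω := (isDGA_formsA q).d_mem n ω hω
  d_d ω := Subtype.ext ((isDGA_formsA q).d_d ω)
  leibniz n ω hω η := Subtype.ext ((isDGA_formsA q).leibniz n ω hω η)

theorem eq_incl_of_mem_degree_zero {ω : FormsA q} (hω : ω ∈ degree (dataA q) 0) :
    ω = inclA q (ω ∅) := by
  ext U
  rw [incl_apply]
  by_cases hU : U = ∅
  · subst hU
    simp [mono]
  · rw [hω U (by simpa using hU)]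
    simp [mono, hU]

/-- This is generation of the base calculus by `B`. Degree one uses the determinant identities,
degree two the volume form, and higher degrees are zero. -/
theorem mem_podlesRange_mul_podlesDRange_pow {n : ℕ} {ω : FormsA q} (hn : ω ∈ degree (dataA q) n)
    (hω : ω ∈ baseForms (formsCoaction q)) : ω ∈ podlesRange q * podlesDRange q ^ n := by
  have h := (mem_baseForms_iff q ω).1 hω
  match n with
  | 0 =>
    rw [pow_zero, mul_one, eq_incl_of_mem_degree_zero q hn]
    have h0 := (h ∅).2 (by decide)
    rw [coactionWeight_empty, neg_zero] at h0
    exact incl_mem_podlesRange q h0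
  | 1 =>
    obtain ⟨a, ha, b, hb, rfl⟩ := (mem_baseForms_degree_one_iff q ω).1 ⟨hn, hω⟩
    rw [pow_one]
    exact incl_mul_ePlus_add_incl_mul_eMinus_mem q ha hb
  | 2 =>
    -- The only two-element monomial without `e⁰` is `e⁺ ∧ e⁻`, and its coefficient has degree zero.
    have hω' : ω = inclA q (ω {0, 1}) * (ePlus q * eMinus q) := by
      rw [ePlus_mul_eMinus, incl_mul_e]
      ext U
      by_cases hU : U = {0, 1}
      · subst hU
        simp [mono]
      · rw [mono, if_neg hU]
        by_cases h2 : 2 ∈ U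
        · exact (h U).1 h2
        · refine hn U ?_
          revert hU h2
          revert U
          decide
    have hR := podlesRange_mul_podlesRange q
    rw [hω', pow_two, ← mul_assoc]
    refine mul_le_mul' (mul_le_mul' hR le_rfl) le_rfl ?_
    rw [mul_assoc (podlesRange q), mul_assoc (podlesRange q)]
    have h01 := (h {0, 1}).2 (by decide)
    rw [coactionWeight_zero_one, neg_zero] at h01
    exact Submodule.mul_mem_mul (incl_mem_podlesRange q h01) (ePlus_mul_eMinus_mem q)
  | n + 3 =>
    -- A monomial of three or more generators must contain `e⁰`.
    have h0 : ω = 0 := by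
      ext U
      by_cases h2 : 2 ∈ U
      · exact (h U).1 h2
      · refine hn U fun hU => h2 ?_
        have h3 : U.card ≤ 3 := by simpa using Finset.card_le_univ U
        have hU' : U = Finset.univ := Finset.card_eq_iff_eq_univ U |>.1 (by simp; omega)
        simp [hU']
    rw [h0]
    exact zero_mem _

theorem isDifferentialCalculus_base
    (hd : ∀ ω ∈ baseForms (formsCoaction q), dA q ω ∈ baseForms (formsCoaction q))
    (hι : ∀ b : podles q, podlesIncl q b ∈ baseForms (formsCoaction q)) :
    IsDifferentialCalculus (A := podles q) (baseGrading (formsCoaction q))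
      (baseD (formsCoaction q) (dA q) hd)
      ((podlesIncl q).codRestrict (baseForms (formsCoaction q)) hι) := by
  refine (isDGA_base q hd).isDifferentialCalculus ?_ ?_ fun n ω hω => ?_
  · intro a b hab
    exact Subtype.ext (incl_injective (dataA q) (congrArg Subtype.val hab))
  · refine le_antisymm ?_ fun ω hω => ?_
    · rintro _ ⟨b, rfl⟩
      exact incl_mem_degree (dataA q) (b : SUq q)
    · have h := ((mem_baseForms_iff q ω).1 ω.2 ∅).2 (by decide)
      rw [coactionWeight_empty, neg_zero] at h
      exact ⟨⟨(ω : FormsA q) ∅, (mem_podles_iff q).2 h⟩,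
        Subtype.ext (eq_incl_of_mem_degree_zero q hω).symm⟩
  -- Generation was proved inside `Ω(A)`; the inclusion of the base forms is an injective
  -- homomorphism, so it transfers back.
  · have hmap : Submodule.map (baseForms (formsCoaction q)).val.toLinearMap
        (LinearMap.range
            ((podlesIncl q).codRestrict (baseForms (formsCoaction q)) hι).toLinearMap *
          LinearMap.range (baseD (formsCoaction q) (dA q) hd ∘ₗ
            ((podlesIncl q).codRestrict (baseForms (formsCoaction q)) hι).toLinearMap) ^ n) =
          podlesRange q * podlesDRange q ^ n := by
      rw [Submodule.map_mul, Submodule.map_pow, ← LinearMap.range_comp, ← LinearMap.range_comp]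
      rfl
    obtain ⟨η, hη, hηω⟩ := hmap.ge (mem_podlesRange_mul_podlesDRange_pow q hω ω.2)
    rwa [← show η = ω from Subtype.ext hηω]

end BaseCalculus

end QHopf

end

open QHopf

theorem mainTheorem11 {k : Type*} [Field k] (q : kˣ) :
    -- `Ω(H)` and `Ω(A)` are differential calculi on `H` and on `A`
    IsDifferentialCalculus (Forms.degree (dataH q)) (dH q) (Forms.incl (dataH q)) ∧
    IsDifferentialCalculus (Forms.degree (dataA q)) (dA q) (inclA q) ∧
    -- the basis one-forms in terms of the differential
    ePlus q = (q : k)⁻¹ • (inclA q (gen q .α) *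
        dA q (inclA q (gen q .γ))) -
      ((q : k) ^ 2)⁻¹ • (inclA q (gen q .γ) *
        dA q (inclA q (gen q .α))) ∧
    eMinus q = inclA q (gen q .δ) * dA q (inclA q (gen q .β)) -
      (q : k) • (inclA q (gen q .β) * dA q (inclA q (gen q .δ))) ∧
    eZero q = inclA q (gen q .δ) * dA q (inclA q (gen q .α)) -
      (q : k) • (inclA q (gen q .β) * dA q (inclA q (gen q .γ))) ∧
    -- the calculus `Ω(A)` is complete
    (∃! Φ, IsHopfExtension q Φ) ∧
    ∀ Φ, IsHopfExtension q Φ →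
      -- the base one-forms
      (∀ ω : FormsA q, (ω ∈ Forms.degree (dataA q) 1 ∧ ω ∈ baseForms Φ) ↔
        ∃ a ∈ degreePart q (-2), ∃ b ∈ degreePart q 2,
          ω = inclA q a * ePlus q + inclA q b * eMinus q) ∧
      -- they lie in `B dB`
      (∀ a ∈ degreePart q (-2), ∀ b ∈ degreePart q 2,
        inclA q a * ePlus q + inclA q b * eMinus q ∈
          Submodule.span k {ω | ∃ b₀ b₁ : podles q,
            ω = podlesIncl q b₀ * dA q (podlesIncl q b₁)}) ∧
      -- the volume form is generated by `B`
      ePlus q * eMinus q ∈ Submodule.span k {ω | ∃ b₀ b₁ b₂ : podles q,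
        ω = podlesIncl q b₀ * dA q (podlesIncl q b₁) * dA q (podlesIncl q b₂)} ∧
      -- the base forms, with the restricted differential, are a differential calculus on `B`
      ∃ (hd : ∀ ω ∈ baseForms Φ, dA q ω ∈ baseForms Φ)
        (hι : ∀ b : podles q, podlesIncl q b ∈ baseForms Φ),
        IsDifferentialCalculus (A := podles q) (baseGrading Φ) (baseD Φ (dA q) hd)
          ((podlesIncl q).codRestrict (baseForms Φ) hι) := by
  refine ⟨isDifferentialCalculus_formsH q, isDifferentialCalculus_formsA q, ePlus_eq q, eMinus_eq q,
    eZero_eq q, ⟨formsCoaction q, isHopfExtension_formsCoaction q, fun Ψ hΨ =>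
      IsHopfExtension.unique q hΨ (isHopfExtension_formsCoaction q)⟩, fun Φ hΦ => ?_⟩
  -- Uniqueness replaces the arbitrary extension by the explicit one, for which coefficients are
  -- computable.
  obtain rfl := IsHopfExtension.unique q hΦ (isHopfExtension_formsCoaction q)
  exact ⟨mem_baseForms_degree_one_iff q,
    fun a ha b hb => podlesRange_mul_podlesDRange_le q
      (incl_mul_ePlus_add_incl_mul_eMinus_mem q ha hb),
    podlesRange_mul_podlesDRange_mul_podlesDRange_le q (ePlus_mul_eMinus_mem q),
    fun ω hω => dA_mem_baseForms q hΦ hω, podlesIncl_mem_baseForms q,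
    isDifferentialCalculus_base q _ _⟩
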